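/- Let $M$ be a (Hausdorff, second countable) $C^\infty$ manifold of dimension $n\ge 2$, let $2\le k\le\infty$, and let "smooth" mean $C^k$. *Cones.* A (strong) cone in a real vector space $V$ of dimension $n$ is a non-empty smooth embedded hypersurface $\mathcal C_0\subset V\setminus\{0\}$ that is invariant under multiplication by positive scalars, satisfies $v\in\mathcal C_0\Rightarrow -v\notin\mathcal C_0$, is the boundary in $V\setminus\{0\}$ of a convex open set $A_0\subset V\setminus\{0\}$, and whose second fundamental form with respect to directions pointing to $A_0$ is positive semi-definite with radical at each $v\in\mathcal C_0$ spanned by $v$. A cone structure on $M$ is a smooth embedded hypersurface $\mathcal C\subset TM$, transverse to the fibres of $TM$, such that $\mathcal C\cap T_pM$ is a strong cone in $T_pM$ for every $p\in M$. *Lorentz-Finsler metrics.* The fundamental tensor at $v$ of a function $L$ on (a subset of) a vector space is $g_v(u,w)=\frac12\frac{\partial^2}{\partial r\partial s}L(v+ru+sw)|_{r=s=0}$. A Lorentz-Finsler metric with domain $A$ is a positive function $L$ on an open set $A\subset TM\setminus\mathbf 0$ such that: each $A_p=A\cap T_pM$ is non-empty, connected and invariant under positive scalars; the closure of $A$ in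 $TM\setminus\mathbf 0$ and that of each $A_p$ in $T_pM\setminus\{0\}$ are smooth manifolds with boundary; $L$ is positively homogeneous of degree $2$ on each $A_p$ and extends smoothly, by zero on the boundary, to the closure of $A$ in $TM\setminus\mathbf 0$; and for every $p$ the fundamental tensor of $L|_{T_pM}$ is non-degenerate on the closure of $A_p$ in $T_pM\setminus\{0\}$ and has index $n-1$ on $A_p$. Its cone structure is the boundary of $A$ in $TM\setminus\mathbf 0$. It is said to be defined on all of $TM$ if $L$ is the restriction to $A$ of a continuous function on $TM$, also denoted $L$, which vanishes on the boundary of $A$ in $TM\setminus\mathbf 0$, is smooth on $TM\setminus\mathbf 0$ and fibrewise positively homogeneous of degree $2$, and whose fundamental tensor is non-degenerate of index $n-1$ at every $v\in TM\setminus\mathbf 0$. *Cone triples.* A cone triple $(\Omega,T,F)$ consists of a smooth one-form $\Omega$, a smooth vector field $T$ with $\Omega(T)\equiv1$, and a smooth Finsler metric $F$ on the bundle $\ker\Omega$: $F$ is smooth and positive off the zero section, zero on it, positively homogeneous of degree $1$, and the fundamental tensor of $F^2$ on each fibre of $\ker\Omega$ is positive definite at nonzero vectors. Let $\pi(v)=v-\Omega(v)T$.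 The triple is associated with $\mathcal C$ if, for all $v\in TM\setminus\mathbf 0$, $v\in\mathcal C\iff v=F(\pi(v))T+\pi(v)$. Its continuous metric is $G(tT_p+w)=t^2-F(w)^2$ for $t\in\mathbb R$, $w\in\ker\Omega_p$. **Statement.** Let $\mathcal C$ be a cone structure on $M$. Then: 1. $\mathcal C$ is the cone structure of a smooth Lorentz-Finsler metric defined on all of $TM$. 2. There is a cone triple associated with $\mathcal C$. Moreover, for every cone triple $(\Omega,T,F)$ associated with $\mathcal C$ and every open neighbourhood $\mathcal U\subset TM$ of the image of the section $T$, there is a metric $L$ as in 1 such that $L(v)=G(v)$ for every $v\in TM$ for which neither $v$ nor its reflection $v-2\Omega(v)T$ has a positive multiple in $\mathcal U$. -/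

import Mathlib

open Set Filter Bundle
open scoped Topology Manifold ContDiff

noncomputable section

/-! ### Hypersurfaces and domains with smooth boundary -/

section Hypersurface

variable {E' : Type*} [NormedAddCommGroup E'] [NormedSpace ℝ E'] {H' : Type*}
  [TopologicalSpace H'] (J : ModelWithCorners ℝ E' H') {N : Type*} [TopologicalSpace N]
  [ChartedSpace H' N]

/-- `f` is a `C^k` function on the open neighbourhood `U` of the point `x ∈ S`, with nonzero
differential at `x`, whose zero set in `U` is `S ∩ U`. The tangent space `T_x S` is then the kernel
of the differential of `f` at `x`. -/
structure IsLocalDefiningFunction (k : ℕ∞) (S : Set N) (x : N) (U : Set N) (f : N → ℝ) :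
    Prop where
  isOpen : IsOpen U
  mem : x ∈ U
  smooth : ContMDiffOn J 𝓘(ℝ, ℝ) k f U
  regular : mfderiv J 𝓘(ℝ, ℝ) f x ≠ 0
  zero_set : S ∩ U = {y ∈ U | f y = 0}

/-- `S` is an embedded hypersurface of class `C^k`: locally a regular level set. -/
def IsEmbeddedHypersurface (k : ℕ∞) (S : Set N) : Prop :=
  ∀ x ∈ S, ∃ U f, IsLocalDefiningFunction J k S x U f

/-- For an open set `A` of `N` and a closed set `Z`, the closure of `A` in `N \ Z` is an embedded
`C^k` manifold with boundary (of full dimension) whose boundary is the topological boundary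
`frontier A \ Z`. -/
def HasSmoothBoundaryOff (k : ℕ∞) (Z A : Set N) : Prop :=
  ∀ x ∈ frontier A \ Z, ∃ U f, IsLocalDefiningFunction J k (frontier A) x U f ∧
    A ∩ U = {y ∈ U | 0 < f y}

end Hypersurface

/-! ### Cones in a vector space -/

section VectorSpace

variable {E : Type*} [NormedAddCommGroup E] [NormedSpace ℝ E]

/-- Invariance under multiplication by positive scalars. -/
def IsConic (S : Set E) : Prop := ∀ v ∈ S, ∀ c : ℝ, 0 < c → c • v ∈ S

/-- Second fundamental form at `v`, with respect to the transverse direction `N`, of the affine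
hypersurface with local defining function `f`: the value `σ(X, Y)` with
`D_X Y = ∇_X Y + σ(X, Y) N`, for `X`, `Y` in the tangent space `ker (Df_v)`. -/
def affineSecondFundamentalForm (f : E → ℝ) (v N X Y : E) : ℝ :=
  -(fderiv ℝ (fderiv ℝ f) v X Y) / fderiv ℝ f v N

/-- Non-radial strong convexity of the hypersurface `C₀` towards `A₀`: the second fundamental form
with respect to any transverse direction `N` pointing to `A₀` is positive semi-definite and its
radical is spanned by the radial direction. -/
def IsRadiallyStronglyConvex (k : ℕ∞) (C₀ A₀ : Set E) : Prop :=
  ∀ v ∈ C₀, ∀ U f, IsLocalDefiningFunction 𝓘(ℝ, E) k C₀ v U f →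
    ∀ N : E, fderiv ℝ f v N ≠ 0 → (∀ᶠ t : ℝ in 𝓝[>] 0, v + t • N ∈ A₀) →
      (∀ X, fderiv ℝ f v X = 0 → 0 ≤ affineSecondFundamentalForm f v N X X) ∧
      ∀ X, fderiv ℝ f v X = 0 →
        ((∀ Y, fderiv ℝ f v Y = 0 → affineSecondFundamentalForm f v N X Y = 0) ↔
          X ∈ Submodule.span ℝ {v})

/-- `C₀` is a strong (salient) cone of class `C^k` in `E`, with interior `A₀`. -/
structure IsStrongConeWithInterior (k : ℕ∞) (C₀ A₀ : Set E) : Prop where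
  nonempty : C₀.Nonempty
  zero_notMem : (0 : E) ∉ C₀
  hypersurface : IsEmbeddedHypersurface 𝓘(ℝ, E) k C₀
  conic : IsConic C₀
  salient : ∀ v ∈ C₀, -v ∉ C₀
  isOpen_interior : IsOpen A₀
  zero_notMem_interior : (0 : E) ∉ A₀
  convex_interior : Convex ℝ A₀
  boundary : frontier A₀ \ {0} = C₀
  stronglyConvex : IsRadiallyStronglyConvex k C₀ A₀

/-- `C₀` is a strong cone of class `C^k` in `E`. -/
def IsStrongCone (k : ℕ∞) (C₀ : Set E) : Prop := ∃ A₀, IsStrongConeWithInterior k C₀ A₀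

/-! ### Fundamental tensors and Lorentz-Minkowski norms -/

/-- The fundamental tensor `g_v(u, w) = (1/2) ∂²/∂r∂s L(v + r u + s w)` at `r = s = 0`. -/
def fundamentalTensor (L : E → ℝ) (v u w : E) : ℝ :=
  (1 / 2) * deriv (fun r : ℝ => deriv (fun s : ℝ => L (v + r • u + s • w)) 0) 0

def IsNondegenerateForm (B : E → E → ℝ) : Prop := ∀ u, (∀ w, B u w = 0) → u = 0

/-- The index of `B`, i.e. the largest dimension of a subspace on which `B` is negative definite,
is `m`. -/
def HasIndex (B : E → E → ℝ) (m : ℕ) : Prop :=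
  IsGreatest {d : ℕ | ∃ W : Submodule ℝ E, Module.finrank ℝ W = d ∧
    ∀ u ∈ W, u ≠ 0 → B u u < 0} m

/-- `L₀` is a properly Lorentz-Minkowski norm of class `C^k` with domain `A₀`; the values of `L₀` on
the boundary of `A₀` in `E \ {0}` are those of its extension by zero. -/
structure IsProperlyLorentzMinkowski (k : ℕ∞) (A₀ : Set E) (L₀ : E → ℝ) : Prop where
  isOpen : IsOpen A₀
  isConnected : IsConnected A₀
  zero_notMem : (0 : E) ∉ A₀
  conic : IsConic A₀
  pos : ∀ v ∈ A₀, 0 < L₀ v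
  homogeneous : ∀ v ∈ A₀, ∀ c : ℝ, 0 < c → L₀ (c • v) = c ^ 2 * L₀ v
  boundary : HasSmoothBoundaryOff 𝓘(ℝ, E) k {0} A₀
  zero_boundary : ∀ v ∈ frontier A₀ \ {0}, L₀ v = 0
  smooth_extension : ∃ (O : Set E) (L' : E → ℝ), IsOpen O ∧ closure A₀ \ {0} ⊆ O ∧
    ContDiffOn ℝ k L' O ∧ EqOn L' L₀ (closure A₀ \ {0}) ∧
    (∀ v ∈ closure A₀ \ {0}, IsNondegenerateForm (fundamentalTensor L' v)) ∧
    ∀ v ∈ A₀, HasIndex (fundamentalTensor L' v) (Module.finrank ℝ E - 1)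

end VectorSpace

/-! ### Cone structures, cone triples and Lorentz-Finsler metrics on a manifold -/

section Manifold

variable {E : Type*} [NormedAddCommGroup E] [NormedSpace ℝ E] {M : Type*} [TopologicalSpace M]
  [ChartedSpace E M]

/-- The part over `p` of a subset of `TM`, as a subset of `T_pM`. -/
def fiberAt (S : Set (TangentBundle 𝓘(ℝ, E) M)) (p : M) : Set E :=
  {v : E | (⟨p, v⟩ : TangentBundle 𝓘(ℝ, E) M) ∈ S}

/-- The restriction to `T_pM` of a function on `TM`. -/
def restrictAt (L : TangentBundle 𝓘(ℝ, E) M → ℝ) (p : M) : E → ℝ :=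
  fun v => L ⟨p, v⟩

/-- The zero section of `TM`. -/
def zeroVectors (E : Type*) [NormedAddCommGroup E] [NormedSpace ℝ E] (M : Type*)
    [TopologicalSpace M] [ChartedSpace E M] : Set (TangentBundle 𝓘(ℝ, E) M) :=
  {v | v.2 = 0}

/-- Multiplication by a scalar in the fibres of `TM`. -/
def scaleVector (c : ℝ) (v : TangentBundle 𝓘(ℝ, E) M) : TangentBundle 𝓘(ℝ, E) M :=
  ⟨v.1, c • v.2⟩

variable [IsManifold 𝓘(ℝ, E) ∞ M]

/-- The tangent space at `v` of the fibre `T_pM` of `TM`, inside `T_v(TM)`. -/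
def tangentOfFiber (p : M) (v : E) :
    Submodule ℝ (TangentSpace 𝓘(ℝ, E).tangent (⟨p, v⟩ : TangentBundle 𝓘(ℝ, E) M)) :=
  LinearMap.range (mfderiv 𝓘(ℝ, E) 𝓘(ℝ, E).tangent
    (fun w : E => (⟨p, w⟩ : TangentBundle 𝓘(ℝ, E) M)) v).toLinearMap

/-- A (strong) cone structure of class `C^k` on `M`: an embedded hypersurface of `TM` that is
transverse to the fibres of `TM` and meets each of them in a strong cone. -/
structure IsConeStructure (k : ℕ∞) (C : Set (TangentBundle 𝓘(ℝ, E) M)) : Prop where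
  hypersurface : IsEmbeddedHypersurface 𝓘(ℝ, E).tangent k C
  transverse : ∀ (p : M) (v : E), (⟨p, v⟩ : TangentBundle 𝓘(ℝ, E) M) ∈ C →
    ∀ U Φ, IsLocalDefiningFunction 𝓘(ℝ, E).tangent k C ⟨p, v⟩ U Φ →
      tangentOfFiber p v ⊔
        LinearMap.ker (mfderiv 𝓘(ℝ, E).tangent 𝓘(ℝ, ℝ) Φ ⟨p, v⟩).toLinearMap = ⊤
  strongCone : ∀ p : M, IsStrongCone k (fiberAt C p)

/-- `L` is a Lorentz-Finsler metric of class `C^k` on `M` with domain `A`; the values of `L` on the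
boundary of `A` in `TM \ 0` are those of its smooth extension by zero. -/
structure IsLorentzFinslerMetric (k : ℕ∞) (A : Set (TangentBundle 𝓘(ℝ, E) M))
    (L : TangentBundle 𝓘(ℝ, E) M → ℝ) : Prop where
  isOpen : IsOpen A
  boundary : HasSmoothBoundaryOff 𝓘(ℝ, E).tangent k (zeroVectors E M) A
  zero_boundary : ∀ v ∈ frontier A \ zeroVectors E M, L v = 0
  smooth_extension : ∃ (O : Set (TangentBundle 𝓘(ℝ, E) M)) (L' : TangentBundle 𝓘(ℝ, E) M → ℝ),
    IsOpen O ∧ closure A \ zeroVectors E M ⊆ O ∧ ContMDiffOn 𝓘(ℝ, E).tangent 𝓘(ℝ, ℝ) k L' O ∧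
    EqOn L' L (closure A \ zeroVectors E M)
  properlyLorentzMinkowski : ∀ p : M,
    IsProperlyLorentzMinkowski k (fiberAt A p) (restrictAt L p)

/-- `L` is defined on all of `TM` as a two-homogeneous function, continuous on `TM` and `C^k` away
from the zero section, whose fundamental tensor has index `n - 1` at every nonzero vector. -/
structure IsLorentzianOnTangentBundle (k : ℕ∞) (L : TangentBundle 𝓘(ℝ, E) M → ℝ) : Prop where
  continuous : Continuous L
  smooth : ContMDiffOn 𝓘(ℝ, E).tangent 𝓘(ℝ, ℝ) k L (zeroVectors E M)ᶜ
  homogeneous : ∀ v, ∀ c : ℝ, 0 < c → L (scaleVector c v) = c ^ 2 * L v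
  nondegenerate : ∀ (p : M) (v : E), v ≠ 0 →
    IsNondegenerateForm (fundamentalTensor (restrictAt L p) v)
  index : ∀ (p : M) (v : E), v ≠ 0 →
    HasIndex (fundamentalTensor (restrictAt L p) v) (Module.finrank ℝ E - 1)

/-- `L` is a Lorentz-Finsler metric defined on all of `TM`, and its cone structure (the boundary in
`TM \ 0` of its cone domain) is `C`. -/
def IsGlobalLorentzFinslerMetricWithCone (k : ℕ∞) (C : Set (TangentBundle 𝓘(ℝ, E) M))
    (L : TangentBundle 𝓘(ℝ, E) M → ℝ) : Prop :=
  IsLorentzianOnTangentBundle k L ∧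
    ∃ A, IsLorentzFinslerMetric k A L ∧ frontier A \ zeroVectors E M = C

/-- The projection `v ↦ v - Ω(v) T` of `TM` onto `ker Ω` along `T`. -/
def kerProj (Ω : (p : M) → TangentSpace 𝓘(ℝ, E) p →L[ℝ] ℝ) (T : (p : M) → TangentSpace 𝓘(ℝ, E) p)
    (v : TangentBundle 𝓘(ℝ, E) M) : TangentBundle 𝓘(ℝ, E) M :=
  ⟨v.1, v.2 - Ω v.1 v.2 • T v.1⟩

/-- A cone triple of class `C^k`: a one-form `Ω`, a vector field `T` with `Ω(T) = 1` and a Finsler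
metric `F` on the bundle `ker Ω`, extended by zero to the zero section. Only the values of `F` on
`ker Ω` matter. -/
structure IsConeTriple (k : ℕ∞) (Ω : (p : M) → TangentSpace 𝓘(ℝ, E) p →L[ℝ] ℝ)
    (T : (p : M) → TangentSpace 𝓘(ℝ, E) p) (F : TangentBundle 𝓘(ℝ, E) M → ℝ) : Prop where
  smooth_form : ContMDiff 𝓘(ℝ, E).tangent 𝓘(ℝ, ℝ) k
    (fun v : TangentBundle 𝓘(ℝ, E) M => Ω v.1 v.2)
  smooth_field : ContMDiff 𝓘(ℝ, E) 𝓘(ℝ, E).tangent k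
    (fun p => (⟨p, T p⟩ : TangentBundle 𝓘(ℝ, E) M))
  unit : ∀ p, Ω p (T p) = 1
  finsler_smooth : ContMDiffOn 𝓘(ℝ, E).tangent 𝓘(ℝ, ℝ) k F
    {v | Ω v.1 v.2 = 0 ∧ v ∉ zeroVectors E M}
  finsler_zero : ∀ v ∈ zeroVectors E M, F v = 0
  finsler_pos : ∀ v, Ω v.1 v.2 = 0 → v ∉ zeroVectors E M → 0 < F v
  finsler_homogeneous : ∀ v, Ω v.1 v.2 = 0 → ∀ c : ℝ, 0 < c → F (scaleVector c v) = c * F v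
  finsler_posDef : ∀ (p : M) (v u : E), Ω p v = 0 → Ω p u = 0 → v ≠ 0 → u ≠ 0 →
    0 < fundamentalTensor (fun w => restrictAt F p w ^ 2) v u u

/-- The cone triple `(Ω, T, F)` is associated with `C`: a nonzero `v` lies in `C` if and only if
`v = F(π(v)) T + π(v)`, where `π` is the projection onto `ker Ω` along `T`. -/
def IsAssociatedTriple (Ω : (p : M) → TangentSpace 𝓘(ℝ, E) p →L[ℝ] ℝ)
    (T : (p : M) → TangentSpace 𝓘(ℝ, E) p) (F : TangentBundle 𝓘(ℝ, E) M → ℝ)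
    (C : Set (TangentBundle 𝓘(ℝ, E) M)) : Prop :=
  ∀ v, v ∉ zeroVectors E M →
    (v ∈ C ↔ v.2 = F (kerProj Ω T v) • T v.1 +
      (v.2 - Ω v.1 v.2 • T v.1))

/-- The continuous Lorentz-Finsler metric `G(t T + w) = t² - F(w)²`, `w ∈ ker Ω`, of a cone
triple. -/
def continuousMetric (Ω : (p : M) → TangentSpace 𝓘(ℝ, E) p →L[ℝ] ℝ)
    (T : (p : M) → TangentSpace 𝓘(ℝ, E) p) (F : TangentBundle 𝓘(ℝ, E) M → ℝ)
    (v : TangentBundle 𝓘(ℝ, E) M) : ℝ :=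
  (Ω v.1 v.2) ^ 2 - F (kerProj Ω T v) ^ 2

/-- The reflection `t T + w ↦ -t T + w`, `w ∈ ker Ω`. -/
def reflectVector (Ω : (p : M) → TangentSpace 𝓘(ℝ, E) p →L[ℝ] ℝ)
    (T : (p : M) → TangentSpace 𝓘(ℝ, E) p) (v : TangentBundle 𝓘(ℝ, E) M) :
    TangentBundle 𝓘(ℝ, E) M :=
  ⟨v.1, v.2 - (2 * Ω v.1 v.2) • T v.1⟩

/-- The vectors with a positive multiple in `U`. -/
def radialSaturation (U : Set (TangentBundle 𝓘(ℝ, E) M)) : Set (TangentBundle 𝓘(ℝ, E) M) :=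
  {v | ∃ c : ℝ, 0 < c ∧ scaleVector c v ∈ U}

end Manifold

end

open Set Filter Bundle
open scoped Topology Manifold ContDiff

/-! ### Fundamental tensors and the Lorentzian index -/

section FundamentalTensor

variable {E : Type*} [NormedAddCommGroup E] [NormedSpace ℝ E]

/-! A cone triple comes from cutting the cones by lines. A salient convex cone has a vector `T` in
its interior and a form `Ω` positive on its closure off the origin. Both conditions are convex, so
local choices glue with partitions of unity. For nonzero `w` in `ker Ω` the line `w + t T` meets the
cone exactly once, at some `t > 0`, and `F w` is that `t`. Interior directions are never tangent to
the cone (`IsStrongConeWithInterior.fderiv_ne_zero`), so the implicit function theorem makes `F`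
smooth (`IsConeStructure.exists_crossing`). Non-radial strong convexity gives the positive
definiteness of the Hessian of `F ^ 2` (`deriv_deriv_sq_crossingParameter_pos`): its second
derivative along a line is `2 F' ^ 2 + 2 F F''` with `F'' ≥ 0`, and if `F'' = 0` the lifted tangent
vector is radial, which forces `F' ≠ 0`. The interiors are given fibre by fibre, with no continuity
in the base point. Local existence of `(Ω, T)` therefore uses a reformulation by crossings, which is
open: `T` is interior and the form is positive on the closure as soon as every line parallel to `T`
through a nonzero vector of the kernel meets the cone at a positive parameter
(`mem_interior_of_forall_exists`).

The continuous metric `G = t ^ 2 - F ^ 2` may fail to be smooth along `ℝ T`, where `F ^ 2` need not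
be twice differentiable. There `F ^ 2` is replaced by a smooth maximum of `F ^ 2` and a small
positive definite quadratic form `ε B`, the scale of the maximum being `ε t ^ 2`, which keeps
homogeneity. Near `ℝ T` the result is quadratic in each fibre; where `F ^ 2 - ε B ≥ 2 ε t ^ 2` it is
still `G`, and this includes neighbourhoods of the cone and of `ker Ω` off the zero section. For
small `ε` the change is confined to directions of the given neighbourhood of `T` and to their
reflections.

The index follows from linear algebra (`isNondegenerateForm_and_hasIndex`). Along `ker Ω` the scale
is constant, and a smooth maximum of strongly convex functions is strongly convex, so the Hessian is
negative on this hyperplane. A positive direction is `T` where the metric is `G`, and the base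
vector itself in the modified region, because there `L > 0` and `g_v(v, v) = L v`. -/

theorem fundamentalTensor_eq_fderiv {L : E → ℝ} {v : E} (h : ContDiffAt ℝ 2 L v) (u w : E) :
    fundamentalTensor L v u w = 1 / 2 * fderiv ℝ (fderiv ℝ L) v u w := by
  have h1 : ∀ᶠ y in 𝓝 v, DifferentiableAt ℝ L y :=
    (h.eventually (by simp)).mono fun y hy => hy.differentiableAt (by simp)
  have hline : Tendsto (fun r : ℝ => v + r • u) (𝓝 0) (𝓝 v) := by
    have : Continuous fun r : ℝ => v + r • u := by fun_prop
    simpa using this.tendsto 0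
  have h2 : (fun r : ℝ => deriv (fun s : ℝ => L (v + r • u + s • w)) 0) =ᶠ[𝓝 0]
      fun r => fderiv ℝ L (v + r • u) w := by
    filter_upwards [hline.eventually h1] with r hr
    have hd : HasDerivAt (fun s : ℝ => v + r • u + s • w) w 0 := by
      simpa using ((hasDerivAt_id (0 : ℝ)).smul_const w).const_add (v + r • u)
    have hr' : HasFDerivAt L (fderiv ℝ L (v + r • u)) (v + r • u + (0 : ℝ) • w) := by
      simpa using hr.hasFDerivAt
    exact (hr'.comp_hasDerivAt (0 : ℝ) hd).deriv
  have h3 : DifferentiableAt ℝ (fderiv ℝ L) v :=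
    (h.fderiv_right (m := 1) (by norm_num)).differentiableAt (by simp)
  have hd : HasDerivAt (fun r : ℝ => v + r • u) u 0 := by
    simpa using ((hasDerivAt_id (0 : ℝ)).smul_const u).const_add v
  have h3' : HasFDerivAt (fderiv ℝ L) (fderiv ℝ (fderiv ℝ L) v) (v + (0 : ℝ) • u) := by
    simpa using h3.hasFDerivAt
  have h4 : HasDerivAt (fun r : ℝ => fderiv ℝ L (v + r • u)) (fderiv ℝ (fderiv ℝ L) v u) 0 :=
    h3'.comp_hasDerivAt (0 : ℝ) hd
  have h5 : HasDerivAt (fun r : ℝ => fderiv ℝ L (v + r • u) w) (fderiv ℝ (fderiv ℝ L) v u w) 0 := by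
    simpa using h4.clm_apply (hasDerivAt_const (0 : ℝ) w)
  rw [fundamentalTensor, h2.deriv_eq, h5.deriv]

/-- On the diagonal the two increments enter only through `r + s`, so no regularity of `L` is needed
and signs reduce to one-variable calculus. -/
theorem fundamentalTensor_self (L : E → ℝ) (v u : E) :
    fundamentalTensor L v u u = 1 / 2 * deriv (deriv fun r : ℝ => L (v + r • u)) 0 := by
  unfold fundamentalTensor
  congr 2
  funext r
  have : (fun s : ℝ => L (v + r • u + s • u)) = fun s => (fun x : ℝ => L (v + x • u)) (r + s) := by
    funext s
    simp only [add_smul, add_assoc]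
  rw [this, deriv_comp_const_add (f := fun x : ℝ => L (v + x • u)) r 0, add_zero]

/-- A negative hyperplane `H` and a positive vector `x` split the space as `H ⊕ ℝ x`. If `h + c x`
is in the radical, then `B h h = c ^ 2 B x x`, which is possible only for `h = 0`, and then `c = 0`.
A negative definite subspace cannot contain `x`, so its dimension is at most `n - 1`. -/
theorem isNondegenerateForm_and_hasIndex [FiniteDimensional ℝ E] {B : E →L[ℝ] E →L[ℝ] ℝ}
    (hB : ∀ u w, B u w = B w u) (H : Submodule ℝ E)
    (hH : Module.finrank ℝ H = Module.finrank ℝ E - 1) (hneg : ∀ u ∈ H, u ≠ 0 → B u u < 0)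
    {x : E} (hx : 0 < B x x) :
    IsNondegenerateForm (fun u w => B u w) ∧
      HasIndex (fun u w => B u w) (Module.finrank ℝ E - 1) := by
  have hx0 : x ≠ 0 := by rintro rfl; simp at hx
  have hpos : 0 < Module.finrank ℝ E := Module.finrank_pos_iff_exists_ne_zero.2 ⟨x, hx0⟩
  have hxH : x ∉ H := fun h => (hneg x h hx0).not_gt hx
  have htop : H ⊔ Submodule.span ℝ {x} = ⊤ := by
    apply Submodule.eq_top_of_finrank_eq
    have hlt : Module.finrank ℝ H < Module.finrank ℝ (H ⊔ Submodule.span ℝ {x} : Submodule ℝ E) := by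
      apply Submodule.finrank_lt_finrank_of_lt
      refine lt_of_le_of_ne le_sup_left fun h => hxH ?_
      rw [h]
      exact Submodule.mem_sup_right (Submodule.mem_span_singleton_self x)
    have := Submodule.finrank_le (H ⊔ Submodule.span ℝ {x} : Submodule ℝ E)
    omega
  refine ⟨fun u hu => ?_, ⟨H, hH, hneg⟩, ?_⟩
  · obtain ⟨h, hh, y, hy, rfl⟩ := Submodule.mem_sup.1 (htop ▸ Submodule.mem_top : u ∈ H ⊔ _)
    obtain ⟨c, rfl⟩ := Submodule.mem_span_singleton.1 hy
    have e1 := hu h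
    have e2 := hu x
    simp only [map_add, map_smul, add_apply, smul_apply,
      smul_eq_mul] at e1 e2
    rw [hB x h] at e1
    have key : B h h = c ^ 2 * B x x := by linear_combination e1 - c * e2
    have hh0 : h = 0 := by
      by_contra hne
      have := hneg h hh hne
      nlinarith [sq_nonneg c]
    subst hh0
    have : c = 0 := by
      have : c * B x x = 0 := by simpa using e2
      exact (mul_eq_zero.1 this).resolve_right hx.ne'
    simp [this]
  · rintro d ⟨W, rfl, hW⟩
    have hxW : x ∉ W := fun h => (hW x h hx0).not_gt hx
    have : Module.finrank ℝ W < Module.finrank ℝ E :=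
      Submodule.finrank_lt fun h => hxW (h ▸ Submodule.mem_top)
    omega

end FundamentalTensor

/-! ### A smooth maximum and its homogeneous perspective -/

section Ramp

/-- A smooth convex function which is constant on `(-∞, 1]` and equal to the identity on
`[2, ∞)`. -/
noncomputable def ramp (x : ℝ) : ℝ := 2 - ∫ t in x..2, Real.smoothTransition (t - 1)

theorem hasDerivAt_ramp (x : ℝ) : HasDerivAt ramp (Real.smoothTransition (x - 1)) x := by
  have hc : Continuous fun t : ℝ => Real.smoothTransition (t - 1) :=
    Real.smoothTransition.continuous.comp (by fun_prop)
  have := (intervalIntegral.integral_hasDerivAt_left (hc.intervalIntegrable x 2)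
    (hc.stronglyMeasurableAtFilter _ _) hc.continuousAt).const_sub 2
  rw [neg_neg] at this
  exact this

theorem deriv_ramp : deriv ramp = fun x => Real.smoothTransition (x - 1) :=
  funext fun x => (hasDerivAt_ramp x).deriv

theorem contDiff_ramp : ContDiff ℝ ∞ ramp := by
  rw [contDiff_infty_iff_deriv]
  refine ⟨fun x => (hasDerivAt_ramp x).differentiableAt, ?_⟩
  rw [deriv_ramp]
  exact Real.smoothTransition.contDiff.comp (by fun_prop)

theorem ramp_of_two_le {x : ℝ} (hx : 2 ≤ x) : ramp x = x := by
  have : ∫ t in x..2, Real.smoothTransition (t - 1) = ∫ t in x..2, (1 : ℝ) := by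
    refine intervalIntegral.integral_congr fun t ht => ?_
    rw [uIcc_of_ge hx] at ht
    exact Real.smoothTransition.one_of_one_le (by linarith [ht.1])
  simp [ramp, this]

theorem ramp_of_le_one {x : ℝ} (hx : x ≤ 1) : ramp x = ramp 1 := by
  have hc : Continuous fun t : ℝ => Real.smoothTransition (t - 1) :=
    Real.smoothTransition.continuous.comp (by fun_prop)
  have h0 : ∫ t in x..1, Real.smoothTransition (t - 1) = ∫ t in x..1, (0 : ℝ) := by
    refine intervalIntegral.integral_congr fun t ht => ?_
    rw [uIcc_of_le hx] at ht
    exact Real.smoothTransition.zero_of_nonpos (by linarith [ht.2])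
  simp only [ramp]
  rw [← intervalIntegral.integral_add_adjacent_intervals (hc.intervalIntegrable x 1)
    (hc.intervalIntegrable 1 2), h0]
  simp

theorem monotone_ramp : Monotone ramp :=
  monotone_of_hasDerivAt_nonneg hasDerivAt_ramp fun _ => Real.smoothTransition.nonneg _

theorem ramp_le_two {x : ℝ} (hx : x ≤ 2) : ramp x ≤ 2 :=
  (monotone_ramp hx).trans_eq (ramp_of_two_le le_rfl)

theorem deriv_deriv_ramp_nonneg (x : ℝ) : 0 ≤ deriv (deriv ramp) x := by
  rw [deriv_ramp]
  exact Monotone.deriv_nonneg fun a b hab => Real.smoothTransition.monotone (by linarith)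

theorem hasDerivAt_deriv_of_contDiffAt {g : ℝ → ℝ} {x : ℝ} (hg : ContDiffAt ℝ 2 g x) :
    HasDerivAt (deriv g) (deriv (deriv g) x) x := by
  have h1 : DifferentiableAt ℝ (fderiv ℝ g) x :=
    (hg.fderiv_right (m := 1) (by norm_num)).differentiableAt (by simp)
  have h2 : DifferentiableAt ℝ (deriv g) x := by
    have : deriv g = fun r => fderiv ℝ g r 1 := by funext r; simp
    rw [this]
    exact h1.clm_apply (differentiableAt_const _)
  exact h2.hasDerivAt

/-- The second derivative of the composition of a convex function with slopes in `[0, 1]`, as in a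
smooth maximum of two strongly convex functions, is negative after a change of sign. -/
theorem deriv_deriv_sub_ramp_neg {a b : ℝ → ℝ} (ha : ContDiffAt ℝ 2 a 0) (hb : ContDiffAt ℝ 2 b 0)
    (ha' : 0 < deriv (deriv a) 0) (hb' : 0 < deriv (deriv b) 0) (c : ℝ) {s : ℝ} (hs : 0 < s) :
    deriv (deriv fun r => c - b r - s * ramp ((a r - b r) / s)) 0 < 0 := by
  have ev {g : ℝ → ℝ} (hg : ContDiffAt ℝ 2 g 0) : ∀ᶠ r in 𝓝 (0 : ℝ), HasDerivAt g (deriv g r) r :=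
    (hg.eventually (by simp)).mono fun y hy => (hy.differentiableAt (by simp)).hasDerivAt
  have ev2 {g : ℝ → ℝ} (hg : ContDiffAt ℝ 2 g 0) : HasDerivAt (deriv g) (deriv (deriv g) 0) 0 :=
    hasDerivAt_deriv_of_contDiffAt hg
  have hr (x : ℝ) : HasDerivAt (deriv ramp) (deriv (deriv ramp) x) x := by
    have : ContDiff ℝ ∞ (deriv ramp) := (contDiff_infty_iff_deriv.1 contDiff_ramp).2
    exact (this.differentiable (by simp) x).hasDerivAt
  have h1 : deriv (fun r => c - b r - s * ramp ((a r - b r) / s)) =ᶠ[𝓝 0]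
      fun r => - deriv b r - deriv ramp ((a r - b r) / s) * (deriv a r - deriv b r) := by
    filter_upwards [ev ha, ev hb] with r har hbr
    have h := ((hbr.const_sub c).sub ((((hasDerivAt_ramp ((a r - b r) / s)).comp r
      ((har.sub hbr).div_const s))).const_mul s)).deriv
    simp only [deriv_ramp]
    refine Eq.trans h ?_
    field_simp
  rw [h1.deriv_eq]
  have h2 := (((ev2 hb).neg).sub (((hr ((a 0 - b 0) / s)).comp (0 : ℝ)
    (((ev ha).self_of_nhds.sub (ev hb).self_of_nhds).div_const s)).mul
      ((ev2 ha).sub (ev2 hb)))).deriv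
  refine lt_of_eq_of_lt h2 ?_
  have k0 : 0 ≤ deriv ramp ((a 0 - b 0) / s) := by
    rw [deriv_ramp]; exact Real.smoothTransition.nonneg _
  have k1 : deriv ramp ((a 0 - b 0) / s) ≤ 1 := by
    rw [deriv_ramp]; exact Real.smoothTransition.le_one _
  have k2 : 0 ≤ deriv (deriv ramp) ((a 0 - b 0) / s) * ((deriv a 0 - deriv b 0) / s) *
      (deriv a 0 - deriv b 0) := by
    have : deriv (deriv ramp) ((a 0 - b 0) / s) * ((deriv a 0 - deriv b 0) / s) *
      (deriv a 0 - deriv b 0) = deriv (deriv ramp) ((a 0 - b 0) / s) *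
        ((deriv a 0 - deriv b 0) ^ 2 / s) := by ring
    rw [this]
    exact mul_nonneg (deriv_deriv_ramp_nonneg _) (by positivity)
  simp only [Function.comp, Pi.sub_apply]
  set q := deriv ramp ((a 0 - b 0) / s)
  -- With `q` the slope of `ramp`, the second derivative is at most `-(1 - q) b'' - q a''`. For `q =
  -- 0` only `b''` contributes; for `q > 0` the term `q a''` is already strictly positive.
  rcases eq_or_lt_of_le k0 with hq | hq
  · rw [← hq]; linarith
  · nlinarith [mul_pos hq ha', mul_nonneg (sub_nonneg.2 k1) hb'.le]

/-- A smooth perspective of `ramp`, equal to `x` for `2 * s ≤ x`. -/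
noncomputable def rampPerspective (x s : ℝ) : ℝ := if 2 * s < x then x else s * ramp (x / s)

theorem rampPerspective_of_lt {x s : ℝ} (h : 2 * s < x) : rampPerspective x s = x := if_pos h

theorem rampPerspective_of_pos {x s : ℝ} (h : 0 < s) : rampPerspective x s = s * ramp (x / s) := by
  unfold rampPerspective
  split_ifs with h'
  · rw [ramp_of_two_le (by rw [le_div_iff₀ h]; exact h'.le)]
    field_simp
  · rfl

theorem rampPerspective_of_two_mul_le {x s : ℝ} (hs : 0 ≤ s) (hs' : s = 0 → 0 ≤ x)
    (h : 2 * s ≤ x) : rampPerspective x s = x := by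
  rcases hs.eq_or_lt with rfl | hs
  · rcases (hs' rfl).eq_or_lt with rfl | hx
    · simp [rampPerspective]
    · exact rampPerspective_of_lt (by simpa)
  · rw [rampPerspective_of_pos hs, ramp_of_two_le (by rwa [le_div_iff₀ hs])]
    field_simp

theorem rampPerspective_le {x s : ℝ} (hs : 0 ≤ s) (h : x ≤ 2 * s) :
    rampPerspective x s ≤ 2 * s := by
  rw [rampPerspective, if_neg h.not_gt, mul_comm]
  gcongr
  exact ramp_le_two (div_le_of_le_mul₀ hs (by norm_num) h)

theorem rampPerspective_mul {x s c : ℝ} (hc : 0 < c) :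
    rampPerspective (c * x) (c * s) = c * rampPerspective x s := by
  unfold rampPerspective
  have : 2 * (c * s) < c * x ↔ 2 * s < x := by
    rw [show 2 * (c * s) = c * (2 * s) by ring, mul_lt_mul_iff_right₀ hc]
  simp only [this]
  split_ifs
  · rfl
  · rw [mul_div_mul_left _ _ hc.ne', mul_assoc]

/-- The two branches agree where both regions overlap, since `ramp` is the identity on `[2, ∞)`. The
branch `2 * s < x` carries smoothness across `s = 0`, which is needed at vectors of `ker Ω`. -/
theorem contDiffAt_rampPerspective {x s : ℝ} (h : 0 < s ∨ 2 * s < x) :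
    ContDiffAt ℝ ∞ (fun p : ℝ × ℝ => rampPerspective p.1 p.2) (x, s) := by
  rcases h with h | h
  · have : ContDiffAt ℝ ∞ (fun p : ℝ × ℝ => p.2 * ramp (p.1 / p.2)) (x, s) :=
      contDiffAt_snd.mul (contDiff_ramp.contDiffAt.comp (x, s)
        (contDiffAt_fst.div contDiffAt_snd h.ne'))
    refine this.congr_of_eventuallyEq ?_
    have : ∀ᶠ p : ℝ × ℝ in 𝓝 (x, s), 0 < p.2 := continuousAt_snd.eventually (lt_mem_nhds h)
    filter_upwards [this] with p hp using rampPerspective_of_pos hp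
  · refine contDiffAt_fst.congr_of_eventuallyEq ?_
    have : ∀ᶠ p : ℝ × ℝ in 𝓝 (x, s), 2 * p.2 < p.1 :=
      (continuous_const.mul continuous_snd).continuousAt.eventually_lt continuousAt_fst h
    filter_upwards [this] with p hp using rampPerspective_of_lt hp

end Ramp

/-! ### Smoothing a Lorentz-Minkowski norm on one vector space -/

section Smoothing

variable {E : Type*} [NormedAddCommGroup E] [NormedSpace ℝ E]

/-- The function `t T + w ↦ t² - m(f², ε B(w, w))`, where `m` is a smooth maximum whose scale is
`ε t²`. -/
noncomputable def smoothedMetric (Ω : E →L[ℝ] ℝ) (T : E) (f : E → ℝ) (B : E →L[ℝ] E →L[ℝ] ℝ)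
    (ε : ℝ) (v : E) : ℝ :=
  Ω v ^ 2 - ε * B (v - Ω v • T) (v - Ω v • T) -
    rampPerspective (f v ^ 2 - ε * B (v - Ω v • T) (v - Ω v • T)) (ε * Ω v ^ 2)

/-- The data from which a Lorentz-Minkowski norm `t² - f²` is smoothed around `T`. -/
structure IsSmoothingData (Ω : E →L[ℝ] ℝ) (T : E) (f : E → ℝ) (B : E →L[ℝ] E →L[ℝ] ℝ)
    (ε : ℝ) : Prop where
  unit : Ω T = 1
  continuous : Continuous f
  contDiffAt : ∀ v, v - Ω v • T ≠ 0 → ContDiffAt ℝ 2 f v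
  map_add_smul : ∀ v (c : ℝ), f (v + c • T) = f v
  map_smul : ∀ v (c : ℝ), 0 < c → f (c • v) = c * f v
  posDef : ∀ v u, Ω v = 0 → Ω u = 0 → v ≠ 0 → u ≠ 0 → 0 < fundamentalTensor (fun w => f w ^ 2) v u u
  form_pos : ∀ v, v ≠ 0 → 0 < B v v
  eps_pos : 0 < ε
  form_lt : ∀ w, Ω w = 0 → w ≠ 0 → ε * B w w < f w ^ 2
  form_lt_one : ∀ w, Ω w = 0 → f w ^ 2 ≤ ε * (B w w + 2) → ε * (B w w + 2) < 1

namespace IsSmoothingData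

variable {Ω : E →L[ℝ] ℝ} {T : E} {f : E → ℝ} {B : E →L[ℝ] E →L[ℝ] ℝ} {ε : ℝ}

section

variable (h : IsSmoothingData Ω T f B ε)
include h

theorem map_proj (v : E) : f (v - Ω v • T) = f v := by
  rw [sub_eq_add_neg, ← neg_smul, h.map_add_smul]

theorem form_proj (v : E) : Ω (v - Ω v • T) = 0 := by simp [h.unit]

omit h in
theorem form_smul (c : ℝ) (x : E) : B (c • x) (c • x) = c ^ 2 * B x x := by
  simp only [_root_.map_smul, smul_apply, smul_eq_mul]
  ring

theorem map_zero : f 0 = 0 := by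
  have := h.map_smul 0 2 (by norm_num)
  rw [smul_zero] at this
  linarith

/-- At `Ω v = 0` the scale vanishes and `form_lt` makes the first argument positive. So the region
where the metric is modified avoids `ker Ω`. -/
theorem coeff_ne_zero {v : E} (hv : v ≠ 0)
    (hx : ¬ 2 * (ε * Ω v ^ 2) < f v ^ 2 - ε * B (v - Ω v • T) (v - Ω v • T)) : Ω v ≠ 0 := by
  intro h0
  apply hx
  have := h.form_lt v h0 hv
  simp only [h0, zero_smul, sub_zero]
  simpa using this

/-- `form_lt_one` is stated on the slice `|t| = 1`; division by `|Ω v|` brings any modified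
direction there. The sign of `t` plays no role, as the condition involves only the component in `ker
Ω`. -/
theorem scaled_lt {v : E} (hv : v ≠ 0)
    (hx : ¬ 2 * (ε * Ω v ^ 2) < f v ^ 2 - ε * B (v - Ω v • T) (v - Ω v • T)) :
    ε * B (v - Ω v • T) (v - Ω v • T) + 2 * (ε * Ω v ^ 2) < Ω v ^ 2 := by
  have ht := h.coeff_ne_zero hv hx
  have ht' : 0 < |Ω v|⁻¹ := inv_pos.2 (abs_pos.2 ht)
  have ht2 : 0 < Ω v ^ 2 := by positivity
  have hsq : |Ω v|⁻¹ ^ 2 = (Ω v ^ 2)⁻¹ := by rw [inv_pow, sq_abs]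
  have key := h.form_lt_one (|Ω v|⁻¹ • (v - Ω v • T)) (by rw [_root_.map_smul, h.form_proj, smul_zero])
  rw [h.map_smul _ _ ht', h.map_proj, form_smul, mul_pow, hsq] at key
  generalize B (v - Ω v • T) (v - Ω v • T) = b at *
  rw [← sub_neg, ← sub_nonpos] at key
  have e1 : (Ω v ^ 2)⁻¹ * f v ^ 2 - ε * ((Ω v ^ 2)⁻¹ * b + 2) =
      (Ω v ^ 2)⁻¹ * (f v ^ 2 - ε * b - 2 * (ε * Ω v ^ 2)) := by field_simp; ring
  have e2 : ε * ((Ω v ^ 2)⁻¹ * b + 2) - 1 =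
      (Ω v ^ 2)⁻¹ * (ε * b + 2 * (ε * Ω v ^ 2) - Ω v ^ 2) := by field_simp
  rw [e1, e2] at key
  have := key (mul_nonpos_of_nonneg_of_nonpos (by positivity) (by linarith))
  have := neg_of_mul_neg_right this (by positivity)
  linarith

/-- In the modified region the perspective is at most `2 ε t ^ 2`, so the metric is at least `t ^ 2
- ε B - 2 ε t ^ 2`, which `scaled_lt` makes positive. -/
theorem smoothedMetric_pos {v : E} (hv : v ≠ 0)
    (hx : ¬ 2 * (ε * Ω v ^ 2) < f v ^ 2 - ε * B (v - Ω v • T) (v - Ω v • T)) :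
    0 < smoothedMetric Ω T f B ε v := by
  have h1 := h.scaled_lt hv hx
  have h2 := rampPerspective_le (mul_nonneg h.eps_pos.le (sq_nonneg (Ω v))) (not_lt.1 hx)
  unfold smoothedMetric
  linarith

theorem smoothedMetric_eq_of_le {v : E}
    (hx : 2 * (ε * Ω v ^ 2) ≤ f v ^ 2 - ε * B (v - Ω v • T) (v - Ω v • T)) :
    smoothedMetric Ω T f B ε v = Ω v ^ 2 - f v ^ 2 := by
  rw [smoothedMetric, rampPerspective_of_two_mul_le (by have := h.eps_pos; positivity) _ hx]
  · ring
  · intro h0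
    rwa [h0, mul_zero] at hx

theorem smoothedMetric_smul (v : E) {c : ℝ} (hc : 0 < c) :
    smoothedMetric Ω T f B ε (c • v) = c ^ 2 * smoothedMetric Ω T f B ε v := by
  have e : c • v - Ω (c • v) • T = c • (v - Ω v • T) := by
    rw [_root_.map_smul, smul_sub, smul_smul, smul_eq_mul]
  have e1 : f (c • v) ^ 2 - ε * B (c • v - Ω (c • v) • T) (c • v - Ω (c • v) • T) =
      c ^ 2 * (f v ^ 2 - ε * B (v - Ω v • T) (v - Ω v • T)) := by
    rw [e, h.map_smul _ _ hc, form_smul]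
    ring
  have e2 : ε * Ω (c • v) ^ 2 = c ^ 2 * (ε * Ω v ^ 2) := by
    rw [_root_.map_smul, smul_eq_mul]; ring
  rw [smoothedMetric, e1, e2, rampPerspective_mul (by positivity), e, form_smul, _root_.map_smul,
    smul_eq_mul, smoothedMetric]
  ring

theorem eventually_lt {v : E}
    (hx : 2 * (ε * Ω v ^ 2) < f v ^ 2 - ε * B (v - Ω v • T) (v - Ω v • T)) :
    ∀ᶠ y in 𝓝 v, 2 * (ε * Ω y ^ 2) < f y ^ 2 - ε * B (y - Ω y • T) (y - Ω y • T) := by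
  have := h.continuous
  exact ContinuousAt.eventually_lt (by fun_prop) (by fun_prop) hx

theorem deriv_deriv_sq_pos {w u : E} (hw : Ω w = 0) (hu : Ω u = 0) (hw0 : w ≠ 0) (hu0 : u ≠ 0) :
    0 < deriv (deriv fun r : ℝ => f (w + r • u) ^ 2) 0 := by
  have := h.posDef w u hw hu hw0 hu0
  rw [fundamentalTensor_self] at this
  linarith

/-- Along `u ∈ ker Ω` both `t` and the scale `ε t ^ 2` are constant. Where the metric is unmodified
only `-f ^ 2` contributes; elsewhere the function is a constant minus a smooth maximum of two
strongly convex functions. -/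
theorem deriv_deriv_smoothedMetric_neg {v u : E} (hv : v ≠ 0) (hu : Ω u = 0) (hu0 : u ≠ 0) :
    deriv (deriv fun r : ℝ => smoothedMetric Ω T f B ε (v + r • u)) 0 < 0 := by
  set w := v - Ω v • T with hw
  have hΩ (r : ℝ) : Ω (v + r • u) = Ω v := by simp [hu]
  have hπ (r : ℝ) : v + r • u - Ω (v + r • u) • T = w + r • u := by rw [hΩ, hw]; abel
  have hf (r : ℝ) : f (v + r • u) = f (w + r • u) := by rw [← hπ, h.map_proj]
  have hline : ContinuousAt (fun r : ℝ => v + r • u) 0 := by fun_prop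
  have hv0 : v + (0 : ℝ) • u = v := by simp
  have hb (c : ℝ) : HasDerivAt (fun r : ℝ => ε * B (w + r • u) (w + r • u))
      (ε * (B u w + B w u + 2 * c * B u u)) c := by
    have e : (fun r : ℝ => ε * B (w + r • u) (w + r • u)) =
        fun r => ε * (B w w + r * (B u w + B w u) + r ^ 2 * B u u) := by
      funext r
      simp only [map_add, _root_.map_smul, add_apply, smul_apply, smul_eq_mul]
      ring
    rw [e]
    have := ((((hasDerivAt_id c).mul_const (B u w + B w u)).const_add (B w w)).add
      ((hasDerivAt_pow 2 c).mul_const (B u u))).const_mul ε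
    exact this.congr_deriv (by simp)
  have hb' : deriv (fun r : ℝ => ε * B (w + r • u) (w + r • u)) =
      fun c => ε * (B u w + B w u + 2 * c * B u u) := funext fun c => (hb c).deriv
  have hb2 : HasDerivAt (fun c : ℝ => ε * (B u w + B w u + 2 * c * B u u)) (ε * (2 * B u u)) 0 := by
    have := (((((hasDerivAt_id (0 : ℝ)).const_mul 2).mul_const (B u u)).const_add
      (B u w + B w u))).const_mul ε
    exact this.congr_deriv (by simp)
  have hbpos : 0 < deriv (deriv fun r : ℝ => ε * B (w + r • u) (w + r • u)) 0 := by
    rw [hb', hb2.deriv]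
    have := h.form_pos u hu0
    have := h.eps_pos
    positivity
  have hf2 (hw0 : w ≠ 0) : ContDiffAt ℝ 2 (fun r : ℝ => f (w + r • u) ^ 2) 0 := by
    have h1 : ContDiffAt ℝ 2 f (w + (0 : ℝ) • u) := by
      rw [zero_smul, add_zero]
      exact h.contDiffAt w (by rwa [h.form_proj, zero_smul, sub_zero])
    have h2 : ContDiffAt ℝ 2 (fun r : ℝ => w + r • u) 0 := by fun_prop
    exact (h1.comp (0 : ℝ) h2).pow 2
  by_cases hx : 2 * (ε * Ω v ^ 2) < f v ^ 2 - ε * B w w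
  · have hw0 : w ≠ 0 := by
      rintro hw0
      rw [← h.map_proj v, ← hw, hw0, h.map_zero] at hx
      have := h.eps_pos
      have : 0 ≤ 2 * (ε * Ω v ^ 2) := by positivity
      simp at hx
      linarith
    have e : (fun r : ℝ => smoothedMetric Ω T f B ε (v + r • u)) =ᶠ[𝓝 0]
        fun r => Ω v ^ 2 - f (w + r • u) ^ 2 := by
      have := hline.eventually (hv0.symm ▸ h.eventually_lt hx)
      filter_upwards [this] with r hr
      rw [h.smoothedMetric_eq_of_le hr.le, hΩ, hf]
    rw [e.deriv.deriv_eq]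
    have : deriv (fun r : ℝ => Ω v ^ 2 - f (w + r • u) ^ 2) =
        fun r => - deriv (fun r : ℝ => f (w + r • u) ^ 2) r := by
      funext r
      rw [deriv_const_sub]
    rw [this, deriv.fun_neg]
    linarith [h.deriv_deriv_sq_pos (h.form_proj v) hu hw0 hu0]
  · have ht := h.coeff_ne_zero hv hx
    have hs : 0 < ε * Ω v ^ 2 := by have := h.eps_pos; positivity
    have e : (fun r : ℝ => smoothedMetric Ω T f B ε (v + r • u)) = fun r =>
        Ω v ^ 2 - ε * B (w + r • u) (w + r • u) - ε * Ω v ^ 2 *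
          ramp ((f (w + r • u) ^ 2 - ε * B (w + r • u) (w + r • u)) / (ε * Ω v ^ 2)) := by
      funext r
      rw [smoothedMetric, hπ, hΩ, hf, rampPerspective_of_pos hs]
    rw [e]
    -- At `w = 0` nothing is known about second derivatives of `f ^ 2`, but the argument of `ramp`
    -- is zero there, hence stays below `1`, where `ramp` is constant. Only the quadratic form
    -- survives.
    by_cases hw0 : w = 0
    · have e1 : (fun r : ℝ => Ω v ^ 2 - ε * B (w + r • u) (w + r • u) - ε * Ω v ^ 2 *
          ramp ((f (w + r • u) ^ 2 - ε * B (w + r • u) (w + r • u)) / (ε * Ω v ^ 2))) =ᶠ[𝓝 0]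
          fun r => Ω v ^ 2 - ε * B (w + r • u) (w + r • u) - ε * Ω v ^ 2 * ramp 1 := by
        have hc := h.continuous
        have : ContinuousAt (fun r : ℝ => (f (w + r • u) ^ 2 -
            ε * B (w + r • u) (w + r • u)) / (ε * Ω v ^ 2)) 0 := by fun_prop
        have := this.eventually_lt_const (u := 1) (by simp [hw0, h.map_zero])
        filter_upwards [this] with r hr
        rw [ramp_of_le_one hr.le]
      rw [e1.deriv.deriv_eq]
      have : deriv (fun r : ℝ => Ω v ^ 2 - ε * B (w + r • u) (w + r • u) - ε * Ω v ^ 2 * ramp 1) =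
          fun r => - deriv (fun r : ℝ => ε * B (w + r • u) (w + r • u)) r := by
        funext r
        rw [deriv_sub_const, deriv_const_sub]
      rw [this, deriv.fun_neg]
      linarith
    · exact deriv_deriv_sub_ramp_neg (hf2 hw0) (by fun_prop)
        (h.deriv_deriv_sq_pos (h.form_proj v) hu hw0 hu0) hbpos _ hs

/-- Euler's identity: along its own ray the metric is `(1 + r) ^ 2` times its value. -/
theorem fundamentalTensor_smoothedMetric_self {v : E} :
    fundamentalTensor (smoothedMetric Ω T f B ε) v v v = smoothedMetric Ω T f B ε v := by
  rw [fundamentalTensor_self]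
  have e : (fun r : ℝ => smoothedMetric Ω T f B ε (v + r • v)) =ᶠ[𝓝 0]
      fun r => (1 + r) ^ 2 * smoothedMetric Ω T f B ε v := by
    filter_upwards [lt_mem_nhds (show (-1 : ℝ) < 0 by norm_num)] with r hr
    rw [← h.smoothedMetric_smul v (by linarith : 0 < 1 + r), add_smul, one_smul]
  rw [e.deriv.deriv_eq]
  have e1 : deriv (fun r : ℝ => (1 + r) ^ 2 * smoothedMetric Ω T f B ε v) =
      fun r => 2 * (1 + r) * smoothedMetric Ω T f B ε v := by
    funext r
    have := ((((hasDerivAt_id r).const_add 1).pow 2).mul_const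
      (smoothedMetric Ω T f B ε v)).deriv
    simpa using! this
  rw [e1]
  have := ((((hasDerivAt_id (0 : ℝ)).const_add 1).const_mul 2).mul_const
      (smoothedMetric Ω T f B ε v)).deriv
  simp only [id] at this
  rw [this]
  ring

/-- The unmodified region is open, and in it the metric along the line of direction `T` is `(t + r)
^ 2` minus a constant. -/
theorem fundamentalTensor_smoothedMetric_field {v : E}
    (hx : 2 * (ε * Ω v ^ 2) < f v ^ 2 - ε * B (v - Ω v • T) (v - Ω v • T)) :
    fundamentalTensor (smoothedMetric Ω T f B ε) v T T = 1 := by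
  rw [fundamentalTensor_self]
  have hline : ContinuousAt (fun r : ℝ => v + r • T) 0 := by fun_prop
  have hv0 : v + (0 : ℝ) • T = v := by simp
  have e : (fun r : ℝ => smoothedMetric Ω T f B ε (v + r • T)) =ᶠ[𝓝 0]
      fun r => (Ω v + r) ^ 2 - f v ^ 2 := by
    have := hline.eventually (hv0.symm ▸ h.eventually_lt hx)
    filter_upwards [this] with r hr
    rw [h.smoothedMetric_eq_of_le hr.le, h.map_add_smul]
    simp [h.unit]
  rw [e.deriv.deriv_eq]
  have e1 : deriv (fun r : ℝ => (Ω v + r) ^ 2 - f v ^ 2) = fun r => 2 * (Ω v + r) := by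
    funext r
    have := ((((hasDerivAt_id r).const_add (Ω v)).pow 2).sub_const (f v ^ 2)).deriv
    simpa using! this
  rw [e1]
  have := (((hasDerivAt_id (0 : ℝ)).const_add (Ω v)).const_mul 2).deriv
  simp only [id] at this
  rw [this]
  norm_num

/-- The negative hyperplane is `ker Ω`. The positive vector is `T` in the unmodified region, where
the metric itself may have any sign, and `v` in the modified region, where the metric is positive.
-/
theorem index_smoothedMetric [FiniteDimensional ℝ E] {v : E} (hv : v ≠ 0)
    (hL : ContDiffAt ℝ 2 (smoothedMetric Ω T f B ε) v) :
    IsNondegenerateForm (fundamentalTensor (smoothedMetric Ω T f B ε) v) ∧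
      HasIndex (fundamentalTensor (smoothedMetric Ω T f B ε) v) (Module.finrank ℝ E - 1) := by
  have e : fundamentalTensor (smoothedMetric Ω T f B ε) v =
      fun u w => ((1 / 2 : ℝ) • fderiv ℝ (fderiv ℝ (smoothedMetric Ω T f B ε)) v) u w := by
    funext u w
    rw [fundamentalTensor_eq_fderiv hL]
    simp
  have key : ∃ x, 0 < fundamentalTensor (smoothedMetric Ω T f B ε) v x x := by
    by_cases hx : 2 * (ε * Ω v ^ 2) < f v ^ 2 - ε * B (v - Ω v • T) (v - Ω v • T)
    · exact ⟨T, by rw [h.fundamentalTensor_smoothedMetric_field hx]; norm_num⟩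
    · exact ⟨v, by rw [h.fundamentalTensor_smoothedMetric_self]; exact h.smoothedMetric_pos hv hx⟩
  have hneg : ∀ u ∈ Ω.toLinearMap.ker, u ≠ 0 →
      fundamentalTensor (smoothedMetric Ω T f B ε) v u u < 0 := by
    intro u hu hu0
    rw [fundamentalTensor_self]
    have := h.deriv_deriv_smoothedMetric_neg hv hu hu0
    linarith
  obtain ⟨x, hx⟩ := key
  rw [e] at hx hneg ⊢
  refine isNondegenerateForm_and_hasIndex (fun u w => ?_) Ω.toLinearMap.ker ?_ hneg hx
  · have := hL.isSymmSndFDerivAt (by simp) u w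
    simp only [smul_apply, this]
  · have h1 := Ω.toLinearMap.finrank_range_add_finrank_ker
    have h2 : Ω.toLinearMap.range = ⊤ := by
      rw [LinearMap.range_eq_top]
      intro c
      exact ⟨c • T, by simp [h.unit]⟩
    rw [h2, finrank_top, Module.finrank_self] at h1
    omega

end

end IsSmoothingData

end Smoothing

/-! ### Fibre coordinates, compactness and homogeneity in the tangent bundle -/

section TangentBundle

variable {E : Type*} [NormedAddCommGroup E] [NormedSpace ℝ E] {M : Type*} [TopologicalSpace M]
  [ChartedSpace E M] [IsManifold 𝓘(ℝ, E) ∞ M]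

/-- The fibre coordinate of a tangent vector in the preferred trivialization at `p₀`. -/
noncomputable def fiberCoord (p₀ : M) (v : TangentBundle 𝓘(ℝ, E) M) : E :=
  (trivializationAt E (TangentSpace 𝓘(ℝ, E)) p₀ v).2

theorem fiberCoord_eq {p₀ p : M}
    (hp : p ∈ (trivializationAt E (TangentSpace 𝓘(ℝ, E) (M := M)) p₀).baseSet) (v : E) :
    fiberCoord p₀ ⟨p, v⟩ =
      (trivializationAt E (TangentSpace 𝓘(ℝ, E)) p₀).continuousLinearEquivAt ℝ p hp v := rfl

theorem baseSet_mem_nhds (p₀ : M) :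
    (trivializationAt E (TangentSpace 𝓘(ℝ, E) (M := M)) p₀).baseSet ∈ 𝓝 p₀ :=
  (trivializationAt E (TangentSpace 𝓘(ℝ, E)) p₀).open_baseSet.mem_nhds
    (mem_baseSet_trivializationAt E _ p₀)

theorem contMDiffOn_fiberCoord (p₀ : M) :
    ContMDiffOn 𝓘(ℝ, E).tangent 𝓘(ℝ, E) ∞ (fiberCoord (E := E) p₀)
      {v | v.1 ∈ (trivializationAt E (TangentSpace 𝓘(ℝ, E) (M := M)) p₀).baseSet} := by
  have := (trivializationAt E (TangentSpace 𝓘(ℝ, E) (M := M)) p₀).contMDiffOn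
    (IB := 𝓘(ℝ, E)) (n := ∞)
  rw [Trivialization.source_eq] at this
  exact contMDiff_snd.comp_contMDiffOn this

/-- Trivializations are fibrewise linear, so smoothness of the combination can be read off from
coordinates. -/
theorem contMDiffWithinAt_add_smul {E' : Type*} [NormedAddCommGroup E'] [NormedSpace ℝ E']
    {H' : Type*} [TopologicalSpace H'] {J : ModelWithCorners ℝ E' H'} {N : Type*}
    [TopologicalSpace N] [ChartedSpace H' N] {n : WithTop ℕ∞} [IsManifold 𝓘(ℝ, E) n M]
    [ContMDiffVectorBundle n E (TangentSpace 𝓘(ℝ, E) (M := M)) 𝓘(ℝ, E)]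
    {S : Set N} {x₀ : N} {b : N → M}
    {s t : N → E} {c : N → ℝ}
    (hs : ContMDiffWithinAt J 𝓘(ℝ, E).tangent n
      (fun x => (⟨b x, s x⟩ : TangentBundle 𝓘(ℝ, E) M)) S x₀)
    (ht : ContMDiffWithinAt J 𝓘(ℝ, E).tangent n
      (fun x => (⟨b x, t x⟩ : TangentBundle 𝓘(ℝ, E) M)) S x₀)
    (hc : ContMDiffWithinAt J 𝓘(ℝ, ℝ) n c S x₀) :
    ContMDiffWithinAt J 𝓘(ℝ, E).tangent n
      (fun x => (⟨b x, s x + c x • t x⟩ : TangentBundle 𝓘(ℝ, E) M)) S x₀ := by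
  rw [contMDiffWithinAt_totalSpace] at hs ht ⊢
  refine ⟨hs.1, (hs.2.add (hc.smul ht.2)).congr_of_eventuallyEq ?_ ?_⟩
  · have hb : ∀ᶠ x in 𝓝[S] x₀,
        b x ∈ (trivializationAt E (TangentSpace 𝓘(ℝ, E) (M := M)) (b x₀)).baseSet :=
      hs.1.continuousWithinAt.eventually (baseSet_mem_nhds (E := E) (b x₀))
    filter_upwards [hb] with x hx
    exact (((trivializationAt E (TangentSpace 𝓘(ℝ, E)) (b x₀)).continuousLinearEquivAt ℝ (b x)
      hx).map_add _ _).trans (congrArg _ (ContinuousLinearEquiv.map_smul _ _ _))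
  · exact (((trivializationAt E (TangentSpace 𝓘(ℝ, E)) (b x₀)).continuousLinearEquivAt ℝ (b x₀)
      (mem_baseSet_trivializationAt E _ _)).map_add _ _).trans
      (congrArg _ (ContinuousLinearEquiv.map_smul _ _ _))

theorem contMDiff_fiberInclusion {n : WithTop ℕ∞} (p : M) :
    ContMDiff 𝓘(ℝ, E) 𝓘(ℝ, E).tangent n
      (fun w : E => (⟨p, w⟩ : TangentBundle 𝓘(ℝ, E) M)) := by
  intro w
  rw [contMDiffAt_totalSpace]
  refine ⟨contMDiffAt_const, ?_⟩
  have : ContMDiffAt 𝓘(ℝ, E) 𝓘(ℝ, E) n (fun w : E => (trivializationAt E (TangentSpace 𝓘(ℝ, E))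
    p).continuousLinearEquivAt ℝ p (mem_baseSet_trivializationAt E _ p) w) w :=
    ContDiffAt.contMDiffAt (ContinuousLinearEquiv.contDiff _).contDiffAt
  exact this

theorem continuous_fiberInclusion (p : M) :
    Continuous (fun w : E => (⟨p, w⟩ : TangentBundle 𝓘(ℝ, E) M)) :=
  (contMDiff_fiberInclusion (n := 0) p).continuous

theorem continuousAt_fiberCoord {p₀ : M} {v : TangentBundle 𝓘(ℝ, E) M}
    (hv : v.1 ∈ (trivializationAt E (TangentSpace 𝓘(ℝ, E) (M := M)) p₀).baseSet) :
    ContinuousAt (fiberCoord (E := E) p₀) v := by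
  refine (contMDiffOn_fiberCoord p₀).continuousOn.continuousAt ?_
  exact (FiberBundle.continuous_proj E (TangentSpace 𝓘(ℝ, E) (M := M))).continuousAt.preimage_mem_nhds
    ((trivializationAt E (TangentSpace 𝓘(ℝ, E)) p₀).open_baseSet.mem_nhds hv)

/-- The tangent vector at `p` with the coordinate `y` in the preferred trivialization at `p₀`. -/
noncomputable def tangentOfCoord (p₀ p : M) (y : E) : TangentBundle 𝓘(ℝ, E) M :=
  ⟨p, (trivializationAt E (TangentSpace 𝓘(ℝ, E)) p₀).symm p y⟩

theorem tangentOfCoord_fiberCoord {p₀ p : M}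
    (hp : p ∈ (trivializationAt E (TangentSpace 𝓘(ℝ, E) (M := M)) p₀).baseSet) (v : E) :
    tangentOfCoord p₀ p (fiberCoord p₀ ⟨p, v⟩) = ⟨p, v⟩ :=
  congrArg (TotalSpace.mk p) (((trivializationAt E (TangentSpace 𝓘(ℝ, E))
    p₀).continuousLinearEquivAt ℝ p hp).symm_apply_apply v)

theorem fiberCoord_tangentOfCoord {p₀ p : M}
    (hp : p ∈ (trivializationAt E (TangentSpace 𝓘(ℝ, E) (M := M)) p₀).baseSet) (y : E) :
    fiberCoord p₀ (tangentOfCoord p₀ p y) = y :=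
  ((trivializationAt E (TangentSpace 𝓘(ℝ, E)) p₀).continuousLinearEquivAt ℝ p hp).apply_symm_apply y

theorem contMDiffOn_tangentOfCoord (p₀ : M) :
    ContMDiffOn (𝓘(ℝ, E).prod 𝓘(ℝ, E)) 𝓘(ℝ, E).tangent ∞
      (fun q : M × E => tangentOfCoord p₀ q.1 q.2)
      ((trivializationAt E (TangentSpace 𝓘(ℝ, E) (M := M)) p₀).baseSet ×ˢ univ) := by
  have := (trivializationAt E (TangentSpace 𝓘(ℝ, E) (M := M)) p₀).contMDiffOn_symm
    (IB := 𝓘(ℝ, E)) (n := ∞)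
  rw [Trivialization.target_eq] at this
  refine this.congr fun q hq => ?_
  exact (trivializationAt E (TangentSpace 𝓘(ℝ, E)) p₀).mk_symm hq.1 q.2

theorem continuousAt_tangentOfCoord (p₀ : M) (y : E) :
    ContinuousAt (fun q : M × E => tangentOfCoord p₀ q.1 q.2) (p₀, y) :=
  (contMDiffOn_tangentOfCoord p₀).continuousOn.continuousAt
    (prod_mem_nhds (baseSet_mem_nhds p₀) univ_mem)

theorem tangentOfCoord_notMem_zeroVectors {p₀ p : M}
    (hp : p ∈ (trivializationAt E (TangentSpace 𝓘(ℝ, E) (M := M)) p₀).baseSet) {y : E}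
    (hy : y ≠ 0) : tangentOfCoord p₀ p y ∉ zeroVectors E M := by
  intro h0
  have h1 := fiberCoord_tangentOfCoord hp y
  have h2 : tangentOfCoord p₀ p y = ⟨p, (0 : E)⟩ := congrArg (TotalSpace.mk p) h0
  rw [h2, fiberCoord_eq hp] at h1
  exact hy (h1.symm.trans (ContinuousLinearEquiv.map_zero _))

/-- Open conditions satisfied by all nonzero vectors at `p₀` hold for all unit vectors at nearby
points. -/
theorem eventually_forall_unit [FiniteDimensional ℝ E] {X : Type*} [TopologicalSpace X] (x₀ : X)
    (p₀ : M) {P : X → TangentBundle 𝓘(ℝ, E) M → Prop}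
    (h : ∀ v : TangentBundle 𝓘(ℝ, E) M, v.1 = p₀ → v ∉ zeroVectors E M →
      ∀ᶠ q : X × TangentBundle 𝓘(ℝ, E) M in 𝓝 (x₀, v), P q.1 q.2) :
    ∀ᶠ q : X × M in 𝓝 (x₀, p₀), ∀ v : E, ‖fiberCoord p₀ ⟨q.2, v⟩‖ = 1 → P q.1 ⟨q.2, v⟩ := by
  have hp₀ := mem_baseSet_trivializationAt E (TangentSpace 𝓘(ℝ, E) (M := M)) p₀
  have key : ∀ᶠ q : X × M in 𝓝 (x₀, p₀), ∀ y ∈ Metric.sphere (0 : E) 1,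
      P q.1 (tangentOfCoord p₀ q.2 y) := by
    -- Tube lemma over the unit sphere of the model space, compact by finite dimension, which the
    -- trivialization identifies with the unit vectors of every nearby fibre.
    refine (isCompact_sphere (0 : E) 1).eventually_forall_of_forall_eventually
      (P := fun (q : X × M) y => P q.1 (tangentOfCoord p₀ q.2 y)) fun y hy => ?_
    have hy0 : y ≠ 0 := by
      rintro rfl
      simp at hy
    have hc' : Tendsto (fun z : (X × M) × E => (z.1.1, tangentOfCoord p₀ z.1.2 z.2))
        (𝓝 ((x₀, p₀), y)) (𝓝 (x₀, tangentOfCoord p₀ p₀ y)) := by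
      refine Tendsto.prodMk_nhds ?_ ?_
      · exact (continuous_fst.comp continuous_fst).tendsto _
      · have : Continuous fun z : (X × M) × E => (z.1.2, z.2) := by fun_prop
        exact (continuousAt_tangentOfCoord p₀ y).tendsto.comp (this.tendsto ((x₀, p₀), y))
    exact hc'.eventually (h _ rfl (tangentOfCoord_notMem_zeroVectors hp₀ hy0))
  have hb : ∀ᶠ q : X × M in 𝓝 (x₀, p₀),
      q.2 ∈ (trivializationAt E (TangentSpace 𝓘(ℝ, E) (M := M)) p₀).baseSet :=
    continuousAt_snd.eventually (baseSet_mem_nhds p₀)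
  filter_upwards [key, hb] with q hq hqb v hv
  have := hq (fiberCoord p₀ ⟨q.2, v⟩) (by simpa using hv)
  rwa [tangentOfCoord_fiberCoord hqb] at this

theorem fiberCoord_smul {p₀ p : M}
    (hp : p ∈ (trivializationAt E (TangentSpace 𝓘(ℝ, E) (M := M)) p₀).baseSet) (c : ℝ) (v : E) :
    fiberCoord p₀ ⟨p, c • v⟩ = c • fiberCoord p₀ ⟨p, v⟩ := by
  rw [fiberCoord_eq hp, fiberCoord_eq hp]
  exact ContinuousLinearEquiv.map_smul _ _ _

theorem fiberCoord_ne_zero {p₀ p : M}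
    (hp : p ∈ (trivializationAt E (TangentSpace 𝓘(ℝ, E) (M := M)) p₀).baseSet) {v : E}
    (hv : v ≠ 0) : fiberCoord p₀ ⟨p, v⟩ ≠ 0 := by
  rw [fiberCoord_eq hp]
  exact fun h => hv ((ContinuousLinearEquiv.map_eq_zero_iff _).1 h)

theorem fiberCoord_zero {p₀ p : M}
    (hp : p ∈ (trivializationAt E (TangentSpace 𝓘(ℝ, E) (M := M)) p₀).baseSet) :
    fiberCoord p₀ ⟨p, (0 : E)⟩ = 0 := by
  rw [fiberCoord_eq hp]
  exact ContinuousLinearEquiv.map_zero _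

theorem eventually_mem_baseSet {v : TangentBundle 𝓘(ℝ, E) M} {p₀ : M} (hv : v.1 = p₀) :
    ∀ᶠ w : TangentBundle 𝓘(ℝ, E) M in 𝓝 v,
      w.1 ∈ (trivializationAt E (TangentSpace 𝓘(ℝ, E) (M := M)) p₀).baseSet := by
  subst hv
  exact (FiberBundle.continuous_proj E (TangentSpace 𝓘(ℝ, E) (M := M))).continuousAt.preimage_mem_nhds
    (baseSet_mem_nhds v.1)

theorem isClosed_zeroVectors : IsClosed (zeroVectors E M) := by
  rw [← isOpen_compl_iff, isOpen_iff_mem_nhds]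
  rintro ⟨p, v⟩ hv
  have hp := mem_baseSet_trivializationAt E (TangentSpace 𝓘(ℝ, E) (M := M)) p
  have h1 := (continuousAt_fiberCoord (v := ⟨p, v⟩) hp).eventually
    (isOpen_ne.mem_nhds (fiberCoord_ne_zero hp hv))
  filter_upwards [h1, eventually_mem_baseSet (E := E) (v := ⟨p, v⟩) rfl] with ⟨q, w⟩ hq hq' hw
  have hw' : w = (0 : E) := hw
  subst hw'
  exact hq (fiberCoord_zero hq')

theorem exists_unit_scale {p₀ p : M}
    (hp : p ∈ (trivializationAt E (TangentSpace 𝓘(ℝ, E) (M := M)) p₀).baseSet) {v : E}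
    (hv : v ≠ 0) : ∃ u : E, ‖fiberCoord p₀ ⟨p, u⟩‖ = 1 ∧ v = ‖fiberCoord p₀ ⟨p, v⟩‖ • u ∧
      u = ‖fiberCoord p₀ ⟨p, v⟩‖⁻¹ • v ∧ 0 < ‖fiberCoord p₀ ⟨p, v⟩‖ := by
  have h1 := norm_pos_iff.2 (fiberCoord_ne_zero hp hv)
  refine ⟨‖fiberCoord p₀ ⟨p, v⟩‖⁻¹ • v, ?_, ?_, rfl, h1⟩
  · rw [fiberCoord_smul hp, norm_smul, norm_inv, norm_norm, inv_mul_cancel₀ h1.ne']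
  · rw [smul_smul, mul_inv_cancel₀ h1.ne', one_smul]

/-- Produces small constants without estimates: a strict inequality valid at `c = 0`, once known to
be open in `(c, p)`, persists for some `c > 0` on a whole neighbourhood of `p₀`. -/
theorem exists_pos_of_eventually_nhds_zero {M : Type*} [TopologicalSpace M] {p₀ : M} {P : ℝ → M → Prop}
    (h : ∀ᶠ q : ℝ × M in 𝓝 ((0 : ℝ), p₀), P q.1 q.2) : ∃ c > 0, ∀ᶠ p in 𝓝 p₀, P c p := by
  have h1 : ∀ᶠ c in 𝓝 (0 : ℝ), ∀ᶠ p in 𝓝 p₀, P c p := h.curry_nhds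
  obtain ⟨c, hc, hc'⟩ := ((h1.filter_mono nhdsWithin_le_nhds).and
    (self_mem_nhdsWithin (s := Ioi (0 : ℝ)))).exists
  exact ⟨c, hc', hc⟩

/-- A function on a closed conic subset of the tangent bundle which is positively homogeneous of
positive degree and continuous off the zero section is continuous. -/
theorem continuousOn_of_homogeneous [FiniteDimensional ℝ E] {Z : Set (TangentBundle 𝓘(ℝ, E) M)}
    (hZ : IsClosed Z) (hZc : ∀ v ∈ Z, ∀ c : ℝ, 0 < c → scaleVector c v ∈ Z)
    {g : TangentBundle 𝓘(ℝ, E) M → ℝ} {d : ℕ} (hd : d ≠ 0)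
    (hg : ContinuousOn g (Z \ zeroVectors E M)) (hg0 : ∀ v ∈ zeroVectors E M, g v = 0)
    (hgc : ∀ v ∈ Z, ∀ c : ℝ, 0 < c → g (scaleVector c v) = c ^ d * g v) : ContinuousOn g Z := by
  have hoff : ∀ v ∈ Z, v ∉ zeroVectors E M → ContinuousWithinAt g Z v := fun v hv h0 =>
    (hg _ ⟨hv, h0⟩).mono_of_mem_nhdsWithin (inter_mem self_mem_nhdsWithin
      (mem_nhdsWithin_of_mem_nhds (isClosed_zeroVectors.isOpen_compl.mem_nhds h0)))
  rintro ⟨p₀, v₀⟩ hv₀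
  by_cases h0 : (⟨p₀, v₀⟩ : TangentBundle 𝓘(ℝ, E) M) ∈ zeroVectors E M
  swap
  · exact hoff _ hv₀ h0
  -- Only zero vectors need an argument. Here `1 / c` bounds `|g|` on the unit vectors of nearby
  -- fibres, and homogeneity turns this into `|g v| ≤ ‖v‖ ^ d / c`, with the norm taken in
  -- coordinates.
  obtain ⟨c, hc, hcp⟩ := exists_pos_of_eventually_nhds_zero (p₀ := p₀)
    (P := fun c p => ∀ v : E, ‖fiberCoord p₀ ⟨p, v⟩‖ = 1 →
      (⟨p, v⟩ : TangentBundle 𝓘(ℝ, E) M) ∈ Z → |c * g ⟨p, v⟩| < 1)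
    (eventually_forall_unit (E := E) (0 : ℝ) p₀ (P := fun c v => v ∈ Z → |c * g v| < 1)
    fun w _ hw => by
      by_cases hwZ : w ∈ Z
      · have h1 := (hoff w hwZ hw).abs.eventually (gt_mem_nhds (lt_add_one |g w|))
        rw [eventually_nhdsWithin_iff] at h1
        have hK : 0 < |g w| + 1 := by positivity
        have h2 : ∀ᶠ c : ℝ in 𝓝 0, |c| * (|g w| + 1) < 1 := by
          have : ContinuousAt (fun c : ℝ => |c| * (|g w| + 1)) 0 := by fun_prop
          exact this.eventually_lt_const (by simp)
        filter_upwards [h2.prod_nhds h1] with ⟨c, v⟩ ⟨hc, hv⟩ hvZ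
        rw [abs_mul]
        exact (mul_le_mul_of_nonneg_left (hv hvZ).le (abs_nonneg c)).trans_lt hc
      · have := (hZ.isOpen_compl.preimage continuous_snd).mem_nhds (x := ((0 : ℝ), w)) hwZ
        filter_upwards [this] with q hq hq'
        exact absurd hq' hq)
  have hp₀ := mem_baseSet_trivializationAt E (TangentSpace 𝓘(ℝ, E) (M := M)) p₀
  have hbound : ∀ᶠ v in 𝓝[Z] (⟨p₀, v₀⟩ : TangentBundle 𝓘(ℝ, E) M),
      ‖g v‖ ≤ ‖fiberCoord p₀ v‖ ^ d / c := by
    have h1 := (FiberBundle.continuous_proj E (TangentSpace 𝓘(ℝ, E) (M := M))).continuousAt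
      (x := ⟨p₀, v₀⟩) |>.eventually hcp
    filter_upwards [self_mem_nhdsWithin, h1.filter_mono nhdsWithin_le_nhds,
      (eventually_mem_baseSet (E := E) (v := ⟨p₀, v₀⟩) rfl).filter_mono nhdsWithin_le_nhds]
      with ⟨p, v⟩ hvZ hv hpb
    by_cases hv0 : v = (0 : E)
    · rw [hg0 _ hv0]
      simp only [norm_zero]
      positivity
    · obtain ⟨u, hu, hvu, huv, hpos⟩ := exists_unit_scale (E := E) hpb hv0
      have huZ : (⟨p, u⟩ : TangentBundle 𝓘(ℝ, E) M) ∈ Z := by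
        rw [huv]; exact hZc _ hvZ _ (inv_pos.2 hpos)
      have h2 := hv u hu huZ
      have h3 := hgc _ huZ _ hpos
      have h4 : scaleVector ‖fiberCoord p₀ (⟨p, v⟩ : TangentBundle 𝓘(ℝ, E) M)‖
          (⟨p, u⟩ : TangentBundle 𝓘(ℝ, E) M) = ⟨p, v⟩ :=
        congrArg (TotalSpace.mk p) hvu.symm
      rw [h4] at h3
      rw [h3, norm_mul, norm_pow, norm_norm, Real.norm_eq_abs, div_eq_mul_inv]
      rw [abs_mul, abs_of_pos hc] at h2
      gcongr
      rw [← one_div, le_div_iff₀ hc, mul_comm]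
      exact h2.le
  rw [ContinuousWithinAt, hg0 _ h0]
  refine squeeze_zero_norm' hbound ?_
  have h1 : ContinuousAt (fun v : TangentBundle 𝓘(ℝ, E) M => ‖fiberCoord p₀ v‖ ^ d / c) ⟨p₀, v₀⟩ :=
    ((continuousAt_fiberCoord (v := ⟨p₀, v₀⟩) hp₀).norm.pow d).div_const c
  have h2 : ‖fiberCoord p₀ (⟨p₀, v₀⟩ : TangentBundle 𝓘(ℝ, E) M)‖ ^ d / c = 0 := by
    have : v₀ = (0 : E) := h0
    rw [this, fiberCoord_zero hp₀]
    simp [hd]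
  rw [ContinuousAt, h2] at h1
  exact h1.mono_left nhdsWithin_le_nhds

end TangentBundle

/-! ### Gluing functions on the tangent bundle; an auxiliary Riemannian form -/

section Gluing

variable {E : Type*} [NormedAddCommGroup E] [NormedSpace ℝ E] {M : Type*} [TopologicalSpace M]
  [ChartedSpace E M] [IsManifold 𝓘(ℝ, E) ∞ M]

theorem continuous_tangentBundle_proj :
    Continuous (fun v : TangentBundle 𝓘(ℝ, E) M => v.1) :=
  FiberBundle.continuous_proj E (TangentSpace 𝓘(ℝ, E) (M := M))

/-- Functions on the tangent bundle given over the members of a cover of the base can be glued with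
a partition of unity on the base. -/
theorem SmoothPartitionOfUnity.contMDiff_sum_tangentBundle {ι : Type*}
    [FiniteDimensional ℝ E] (ρ : SmoothPartitionOfUnity ι 𝓘(ℝ, E) M univ) {U : ι → Set M}
    (hU : ∀ i, IsOpen (U i))
    (hρ : ρ.IsSubordinate U) {n : ℕ∞} {g : ι → TangentBundle 𝓘(ℝ, E) M → ℝ}
    (hg : ∀ i, ContMDiffOn 𝓘(ℝ, E).tangent 𝓘(ℝ, ℝ) n (g i) {v | v.1 ∈ U i}) :
    ContMDiff 𝓘(ℝ, E).tangent 𝓘(ℝ, ℝ) n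
      (fun v : TangentBundle 𝓘(ℝ, E) M => ∑ i ∈ ρ.finsupport v.1, ρ i v.1 * g i v) := by
  -- As a `finsum` over all indices the sum has a fixed index set, so local finiteness of the
  -- supports applies.
  have e : (fun v : TangentBundle 𝓘(ℝ, E) M => ∑ i ∈ ρ.finsupport v.1, ρ i v.1 * g i v) =
      fun v => ∑ᶠ i, ρ i v.1 * g i v := by
    funext v
    refine (finsum_eq_sum_of_support_subset _ fun i hi => ?_).symm
    rw [SmoothPartitionOfUnity.coe_finsupport]
    exact left_ne_zero_of_mul hi
  rw [e]
  refine contMDiff_finsum (fun i v => ?_) ?_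
  · by_cases hv : v.1 ∈ tsupport (ρ i)
    · have h1 : ContMDiffAt 𝓘(ℝ, E).tangent 𝓘(ℝ, ℝ) n (g i) v :=
        (hg i).contMDiffAt (((hU i).preimage continuous_tangentBundle_proj).mem_nhds (hρ i hv))
      have h2 : ContMDiff 𝓘(ℝ, E).tangent 𝓘(ℝ, ℝ) n
          (fun v : TangentBundle 𝓘(ℝ, E) M => ρ i v.1) :=
        ((ρ i).contMDiff.of_le (by exact_mod_cast le_top)).comp
          (contMDiff_proj (TangentSpace 𝓘(ℝ, E) (M := M)))
      exact h2.contMDiffAt.mul h1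
    · have h1 : ∀ᶠ w : TangentBundle 𝓘(ℝ, E) M in 𝓝 v, w.1 ∉ tsupport (ρ i) :=
        ((isClosed_tsupport (ρ i)).isOpen_compl.preimage
          continuous_tangentBundle_proj).mem_nhds hv
      refine (contMDiffAt_const (c := (0 : ℝ))).congr_of_eventuallyEq ?_
      filter_upwards [h1] with w hw
      rw [image_eq_zero_of_notMem_tsupport hw, zero_mul]
  · refine (ρ.locallyFinite.preimage_continuous continuous_tangentBundle_proj).subset fun i v hv => ?_
    exact left_ne_zero_of_mul hv

/-- A Riemannian metric, obtained by averaging Euclidean inner products pulled back through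
trivializations. Smoothness is recorded for the quadratic form alone, which is all that the
smoothing sees. `toEuclidean` supplies the inner product, as the model space is only normed. -/
theorem exists_pos_form [FiniteDimensional ℝ E] [T2Space M] [SigmaCompactSpace M] (n : ℕ∞) :
    ∃ B : M → E →L[ℝ] E →L[ℝ] ℝ, (∀ p v, v ≠ 0 → 0 < B p v v) ∧
      ContMDiff 𝓘(ℝ, E).tangent 𝓘(ℝ, ℝ) n
        (fun v : TangentBundle 𝓘(ℝ, E) M => B v.1 v.2 v.2) := by
  set U : M → Set M :=
    fun p => (trivializationAt E (TangentSpace 𝓘(ℝ, E) (M := M)) p).baseSet with hU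
  have hUo : ∀ p, IsOpen (U p) := fun p => (trivializationAt E _ p).open_baseSet
  obtain ⟨ρ, hρ⟩ := SmoothPartitionOfUnity.exists_isSubordinate 𝓘(ℝ, E) isClosed_univ U hUo
    fun p _ => mem_iUnion.2 ⟨p, mem_baseSet_trivializationAt E _ p⟩
  let A : M → M → E →L[ℝ] EuclideanSpace ℝ (Fin (Module.finrank ℝ E)) := fun i p =>
    (toEuclidean (E := E)).toContinuousLinearMap ∘L
      ((trivializationAt E (TangentSpace 𝓘(ℝ, E) (M := M)) i).continuousLinearMapAt ℝ p)
  let B : M → M → E →L[ℝ] E →L[ℝ] ℝ := fun i p => (innerSL ℝ).bilinearComp (A i p) (A i p)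
  have hB (i p : M) (v : E) : B i p v v = ‖A i p v‖ ^ 2 :=
    real_inner_self_eq_norm_sq (A i p v)
  have hA (i p : M) (hp : p ∈ U i) (v : E) : A i p v = toEuclidean (fiberCoord i ⟨p, v⟩) := by
    have := (trivializationAt E (TangentSpace 𝓘(ℝ, E) (M := M)) i).continuousLinearMapAt_apply_of_mem
      (R := ℝ) hp v
    exact congrArg toEuclidean this
  have hsum (p : M) (v : E) : (∑ i ∈ ρ.finsupport p, ρ i p • B i p) v v =
      ∑ i ∈ ρ.finsupport p, ρ i p * B i p v v := by
    simp only [sum_apply, smul_apply, smul_eq_mul]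
  refine ⟨fun p => ∑ i ∈ ρ.finsupport p, ρ i p • B i p, fun p v hv => ?_, ?_⟩
  · rw [hsum]
    refine Finset.sum_pos (fun i hi => ?_) ?_
    · have h0 : ρ i p ≠ 0 := by simpa using hi
      have hp : p ∈ U i := hρ i (subset_tsupport _ h0)
      refine mul_pos ((ρ.nonneg i p).lt_of_ne' h0) ?_
      rw [hB, hA i p hp]
      have := fiberCoord_ne_zero (E := E) hp hv
      have : toEuclidean (fiberCoord i (⟨p, v⟩ : TangentBundle 𝓘(ℝ, E) M)) ≠ 0 :=
        fun h => this ((ContinuousLinearEquiv.map_eq_zero_iff _).1 h)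
      positivity
    · obtain ⟨i, hi⟩ := ρ.exists_pos_of_mem (mem_univ p)
      exact ⟨i, by simpa using hi.ne'⟩
  · have := ρ.contMDiff_sum_tangentBundle hUo hρ (n := n) (g := fun i v => B i v.1 v.2 v.2)
      fun i => by
        have h1 : ContDiff ℝ n fun y : E => ‖toEuclidean y‖ ^ 2 :=
          (toEuclidean (E := E)).contDiff.norm_sq ℝ
        refine (h1.contMDiff.comp_contMDiffOn ((contMDiffOn_fiberCoord i).of_le
          (by exact_mod_cast le_top))).congr fun v hv => ?_
        exact (hB i v.1 v.2).trans (by rw [hA i _ hv (v := v.2)]; rfl)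
    exact this.congr fun v => hsum v.1 v.2

end Gluing

/-! ### The fibrewise function of a cone triple -/

section ConeFunction

variable {E : Type*} [NormedAddCommGroup E] [NormedSpace ℝ E] {M : Type*} [TopologicalSpace M]
  [ChartedSpace E M]

/-- The function `t T + w ↦ F w`, `w ∈ ker Ω`, of a cone triple. -/
noncomputable def coneFunction (Ω : (p : M) → TangentSpace 𝓘(ℝ, E) p →L[ℝ] ℝ)
    (T : (p : M) → TangentSpace 𝓘(ℝ, E) p) (F : TangentBundle 𝓘(ℝ, E) M → ℝ)
    (v : TangentBundle 𝓘(ℝ, E) M) : ℝ := F (kerProj Ω T v)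

/-- Without the curves the closure could be smaller than `{f ≤ g}`. Along them `f` is constant and
`g` increases, so each point of equality is a limit of points of strict inequality. They will be the
lines `v + s T`. -/
theorem frontier_setOf_lt_of_curve {X : Type*} [TopologicalSpace X] {f g : X → ℝ}
    (hf : Continuous f) (hg : Continuous g)
    (h : ∀ x, ∃ c : ℝ → X, Continuous c ∧ c 0 = x ∧ ∀ s, f (c s) = f x ∧ g (c s) = g x + s) :
    closure {x | f x < g x} = {x | f x ≤ g x} ∧ frontier {x | f x < g x} = {x | f x = g x} := by
  have hcl : closure {x | f x < g x} = {x | f x ≤ g x} := by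
    refine subset_antisymm (closure_lt_subset_le hf hg) fun x hx => ?_
    obtain ⟨c, hc, rfl, hcs⟩ := h x
    have h1 : Tendsto c (𝓝[>] 0) (𝓝 (c 0)) := hc.continuousAt.mono_left nhdsWithin_le_nhds
    refine mem_closure_of_tendsto h1 ?_
    filter_upwards [self_mem_nhdsWithin] with s hs
    have hs' : (0 : ℝ) < s := hs
    have hx' : f (c 0) ≤ g (c 0) := hx
    show f (c s) < g (c s)
    rw [(hcs s).1, (hcs s).2]
    linarith
  refine ⟨hcl, ?_⟩
  rw [(isOpen_lt hf hg).frontier_eq, hcl]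
  ext x
  exact ⟨fun h => le_antisymm h.1 (not_lt.1 h.2), fun h => ⟨le_of_eq h, fun h' => h'.ne h⟩⟩

variable [IsManifold 𝓘(ℝ, E) ∞ M]

theorem continuous_add_smul_fiber (p : M) (v t : TangentSpace 𝓘(ℝ, E) p) :
    Continuous (fun s : ℝ => (⟨p, v + s • t⟩ : TangentBundle 𝓘(ℝ, E) M)) :=
  (continuous_fiberInclusion p).comp (by fun_prop)

namespace IsConeTriple

variable {k : ℕ∞} {Ω : (p : M) → TangentSpace 𝓘(ℝ, E) p →L[ℝ] ℝ}
  {T : (p : M) → TangentSpace 𝓘(ℝ, E) p} {F : TangentBundle 𝓘(ℝ, E) M → ℝ}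
  (h : IsConeTriple k Ω T F)
include h

theorem contMDiff_kerProj :
    ContMDiff 𝓘(ℝ, E).tangent 𝓘(ℝ, E).tangent k (kerProj Ω T) := by
  intro v
  have h1 : ContMDiff 𝓘(ℝ, E).tangent 𝓘(ℝ, E).tangent k
      (fun v : TangentBundle 𝓘(ℝ, E) M => (⟨v.1, T v.1⟩ : TangentBundle 𝓘(ℝ, E) M)) :=
    h.smooth_field.comp (contMDiff_proj (TangentSpace 𝓘(ℝ, E) (M := M)))
  have : IsManifold 𝓘(ℝ, E) k M := .of_le (n := ∞) (by exact_mod_cast le_top)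
  have := contMDiffWithinAt_add_smul (E := E) (n := k) (S := univ) (x₀ := v)
    (b := fun v : TangentBundle 𝓘(ℝ, E) M => v.1) (s := fun v => v.2) (t := fun v => T v.1)
    (c := fun v => - Ω v.1 v.2) contMDiff_id.contMDiffAt.contMDiffWithinAt
    h1.contMDiffAt.contMDiffWithinAt h.smooth_form.neg.contMDiffAt.contMDiffWithinAt
  rw [contMDiffWithinAt_univ] at this
  refine this.congr_of_eventuallyEq (Eventually.of_forall fun w => ?_)
  refine congrArg (TotalSpace.mk w.1) ?_
  show w.2 - Ω w.1 w.2 • T w.1 = w.2 + (-Ω w.1 w.2) • T w.1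
  rw [neg_smul, ← sub_eq_add_neg]

theorem form_kerProj (v : TangentBundle 𝓘(ℝ, E) M) : Ω v.1 (kerProj Ω T v).2 = 0 := by
  show Ω v.1 (v.2 - Ω v.1 v.2 • T v.1) = 0
  rw [map_sub, map_smul, h.unit]
  simp

theorem kerProj_add_smul (p : M) (v : TangentSpace 𝓘(ℝ, E) p) (c : ℝ) :
    kerProj Ω T ⟨p, v + c • T p⟩ = kerProj Ω T ⟨p, v⟩ := by
  refine congrArg (TotalSpace.mk p) ?_
  show v + c • T p - Ω p (v + c • T p) • T p = v - Ω p v • T p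
  have : Ω p (v + c • T p) = Ω p v + c :=
    ((Ω p).map_add _ _).trans (by rw [map_smul, h.unit]; simp)
  rw [this, add_smul]
  abel

omit [IsManifold 𝓘(ℝ, E) ∞ M] h in
theorem kerProj_of_form_eq_zero {p : M} {v : TangentSpace 𝓘(ℝ, E) p} (hv : Ω p v = 0) :
    kerProj Ω T ⟨p, v⟩ = ⟨p, v⟩ := by
  refine congrArg (TotalSpace.mk p) ?_
  show v - Ω p v • T p = v
  rw [hv, zero_smul, sub_zero]

omit [IsManifold 𝓘(ℝ, E) ∞ M] h in
theorem kerProj_smul (p : M) (v : TangentSpace 𝓘(ℝ, E) p) (c : ℝ) :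
    kerProj Ω T ⟨p, c • v⟩ = scaleVector c (kerProj Ω T ⟨p, v⟩) := by
  refine congrArg (TotalSpace.mk p) ?_
  show c • v - Ω p (c • v) • T p = c • (v - Ω p v • T p)
  have : Ω p (c • v) = c * Ω p v := (Ω p).map_smul _ _
  rw [this, mul_smul, smul_sub]

theorem contMDiffOn_coneFunction :
    ContMDiffOn 𝓘(ℝ, E).tangent 𝓘(ℝ, ℝ) k (coneFunction Ω T F)
      {v | kerProj Ω T v ∉ zeroVectors E M} :=
  h.finsler_smooth.comp h.contMDiff_kerProj.contMDiffOn fun v hv => ⟨h.form_kerProj v, hv⟩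

theorem isOpen_kerProj_ne : IsOpen {v | kerProj Ω T v ∉ zeroVectors E M} :=
  isClosed_zeroVectors.isOpen_compl.preimage h.contMDiff_kerProj.continuous

/-- `F` is smooth only on nonzero vectors of `ker Ω`; homogeneity extends its continuity over the
zero section, and composition with the projection along `T` gives continuity on the whole bundle. -/
theorem continuous_coneFunction [FiniteDimensional ℝ E] : Continuous (coneFunction Ω T F) := by
  have hZ : IsClosed {v : TangentBundle 𝓘(ℝ, E) M | Ω v.1 v.2 = 0} :=
    isClosed_eq h.smooth_form.continuous continuous_const
  have key : ContinuousOn F {v : TangentBundle 𝓘(ℝ, E) M | Ω v.1 v.2 = 0} := by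
    refine continuousOn_of_homogeneous hZ (fun v hv c hc => ?_) one_ne_zero
      h.finsler_smooth.continuousOn h.finsler_zero fun v hv c hc => ?_
    · have hv' : Ω v.1 v.2 = 0 := hv
      exact ((Ω v.1).map_smul c v.2).trans (by rw [hv', smul_zero])
    · rw [pow_one]
      exact h.finsler_homogeneous v hv c hc
  exact key.comp_continuous h.contMDiff_kerProj.continuous h.form_kerProj

theorem coneFunction_add_smul (p : M) (v : TangentSpace 𝓘(ℝ, E) p) (c : ℝ) :
    coneFunction Ω T F ⟨p, v + c • T p⟩ = coneFunction Ω T F ⟨p, v⟩ := by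
  rw [coneFunction, h.kerProj_add_smul, coneFunction]

theorem coneFunction_smul (p : M) (v : TangentSpace 𝓘(ℝ, E) p) {c : ℝ} (hc : 0 < c) :
    coneFunction Ω T F ⟨p, c • v⟩ = c * coneFunction Ω T F ⟨p, v⟩ := by
  rw [coneFunction, kerProj_smul, h.finsler_homogeneous _ (h.form_kerProj ⟨p, v⟩) c hc, coneFunction]

theorem coneFunction_of_mem {v : TangentBundle 𝓘(ℝ, E) M}
    (hv : kerProj Ω T v ∈ zeroVectors E M) : coneFunction Ω T F v = 0 :=
  h.finsler_zero _ hv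

theorem coneFunction_pos {v : TangentBundle 𝓘(ℝ, E) M}
    (hv : kerProj Ω T v ∉ zeroVectors E M) : 0 < coneFunction Ω T F v :=
  h.finsler_pos _ (h.form_kerProj v) hv

theorem coneFunction_nonneg (v : TangentBundle 𝓘(ℝ, E) M) : 0 ≤ coneFunction Ω T F v := by
  by_cases hv : kerProj Ω T v ∈ zeroVectors E M
  · exact (h.coneFunction_of_mem hv).ge
  · exact (h.coneFunction_pos hv).le

/-- If `Ω v = 0`, then `v` is its own projection and `F` is positive on it. This quantity serves as
a comparison norm for the estimates on `ε`. -/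
theorem sq_add_sq_pos {v : TangentBundle 𝓘(ℝ, E) M} (hv : v ∉ zeroVectors E M) :
    0 < coneFunction Ω T F v ^ 2 + Ω v.1 v.2 ^ 2 := by
  by_cases hv' : Ω v.1 v.2 = 0
  · have : kerProj Ω T v ∉ zeroVectors E M := by
      have := kerProj_of_form_eq_zero (T := T) (p := v.1) (v := v.2) hv'
      rwa [show kerProj Ω T v = v from this]
    have := h.coneFunction_pos this
    positivity
  · positivity

theorem form_add_smul (p : M) (v : TangentSpace 𝓘(ℝ, E) p) (c : ℝ) : Ω p (v + c • T p) = Ω p v + c :=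
  ((Ω p).map_add _ _).trans (by rw [map_smul, h.unit]; simp)

theorem frontier_domain [FiniteDimensional ℝ E] :
    closure {v : TangentBundle 𝓘(ℝ, E) M | coneFunction Ω T F v < Ω v.1 v.2} =
        {v | coneFunction Ω T F v ≤ Ω v.1 v.2} ∧
      frontier {v : TangentBundle 𝓘(ℝ, E) M | coneFunction Ω T F v < Ω v.1 v.2} =
        {v | coneFunction Ω T F v = Ω v.1 v.2} := by
  refine frontier_setOf_lt_of_curve h.continuous_coneFunction h.smooth_form.continuous fun v => ?_
  refine ⟨fun s => ⟨v.1, v.2 + s • T v.1⟩, continuous_add_smul_fiber _ _ _, ?_, fun s =>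
    ⟨h.coneFunction_add_smul _ _ _, h.form_add_smul _ _ _⟩⟩
  refine congrArg (TotalSpace.mk v.1) ?_
  show v.2 + (0 : ℝ) • T v.1 = v.2
  rw [zero_smul, add_zero]

theorem frontier_fiber_domain [FiniteDimensional ℝ E] (p : M) :
    closure {v : TangentSpace 𝓘(ℝ, E) p | coneFunction Ω T F ⟨p, v⟩ < Ω p v} =
        {v | coneFunction Ω T F ⟨p, v⟩ ≤ Ω p v} ∧
      frontier {v : TangentSpace 𝓘(ℝ, E) p | coneFunction Ω T F ⟨p, v⟩ < Ω p v} =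
        {v | coneFunction Ω T F ⟨p, v⟩ = Ω p v} := by
  refine frontier_setOf_lt_of_curve
    (h.continuous_coneFunction.comp (continuous_fiberInclusion (E := E) p)) (Ω p).continuous fun v => ?_
  refine ⟨fun s => v + s • T p, ?_, ?_, fun s =>
    ⟨h.coneFunction_add_smul _ _ _, h.form_add_smul _ _ _⟩⟩
  · exact continuous_const.add (continuous_id.smul continuous_const)
  · show v + (0 : ℝ) • T p = v
    rw [zero_smul, add_zero]

/-- Both sides of the defining equation have the same projection to `ker Ω`, and `T` does not
vanish, so only the coefficients of `T` are compared. -/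
theorem mem_iff_of_isAssociatedTriple {C : Set (TangentBundle 𝓘(ℝ, E) M)}
    (hC : IsAssociatedTriple Ω T F C) {v : TangentBundle 𝓘(ℝ, E) M} (hv : v ∉ zeroVectors E M) :
    v ∈ C ↔ coneFunction Ω T F v = Ω v.1 v.2 := by
  have hT : T v.1 ≠ 0 := by
    intro h0
    have := h.unit v.1
    rw [h0, map_zero] at this
    exact zero_ne_one this
  rw [hC v hv]
  constructor
  · intro h1
    have h2 : (coneFunction Ω T F v - Ω v.1 v.2) • T v.1 = 0 := by
      rw [sub_smul, coneFunction]
      have : F (kerProj Ω T v) • T v.1 = v.2 - (v.2 - Ω v.1 v.2 • T v.1) :=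
        eq_sub_of_add_eq h1.symm
      rw [this]
      abel
    exact sub_eq_zero.1 ((smul_eq_zero.1 h2).resolve_right hT)
  · intro h1
    rw [coneFunction] at h1
    rw [h1]
    abel

end IsConeTriple

end ConeFunction

/-! ### Choice of the smoothing scale -/

section Smoothing

variable {E : Type*} [NormedAddCommGroup E] [NormedSpace ℝ E] [FiniteDimensional ℝ E]
  {M : Type*} [TopologicalSpace M] [ChartedSpace E M] [IsManifold 𝓘(ℝ, E) ∞ M]

/-- The scales `ε` at which the smoothing of `Ω² - f²` with auxiliary form `B` on `T_pM` only
affects directions of `U`. -/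
structure IsSmoothingScale (Ω : (p : M) → TangentSpace 𝓘(ℝ, E) p →L[ℝ] ℝ)
    (T : (p : M) → TangentSpace 𝓘(ℝ, E) p) (f : TangentBundle 𝓘(ℝ, E) M → ℝ)
    (B : M → E →L[ℝ] E →L[ℝ] ℝ) (U : Set (TangentBundle 𝓘(ℝ, E) M)) (p : M) (ε : ℝ) : Prop where
  pos : 0 < ε
  form_lt : ∀ w : TangentSpace 𝓘(ℝ, E) p, Ω p w = 0 → w ≠ 0 → ε * B p w w < f ⟨p, w⟩ ^ 2
  form_lt_one : ∀ w : TangentSpace 𝓘(ℝ, E) p, Ω p w = 0 → f ⟨p, w⟩ ^ 2 ≤ ε * (B p w w + 2) →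
    (⟨p, T p + w⟩ : TangentBundle 𝓘(ℝ, E) M) ∈ U ∧ ε * (B p w w + 2) < 1

omit [FiniteDimensional ℝ E] in
theorem form_self_nonneg {B : E →L[ℝ] E →L[ℝ] ℝ} (hB : ∀ v, v ≠ 0 → 0 < B v v) (v : E) :
    0 ≤ B v v := by
  by_cases hv : v = 0
  · simp [hv]
  · exact (hB v hv).le

omit [FiniteDimensional ℝ E] [IsManifold 𝓘(ℝ, E) ∞ M] in
-- Admissibility passes to smaller positive scales, so the admissible scales form an interval. This
-- convexity is what lets locally constant choices be glued to a smooth function `ε`.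
theorem convex_setOf_isSmoothingScale {Ω : (p : M) → TangentSpace 𝓘(ℝ, E) p →L[ℝ] ℝ}
    {T : (p : M) → TangentSpace 𝓘(ℝ, E) p} {f : TangentBundle 𝓘(ℝ, E) M → ℝ}
    {B : M → E →L[ℝ] E →L[ℝ] ℝ} (hB : ∀ p v, v ≠ 0 → 0 < B p v v)
    {U : Set (TangentBundle 𝓘(ℝ, E) M)} (p : M) :
    Convex ℝ {ε | IsSmoothingScale Ω T f B U p ε} := by
  refine OrdConnected.convex ⟨fun x hx y hy z hz => ?_⟩
  have hmono (w : E) (b : ℝ) (hb : 0 ≤ b) : z * (B p w w + b) ≤ y * (B p w w + b) :=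
    mul_le_mul_of_nonneg_right hz.2 (add_nonneg (form_self_nonneg (hB p) w) hb)
  refine ⟨lt_of_lt_of_le hx.pos hz.1, fun w hw hw0 => ?_, fun w hw hfw => ?_⟩
  · refine lt_of_le_of_lt ?_ (hy.form_lt w hw hw0)
    simpa using hmono w 0 le_rfl
  · have h1 := hmono w 2 (by norm_num)
    have h2 := hy.form_lt_one w hw (hfw.trans h1)
    exact ⟨h2.1, h1.trans_lt h2.2⟩

namespace IsConeTriple

variable {k : ℕ∞} {Ω : (p : M) → TangentSpace 𝓘(ℝ, E) p →L[ℝ] ℝ}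
  {T : (p : M) → TangentSpace 𝓘(ℝ, E) p} {F : TangentBundle 𝓘(ℝ, E) M → ℝ}
  (h : IsConeTriple k Ω T F)
include h

/-- Both sides are homogeneous of degree two, so unit vectors of nearby fibres suffice; there the
inequality is strict at `c = 0` by `sq_add_sq_pos`. The squared norm is included to locate `w` near
zero in terms of `f`. -/
theorem eventually_form_lt {B : M → E →L[ℝ] E →L[ℝ] ℝ}
    (hBc : Continuous fun v : TangentBundle 𝓘(ℝ, E) M => B v.1 v.2 v.2) (p₀ : M) :
    ∃ c > 0, ∀ᶠ p in 𝓝 p₀, ∀ v : TangentSpace 𝓘(ℝ, E) p, v ≠ 0 →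
      c * (B p v v + ‖fiberCoord p₀ ⟨p, v⟩‖ ^ 2) < coneFunction Ω T F ⟨p, v⟩ ^ 2 + Ω p v ^ 2 := by
  have hcont := h.continuous_coneFunction
  have hΩ := h.smooth_form.continuous
  obtain ⟨c, hc, hcp⟩ := exists_pos_of_eventually_nhds_zero (p₀ := p₀)
    (P := fun c p => ∀ v : E, ‖fiberCoord p₀ ⟨p, v⟩‖ = 1 →
      c * (B p v v + 1) < coneFunction Ω T F ⟨p, v⟩ ^ 2 + Ω p v ^ 2)
    (eventually_forall_unit (E := E) (0 : ℝ) p₀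
      (P := fun c v => c * (B v.1 v.2 v.2 + 1) < coneFunction Ω T F v ^ 2 + Ω v.1 v.2 ^ 2)
      fun v _ hv => by
        have h1 : Continuous fun q : ℝ × TangentBundle 𝓘(ℝ, E) M =>
            q.1 * (B q.2.1 q.2.2 q.2.2 + 1) :=
          continuous_fst.mul ((hBc.comp continuous_snd).add continuous_const)
        have h2 : Continuous fun q : ℝ × TangentBundle 𝓘(ℝ, E) M =>
            coneFunction Ω T F q.2 ^ 2 + Ω q.2.1 q.2.2 ^ 2 :=
          ((hcont.comp continuous_snd).pow 2).add ((hΩ.comp continuous_snd).pow 2)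
        refine h1.continuousAt.eventually_lt h2.continuousAt ?_
        simpa using h.sq_add_sq_pos hv)
  refine ⟨c, hc, ?_⟩
  filter_upwards [hcp, baseSet_mem_nhds (E := E) p₀] with p hp hpb v hv
  obtain ⟨u, hu, hvu, -, hpos⟩ := exists_unit_scale (E := E) hpb hv
  have h1 := hp u hu
  have h2 := h.coneFunction_smul p u hpos
  have h3 : Ω p (‖fiberCoord p₀ (⟨p, v⟩ : TangentBundle 𝓘(ℝ, E) M)‖ • u) =
    ‖fiberCoord p₀ (⟨p, v⟩ : TangentBundle 𝓘(ℝ, E) M)‖ * Ω p u := (Ω p).map_smul _ _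
  have h4 : B p (‖fiberCoord p₀ (⟨p, v⟩ : TangentBundle 𝓘(ℝ, E) M)‖ • u)
      (‖fiberCoord p₀ (⟨p, v⟩ : TangentBundle 𝓘(ℝ, E) M)‖ • u) = _ :=
    IsSmoothingData.form_smul (B := B p) _ u
  have e1 : coneFunction Ω T F ⟨p, v⟩ = _ := (congrArg (fun x : E => coneFunction Ω T F ⟨p, x⟩) hvu).trans h2
  have e2 : Ω p v = _ := (congrArg (fun x : E => Ω p x) hvu).trans h3
  have e3 : B p v v = _ := (congrArg (fun x : E => B p x x) hvu).trans h4
  rw [e1, e2, e3]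
  generalize ‖fiberCoord p₀ (⟨p, v⟩ : TangentBundle 𝓘(ℝ, E) M)‖ = r at hpos
  have := mul_lt_mul_of_pos_left h1 (pow_pos hpos 2)
  calc _ = r ^ 2 * (c * (B p u u + 1)) := by ring
    _ < _ := this
    _ = _ := by ring

omit [FiniteDimensional ℝ E] in
-- Continuity of fibrewise translation by `T` gives a tube of uniform coordinate radius around the
-- section `T` inside `U`.
theorem eventually_add_field_mem {U : Set (TangentBundle 𝓘(ℝ, E) M)} (hU : IsOpen U)
    (hTU : ∀ p, (⟨p, T p⟩ : TangentBundle 𝓘(ℝ, E) M) ∈ U) (p₀ : M) :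
    ∃ δ > 0, ∀ᶠ p in 𝓝 p₀, ∀ v : TangentSpace 𝓘(ℝ, E) p, ‖fiberCoord p₀ ⟨p, v⟩‖ < δ →
      (⟨p, T p + v⟩ : TangentBundle 𝓘(ℝ, E) M) ∈ U := by
  let A : TangentBundle 𝓘(ℝ, E) M → TangentBundle 𝓘(ℝ, E) M :=
    fun v => ⟨v.1, T v.1 + (1 : ℝ) • v.2⟩
  have hA (p : M) (v : TangentSpace 𝓘(ℝ, E) p) : A ⟨p, v⟩ = ⟨p, T p + v⟩ :=
    congrArg (fun x => (⟨p, T p + x⟩ : TangentBundle 𝓘(ℝ, E) M)) (one_smul ℝ v)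
  have hAc : ContMDiff 𝓘(ℝ, E).tangent 𝓘(ℝ, E).tangent k A := by
    intro v
    have h1 : ContMDiff 𝓘(ℝ, E).tangent 𝓘(ℝ, E).tangent k
        (fun v : TangentBundle 𝓘(ℝ, E) M => (⟨v.1, T v.1⟩ : TangentBundle 𝓘(ℝ, E) M)) :=
      h.smooth_field.comp (contMDiff_proj (TangentSpace 𝓘(ℝ, E) (M := M)))
    have : IsManifold 𝓘(ℝ, E) k M := .of_le (n := ∞) (by exact_mod_cast le_top)
    exact contMDiffWithinAt_add_smul (E := E) (n := k) (S := univ) (x₀ := v)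
      (b := fun v : TangentBundle 𝓘(ℝ, E) M => v.1) (s := fun v => T v.1) (t := fun v => v.2)
      (c := fun _ => 1) h1.contMDiffAt.contMDiffWithinAt
      contMDiff_id.contMDiffAt.contMDiffWithinAt contMDiffWithinAt_const
  have hp₀ := mem_baseSet_trivializationAt E (TangentSpace 𝓘(ℝ, E) (M := M)) p₀
  have h0 : tangentOfCoord p₀ p₀ (0 : E) = ⟨p₀, (0 : E)⟩ := by
    have := tangentOfCoord_fiberCoord hp₀ (0 : E)
    rwa [fiberCoord_zero hp₀] at this
  have h1 : ContinuousAt (fun q : M × E => A (tangentOfCoord p₀ q.1 q.2)) (p₀, 0) :=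
    ContinuousAt.comp (g := A) hAc.continuous.continuousAt (continuousAt_tangentOfCoord p₀ 0)
  have h2 : ∀ᶠ q : M × E in 𝓝 (p₀, 0), A (tangentOfCoord p₀ q.1 q.2) ∈ U := by
    refine h1.eventually (hU.mem_nhds ?_)
    show A (tangentOfCoord p₀ p₀ (0 : E)) ∈ U
    have h3 : (⟨p₀, T p₀ + (0 : TangentSpace 𝓘(ℝ, E) p₀)⟩ : TangentBundle 𝓘(ℝ, E) M) =
      ⟨p₀, T p₀⟩ := congrArg (TotalSpace.mk p₀) (add_zero _)
    rw [h0]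
    exact ((hA p₀ 0).trans h3) ▸ hTU p₀
  rw [nhds_prod_eq, eventually_prod_iff] at h2
  obtain ⟨P, hP, Q, hQ, hPQ⟩ := h2
  obtain ⟨δ, hδ, hδQ⟩ := Metric.eventually_nhds_iff.1 hQ
  refine ⟨δ, hδ, ?_⟩
  filter_upwards [hP, baseSet_mem_nhds (E := E) p₀] with p hp hpb v hv
  have h3 : A (tangentOfCoord p₀ p (fiberCoord p₀ ⟨p, v⟩)) ∈ U :=
    hPQ hp (hδQ (y := fiberCoord p₀ ⟨p, v⟩) (by simpa using hv))
  have h4 := (congrArg A (tangentOfCoord_fiberCoord hpb v)).trans (hA p v)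
  exact (congrArg (· ∈ U) h4).mp h3

theorem exists_smoothingScale [T2Space M] [SigmaCompactSpace M] {B : M → E →L[ℝ] E →L[ℝ] ℝ}
    (hB : ∀ p v, v ≠ 0 → 0 < B p v v)
    (hBc : Continuous fun v : TangentBundle 𝓘(ℝ, E) M => B v.1 v.2 v.2)
    {U : Set (TangentBundle 𝓘(ℝ, E) M)} (hU : IsOpen U)
    (hTU : ∀ p, (⟨p, T p⟩ : TangentBundle 𝓘(ℝ, E) M) ∈ U) (n : ℕ∞) :
    ∃ ε : M → ℝ, ContMDiff 𝓘(ℝ, E) 𝓘(ℝ, ℝ) n ε ∧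
      ∀ p, IsSmoothingScale Ω T (coneFunction Ω T F) B U p (ε p) := by
  obtain ⟨ε, hε⟩ := exists_contMDiffMap_forall_mem_convex_of_local_const 𝓘(ℝ, E) (n := n)
    (t := fun p => {ε | IsSmoothingScale Ω T (coneFunction Ω T F) B U p ε})
    (convex_setOf_isSmoothingScale hB) fun p₀ => by
      obtain ⟨c, hc, hcp⟩ := h.eventually_form_lt hBc p₀
      obtain ⟨δ, hδ, hδp⟩ := h.eventually_add_field_mem hU hTU p₀
      -- On `ker Ω`, `f ^ 2 ≤ ε (B + 2)` and `c (B + ‖w‖ ^ 2) < f ^ 2`. With `ε ≤ c / 2` half of `c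
      -- B` absorbs `ε B`, leaving `c / 2 * B + c ‖w‖ ^ 2 < 2 ε`. Then `2 ε ≤ c δ ^ 2` gives `‖w‖ <
      -- δ`, while `ε B < 2 ε` and `ε ≤ 1 / 8` give `ε (B + 2) < 1`.
      obtain ⟨ε, hε, h1, h2, h3⟩ : ∃ ε > 0, ε ≤ c / 2 ∧ ε ≤ 1 / 8 ∧ 2 * ε ≤ c * δ ^ 2 :=
        ⟨min (c / 2) (min (1 / 8) (c * δ ^ 2 / 2)), by positivity, min_le_left _ _,
          (min_le_right _ _).trans (min_le_left _ _), by
            have := (min_le_right (c / 2) _).trans (min_le_right (1 / 8) (c * δ ^ 2 / 2))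
            linarith⟩
      refine ⟨ε, ?_⟩
      filter_upwards [hcp, hδp, baseSet_mem_nhds (E := E) p₀] with p hp hpU hpb
      refine ⟨hε, fun w hw hw0 => ?_, fun w hw hfw => ?_⟩
      · have h4 := hp w hw0
        rw [hw] at h4
        have h5 : 0 ≤ B p w w := form_self_nonneg (hB p) w
        nlinarith [sq_nonneg ‖fiberCoord p₀ (⟨p, w⟩ : TangentBundle 𝓘(ℝ, E) M)‖]
      · by_cases hw0 : w = 0
        · have h5 : B p w w = 0 := by
            rw [hw0]; exact map_zero _
          refine ⟨hpU w ?_, by rw [h5]; linarith⟩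
          have : fiberCoord p₀ (⟨p, w⟩ : TangentBundle 𝓘(ℝ, E) M) = 0 := by
            rw [hw0]; exact fiberCoord_zero hpb
          rw [this, norm_zero]
          exact hδ
        · have h4 := hp w hw0
          rw [hw] at h4
          have h5 : 0 ≤ B p w w := form_self_nonneg (hB p) w
          have h6 : 0 ≤ ‖fiberCoord p₀ (⟨p, w⟩ : TangentBundle 𝓘(ℝ, E) M)‖ := norm_nonneg _
          have h7 : ε * B p w w ≤ c / 2 * B p w w := mul_le_mul_of_nonneg_right h1 h5
          have h8 : 0 ≤ c * B p w w := mul_nonneg hc.le h5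
          have h9 : 0 ≤ c * ‖fiberCoord p₀ (⟨p, w⟩ : TangentBundle 𝓘(ℝ, E) M)‖ ^ 2 := by positivity
          refine ⟨hpU w ?_, by linarith⟩
          refine lt_of_pow_lt_pow_left₀ 2 hδ.le (lt_of_mul_lt_mul_left (a := c) ?_ hc.le)
          linarith
  exact ⟨ε, ε.contMDiff, hε⟩

end IsConeTriple

end Smoothing

/-! ### The smoothed metric on the tangent bundle -/

section Smoothing

variable {E : Type*} [NormedAddCommGroup E] [NormedSpace ℝ E]
  {M : Type*} [TopologicalSpace M] [ChartedSpace E M] [IsManifold 𝓘(ℝ, E) ∞ M]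

/-- The fibrewise smoothing of `Ω² - f²`. -/
noncomputable def smoothedMetricOnBundle (Ω : (p : M) → TangentSpace 𝓘(ℝ, E) p →L[ℝ] ℝ)
    (T : (p : M) → TangentSpace 𝓘(ℝ, E) p) (f : TangentBundle 𝓘(ℝ, E) M → ℝ)
    (B : M → E →L[ℝ] E →L[ℝ] ℝ) (ε : M → ℝ) (v : TangentBundle 𝓘(ℝ, E) M) : ℝ :=
  smoothedMetric (E := E) (Ω v.1) (T v.1) (fun w => f ⟨v.1, w⟩) (B v.1) (ε v.1) v.2

omit [IsManifold 𝓘(ℝ, E) ∞ M] in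
theorem smoothedMetricOnBundle_eq {Ω : (p : M) → TangentSpace 𝓘(ℝ, E) p →L[ℝ] ℝ}
    {T : (p : M) → TangentSpace 𝓘(ℝ, E) p} {f : TangentBundle 𝓘(ℝ, E) M → ℝ}
    {B : M → E →L[ℝ] E →L[ℝ] ℝ} {ε : M → ℝ} (v : TangentBundle 𝓘(ℝ, E) M) :
    smoothedMetricOnBundle Ω T f B ε v = Ω v.1 v.2 ^ 2 -
      ε v.1 * B v.1 (kerProj Ω T v).2 (kerProj Ω T v).2 -
      rampPerspective (f v ^ 2 - ε v.1 * B v.1 (kerProj Ω T v).2 (kerProj Ω T v).2)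
        (ε v.1 * Ω v.1 v.2 ^ 2) := rfl

namespace IsConeTriple

variable {k : ℕ∞} {Ω : (p : M) → TangentSpace 𝓘(ℝ, E) p →L[ℝ] ℝ}
  {T : (p : M) → TangentSpace 𝓘(ℝ, E) p} {F : TangentBundle 𝓘(ℝ, E) M → ℝ}
  (h : IsConeTriple k Ω T F)
include h

theorem isSmoothingData [FiniteDimensional ℝ E] (hk : 2 ≤ k) {B : M → E →L[ℝ] E →L[ℝ] ℝ}
    (hB : ∀ p v, v ≠ 0 → 0 < B p v v) {U : Set (TangentBundle 𝓘(ℝ, E) M)} {p : M} {ε : ℝ}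
    (hε : IsSmoothingScale Ω T (coneFunction Ω T F) B U p ε) :
    IsSmoothingData (E := E) (Ω p) (T p) (fun w => coneFunction Ω T F ⟨p, w⟩) (B p) ε where
  unit := h.unit p
  continuous := h.continuous_coneFunction.comp (continuous_fiberInclusion (E := E) p)
  contDiffAt v hv := by
    have h1 : ContMDiffAt 𝓘(ℝ, E).tangent 𝓘(ℝ, ℝ) k (coneFunction Ω T F) ⟨p, v⟩ :=
      h.contMDiffOn_coneFunction.contMDiffAt (h.isOpen_kerProj_ne.mem_nhds hv)
    have h2 : ContMDiffAt 𝓘(ℝ, E) 𝓘(ℝ, ℝ) k (fun w : E => coneFunction Ω T F ⟨p, w⟩) v :=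
      ContMDiffAt.comp (I' := 𝓘(ℝ, E).tangent) (g := coneFunction Ω T F)
        (f := fun w : E => (⟨p, w⟩ : TangentBundle 𝓘(ℝ, E) M)) v h1
        (contMDiff_fiberInclusion p).contMDiffAt
    exact h2.contDiffAt.of_le (WithTop.coe_le_coe.2 hk)
  map_add_smul v c := h.coneFunction_add_smul p v c
  map_smul v c hc := h.coneFunction_smul p v hc
  posDef v u hv hu hv0 hu0 := by
    have h1 := h.finsler_posDef p v u hv hu hv0 hu0
    rw [fundamentalTensor_self] at h1 ⊢
    have e (r : ℝ) : coneFunction Ω T F ⟨p, v + r • u⟩ = restrictAt F p (v + r • u) := by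
      have h2 : Ω p (v + r • u : E) = 0 := by
        have := ((Ω p).map_add v (r • u)).trans (congrArg₂ (· + ·) hv ((Ω p).map_smul r u))
        refine this.trans ?_
        have hu' : Ω p u = 0 := hu
        simp [hu']
      exact congrArg F (kerProj_of_form_eq_zero (T := T) h2)
    simp only [e]
    exact h1
  form_pos := hB p
  eps_pos := hε.pos
  form_lt := hε.form_lt
  form_lt_one w hw hfw := (hε.form_lt_one w hw hfw).2

/-- Along `ℝ T`, where `F` may be singular, the smooth maximum is locally constant in `F`. Off it
`F` is smooth, and the arguments lie in the smoothness domain of `rampPerspective`: the scale is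
positive if `Ω v ≠ 0`, and otherwise `form_lt` makes the first argument positive. -/
theorem contMDiffAt_smoothedMetricOnBundle [FiniteDimensional ℝ E]
    {B : M → E →L[ℝ] E →L[ℝ] ℝ}
    (hBs : ContMDiff 𝓘(ℝ, E).tangent 𝓘(ℝ, ℝ) k
      (fun v : TangentBundle 𝓘(ℝ, E) M => B v.1 v.2 v.2))
    {U : Set (TangentBundle 𝓘(ℝ, E) M)} {ε : M → ℝ} (hεs : ContMDiff 𝓘(ℝ, E) 𝓘(ℝ, ℝ) k ε)
    (hε : ∀ p, IsSmoothingScale Ω T (coneFunction Ω T F) B U p (ε p))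
    {v : TangentBundle 𝓘(ℝ, E) M} (hv : v ∉ zeroVectors E M) :
    ContMDiffAt 𝓘(ℝ, E).tangent 𝓘(ℝ, ℝ) k
      (smoothedMetricOnBundle Ω T (coneFunction Ω T F) B ε) v := by
  have hε' : ContMDiff 𝓘(ℝ, E).tangent 𝓘(ℝ, ℝ) k
      (fun v : TangentBundle 𝓘(ℝ, E) M => ε v.1) :=
    hεs.comp (contMDiff_proj (TangentSpace 𝓘(ℝ, E) (M := M)))
  have hs : ContMDiff 𝓘(ℝ, E).tangent 𝓘(ℝ, ℝ) k
      (fun v : TangentBundle 𝓘(ℝ, E) M => ε v.1 * Ω v.1 v.2 ^ 2) :=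
    hε'.mul (h.smooth_form.pow 2)
  set q : TangentBundle 𝓘(ℝ, E) M → ℝ :=
    fun v => ε v.1 * B v.1 (kerProj Ω T v).2 (kerProj Ω T v).2 with hqdef
  have hq : ContMDiff 𝓘(ℝ, E).tangent 𝓘(ℝ, ℝ) k q := hε'.mul (hBs.comp h.contMDiff_kerProj)
  have hmain : ContMDiff 𝓘(ℝ, E).tangent 𝓘(ℝ, ℝ) k
      (fun v : TangentBundle 𝓘(ℝ, E) M => Ω v.1 v.2 ^ 2 - q v) := (h.smooth_form.pow 2).sub hq
  have e : smoothedMetricOnBundle Ω T (coneFunction Ω T F) B ε = fun v => Ω v.1 v.2 ^ 2 - q v -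
      rampPerspective (coneFunction Ω T F v ^ 2 - q v) (ε v.1 * Ω v.1 v.2 ^ 2) :=
    funext smoothedMetricOnBundle_eq
  rw [e]
  by_cases hw : kerProj Ω T v ∈ zeroVectors E M
  · have hq0 : q v = 0 := by
      have : (kerProj Ω T v).2 = (0 : E) := hw
      simp only [hqdef, this]
      exact mul_eq_zero_of_right _ (map_zero _)
    have hΩ : Ω v.1 v.2 ≠ 0 := by
      intro h0
      have := kerProj_of_form_eq_zero (T := T) (p := v.1) (v := v.2) h0
      exact hv (by rwa [show kerProj Ω T v = v from this] at hw)
    have hpos : 0 < ε v.1 * Ω v.1 v.2 ^ 2 := by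
      have := (hε v.1).pos
      positivity
    have h1 : ContinuousAt (fun v => coneFunction Ω T F v ^ 2 - q v) v :=
      ((h.continuous_coneFunction.pow 2).sub hq.continuous).continuousAt
    have h2 := h1.eventually_lt hs.continuous.continuousAt
      (by rw [h.coneFunction_of_mem hw, hq0]; simpa using hpos)
    have h3 := hs.continuous.continuousAt.eventually (lt_mem_nhds hpos)
    refine (hmain.contMDiffAt.sub (hs.contMDiffAt.mul
      (contMDiffAt_const (c := ramp 1)))).congr_of_eventuallyEq ?_
    filter_upwards [h2, h3] with u hu hu'
    have hu'' : 0 < ε u.1 * Ω u.1 u.2 ^ 2 := hu'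
    simp only [Pi.mul_apply]
    rw [rampPerspective_of_pos hu'', ramp_of_le_one (x := _ / _)]
    rw [div_le_one hu'']
    exact hu.le
  · have h1 : ContMDiffAt 𝓘(ℝ, E).tangent 𝓘(ℝ, ℝ) k (coneFunction Ω T F) v :=
      h.contMDiffOn_coneFunction.contMDiffAt (h.isOpen_kerProj_ne.mem_nhds hw)
    have h2 : ContMDiffAt 𝓘(ℝ, E).tangent 𝓘(ℝ, ℝ × ℝ) k
        (fun v => (coneFunction Ω T F v ^ 2 - q v, ε v.1 * Ω v.1 v.2 ^ 2)) v :=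
      ((h1.pow 2).sub hq.contMDiffAt).prodMk_space hs.contMDiffAt
    have hcond : 0 < ε v.1 * Ω v.1 v.2 ^ 2 ∨
        2 * (ε v.1 * Ω v.1 v.2 ^ 2) < coneFunction Ω T F v ^ 2 - q v := by
      by_cases hΩ : Ω v.1 v.2 = 0
      · right
        have h3 : v.2 - Ω v.1 v.2 • T v.1 = v.2 := by rw [hΩ, zero_smul, sub_zero]
        have h4 := (hε v.1).form_lt v.2 hΩ hv
        have h5 : q v = ε v.1 * B v.1 v.2 v.2 :=
          congrArg (fun x : E => ε v.1 * B v.1 x x) h3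
        rw [hΩ, h5]
        simpa using h4
      · left
        have := (hε v.1).pos
        positivity
    have h3 := (contDiffAt_rampPerspective hcond).of_le (n := ∞) (m := k)
      (by exact_mod_cast le_top)
    exact hmain.contMDiffAt.sub (ContMDiffAt.comp (I' := 𝓘(ℝ, ℝ × ℝ)) v h3.contMDiffAt h2)

theorem isLorentzianOnTangentBundle_smoothedMetric [FiniteDimensional ℝ E] (hk : 2 ≤ k)
    {B : M → E →L[ℝ] E →L[ℝ] ℝ} (hB : ∀ p v, v ≠ 0 → 0 < B p v v)
    (hBs : ContMDiff 𝓘(ℝ, E).tangent 𝓘(ℝ, ℝ) k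
      (fun v : TangentBundle 𝓘(ℝ, E) M => B v.1 v.2 v.2))
    {U : Set (TangentBundle 𝓘(ℝ, E) M)} {ε : M → ℝ} (hεs : ContMDiff 𝓘(ℝ, E) 𝓘(ℝ, ℝ) k ε)
    (hε : ∀ p, IsSmoothingScale Ω T (coneFunction Ω T F) B U p (ε p)) :
    IsLorentzianOnTangentBundle k (smoothedMetricOnBundle Ω T (coneFunction Ω T F) B ε) := by
  have hd (p : M) := h.isSmoothingData hk hB (hε p)
  have hsm : ContMDiffOn 𝓘(ℝ, E).tangent 𝓘(ℝ, ℝ) k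
      (smoothedMetricOnBundle Ω T (coneFunction Ω T F) B ε) (zeroVectors E M)ᶜ := fun v hv =>
    (h.contMDiffAt_smoothedMetricOnBundle hBs hεs hε hv).contMDiffWithinAt
  have hhom : ∀ v : TangentBundle 𝓘(ℝ, E) M, ∀ c : ℝ, 0 < c →
      smoothedMetricOnBundle Ω T (coneFunction Ω T F) B ε (scaleVector c v) =
        c ^ 2 * smoothedMetricOnBundle Ω T (coneFunction Ω T F) B ε v := fun v c hc =>
    (hd v.1).smoothedMetric_smul v.2 hc
  have hidx (p : M) (v : E) (hv : v ≠ 0) := (hd p).index_smoothedMetric hv (by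
    have h1 : ContMDiffAt 𝓘(ℝ, E) 𝓘(ℝ, ℝ) k (fun w : E =>
        smoothedMetricOnBundle Ω T (coneFunction Ω T F) B ε ⟨p, w⟩) v :=
      ContMDiffAt.comp (I' := 𝓘(ℝ, E).tangent)
        (g := smoothedMetricOnBundle Ω T (coneFunction Ω T F) B ε)
        (f := fun w : E => (⟨p, w⟩ : TangentBundle 𝓘(ℝ, E) M)) v
        (h.contMDiffAt_smoothedMetricOnBundle hBs hεs hε hv)
        (contMDiff_fiberInclusion p).contMDiffAt
    exact h1.contDiffAt.of_le (WithTop.coe_le_coe.2 hk))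
  refine ⟨?_, hsm, hhom, fun p v hv => (hidx p v hv).1, fun p v hv => (hidx p v hv).2⟩
  rw [← continuousOn_univ]
  refine continuousOn_of_homogeneous isClosed_univ (fun _ _ _ _ => mem_univ _) two_ne_zero ?_ ?_
    fun v _ c hc => hhom v c hc
  · rw [← compl_eq_univ_sdiff]
    exact hsm.continuousOn
  · intro v hv
    -- Doubling fixes a zero vector, so homogeneity reads `L = 4 L` there and forces `L = 0`.
    have h2 : scaleVector 2 v = v := by
      have : v.2 = 0 := hv
      refine congrArg (TotalSpace.mk v.1) ?_
      show (2 : ℝ) • v.2 = v.2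
      rw [this, smul_zero]
    have h3 := hhom v 2 two_pos
    rw [h2] at h3
    linarith

end IsConeTriple

end Smoothing

/-! ### The Lorentz-Finsler metric and its cone -/

section Metric

variable {E : Type*} [NormedAddCommGroup E] [NormedSpace ℝ E]
  {M : Type*} [TopologicalSpace M] [ChartedSpace E M] [IsManifold 𝓘(ℝ, E) ∞ M]

theorem fderiv_apply_of_map_add_smul {g : E → ℝ} {x t : E} (hg : DifferentiableAt ℝ g x) {c : ℝ}
    (h : ∀ s : ℝ, g (x + s • t) = g x + s * c) : fderiv ℝ g x t = c := by
  have h1 : HasDerivAt (fun s : ℝ => g (x + s • t)) (fderiv ℝ g x t) 0 :=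
    hg.hasFDerivAt.hasLineDerivAt t
  simp only [h] at h1
  exact h1.unique (by simpa using ((hasDerivAt_id (0 : ℝ)).mul_const c).const_add (g x))

theorem fderiv_comp_fiberInclusion {Φ : TangentBundle 𝓘(ℝ, E) M → ℝ} {p : M} {v : E}
    (hΦ : MDifferentiableAt 𝓘(ℝ, E).tangent 𝓘(ℝ, ℝ) Φ ⟨p, v⟩) :
    fderiv ℝ (fun w : E => Φ ⟨p, w⟩) v = (mfderiv 𝓘(ℝ, E).tangent 𝓘(ℝ, ℝ) Φ ⟨p, v⟩).comp
      (mfderiv 𝓘(ℝ, E) 𝓘(ℝ, E).tangent (fun w : E => (⟨p, w⟩ : TangentBundle 𝓘(ℝ, E) M)) v) := by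
  rw [← mfderiv_eq_fderiv]
  exact mfderiv_comp (I' := 𝓘(ℝ, E).tangent) v hΦ
    ((contMDiff_fiberInclusion (n := 1) p).mdifferentiableAt (by simp))

theorem fderiv_fiber_eq_zero {Φ : TangentBundle 𝓘(ℝ, E) M → ℝ} {p : M} {v : E}
    (hΦ : MDifferentiableAt 𝓘(ℝ, E).tangent 𝓘(ℝ, ℝ) Φ ⟨p, v⟩)
    (h0 : mfderiv 𝓘(ℝ, E).tangent 𝓘(ℝ, ℝ) Φ ⟨p, v⟩ = 0) :
    fderiv ℝ (fun w : E => Φ ⟨p, w⟩) v = 0 := by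
  rw [fderiv_comp_fiberInclusion hΦ, h0]
  exact ContinuousLinearMap.zero_comp _

namespace IsConeTriple

variable {k : ℕ∞} {Ω : (p : M) → TangentSpace 𝓘(ℝ, E) p →L[ℝ] ℝ}
  {T : (p : M) → TangentSpace 𝓘(ℝ, E) p} {F : TangentBundle 𝓘(ℝ, E) M → ℝ}
  (h : IsConeTriple k Ω T F)
include h

theorem kerProj_notMem_of_eq {v : TangentBundle 𝓘(ℝ, E) M} (hv : v ∉ zeroVectors E M)
    (hv' : coneFunction Ω T F v = Ω v.1 v.2) : kerProj Ω T v ∉ zeroVectors E M := by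
  intro h0
  rw [h.coneFunction_of_mem h0] at hv'
  have := kerProj_of_form_eq_zero (T := T) (p := v.1) (v := v.2) hv'.symm
  exact hv (by rwa [show kerProj Ω T v = v from this] at h0)

/-- `Ω - f` has derivative `1` along `T`, since `f` does not change along `T`; hence it is regular
already on each fibre. Nonzero vectors with `f = Ω` are not on `ℝ T`, so `f` is smooth near them. -/
theorem isLocalDefiningFunction (hk : 1 ≤ k) [FiniteDimensional ℝ E]
    {v : TangentBundle 𝓘(ℝ, E) M} (hv : v ∉ zeroVectors E M)
    (hv' : coneFunction Ω T F v = Ω v.1 v.2) :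
    IsLocalDefiningFunction 𝓘(ℝ, E).tangent k
      (frontier {v : TangentBundle 𝓘(ℝ, E) M | coneFunction Ω T F v < Ω v.1 v.2}) v
      {v | kerProj Ω T v ∉ zeroVectors E M} (fun v => Ω v.1 v.2 - coneFunction Ω T F v) ∧
    IsLocalDefiningFunction 𝓘(ℝ, E) k
      (frontier {w : E | coneFunction Ω T F ⟨v.1, w⟩ < Ω v.1 w}) v.2
      {w | kerProj Ω T ⟨v.1, w⟩ ∉ zeroVectors E M}
      (fun w => Ω v.1 w - coneFunction Ω T F ⟨v.1, w⟩) := by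
  have hsm : ContMDiffOn 𝓘(ℝ, E).tangent 𝓘(ℝ, ℝ) k
      (fun v : TangentBundle 𝓘(ℝ, E) M => Ω v.1 v.2 - coneFunction Ω T F v)
      {v | kerProj Ω T v ∉ zeroVectors E M} :=
    h.smooth_form.contMDiffOn.sub h.contMDiffOn_coneFunction
  have hsm' : ContMDiffOn 𝓘(ℝ, E) 𝓘(ℝ, ℝ) k
      (fun w : E => Ω v.1 w - coneFunction Ω T F ⟨v.1, w⟩)
      {w | kerProj Ω T ⟨v.1, w⟩ ∉ zeroVectors E M} :=
    ContMDiffOn.comp (I' := 𝓘(ℝ, E).tangent)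
      (f := fun w : E => (⟨v.1, w⟩ : TangentBundle 𝓘(ℝ, E) M)) hsm
      (contMDiff_fiberInclusion v.1).contMDiffOn fun w hw => hw
  have hvU := h.kerProj_notMem_of_eq hv hv'
  have ho' : IsOpen {w : E | kerProj Ω T ⟨v.1, w⟩ ∉ zeroVectors E M} :=
    h.isOpen_kerProj_ne.preimage (continuous_fiberInclusion v.1)
  have hk0 : (k : WithTop ℕ∞) ≠ 0 := by
    have : (1 : ℕ∞) ≠ 0 := one_ne_zero
    have : k ≠ 0 := fun h0 => by simp [h0] at hk
    exact_mod_cast this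
  have hreg : fderiv ℝ (fun w : E => Ω v.1 w - coneFunction Ω T F ⟨v.1, w⟩) v.2 ≠ 0 := by
    intro h0
    have h1 : DifferentiableAt ℝ (fun w : E => Ω v.1 w - coneFunction Ω T F ⟨v.1, w⟩) v.2 :=
      ((hsm'.contMDiffAt (ho'.mem_nhds hvU)).contDiffAt).differentiableAt hk0
    have h2 := fderiv_apply_of_map_add_smul (E := E)
      (g := fun w : E => Ω v.1 w - coneFunction Ω T F ⟨v.1, w⟩) (x := v.2) (t := T v.1) h1
      (c := 1) fun s => by
      refine (congrArg₂ (· - ·) (h.form_add_smul v.1 v.2 s)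
        (h.coneFunction_add_smul v.1 v.2 s)).trans ?_
      show _ = Ω v.1 v.2 - coneFunction Ω T F v + s * 1
      ring
    exact zero_ne_one ((congrArg (fun A : E →L[ℝ] ℝ => A (T v.1)) h0).symm.trans h2)
  refine ⟨⟨h.isOpen_kerProj_ne, hvU, hsm, fun h0 => hreg ?_, ?_⟩, ⟨ho', hvU, hsm', ?_, ?_⟩⟩
  · have h1 : MDifferentiableAt 𝓘(ℝ, E).tangent 𝓘(ℝ, ℝ)
        (fun v : TangentBundle 𝓘(ℝ, E) M => Ω v.1 v.2 - coneFunction Ω T F v) ⟨v.1, v.2⟩ :=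
      (hsm.contMDiffAt (h.isOpen_kerProj_ne.mem_nhds hvU)).mdifferentiableAt hk0
    have h2 : mfderiv 𝓘(ℝ, E).tangent 𝓘(ℝ, ℝ)
        (fun v : TangentBundle 𝓘(ℝ, E) M => Ω v.1 v.2 - coneFunction Ω T F v) ⟨v.1, v.2⟩ = 0 := h0
    exact fderiv_fiber_eq_zero (E := E) h1 h2
  · rw [h.frontier_domain.2]
    ext w
    exact ⟨fun hw => ⟨hw.2, sub_eq_zero.2 hw.1.symm⟩, fun hw => ⟨(sub_eq_zero.1 hw.2).symm, hw.1⟩⟩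
  · exact fun h0 => hreg (mfderiv_eq_fderiv.symm.trans h0)
  · have h1 := (h.frontier_fiber_domain v.1).2
    ext w
    refine ⟨fun hw => ⟨hw.2, ?_⟩, fun hw => ⟨?_, hw.1⟩⟩
    · have : w ∈ {v_1 : E | coneFunction Ω T F ⟨v.1, v_1⟩ = Ω v.1 v_1} := h1 ▸ hw.1
      exact sub_eq_zero.2 this.symm
    · have : w ∈ {v_1 : E | coneFunction Ω T F ⟨v.1, v_1⟩ = Ω v.1 v_1} := (sub_eq_zero.1 hw.2).symm
      exact h1 ▸ this

/-- The domain is star-shaped about `T`: `f (b w + a T) = b f w < b Ω w + a`. Convexity of `F` does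
not enter. -/
theorem isConnected_fiber_domain [FiniteDimensional ℝ E] (p : M) :
    IsConnected {w : E | coneFunction Ω T F ⟨p, w⟩ < Ω p w} := by
  have hT : (T p : E) ∈ {w : E | coneFunction Ω T F ⟨p, w⟩ < Ω p w} := by
    have h1 : kerProj Ω T ⟨p, T p⟩ ∈ zeroVectors E M := by
      show T p - Ω p (T p) • T p = 0
      rw [h.unit, one_smul, sub_self]
    show coneFunction Ω T F ⟨p, T p⟩ < Ω p (T p)
    rw [h.coneFunction_of_mem h1, h.unit]
    exact one_pos
  refine (StarConvex.isPathConnected (a := (T p : E)) ?_ hT).isConnected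
  intro w hw a b ha hb hab
  rcases hb.eq_or_lt with rfl | hb
  · have : a = 1 := by linarith
    subst this
    rw [one_smul, zero_smul, add_zero]
    exact hT
  · have h1 := h.coneFunction_add_smul p (b • w) a
    have h2 := h.form_add_smul p (b • w) a
    have h3 := h.coneFunction_smul p w hb
    have h4 : Ω p (b • w) = b * Ω p w := (Ω p).map_smul _ _
    have h5 : coneFunction Ω T F ⟨p, w⟩ < Ω p w := hw
    rw [add_comm]
    show coneFunction Ω T F ⟨p, b • w + a • T p⟩ < Ω p (b • w + a • T p)
    rw [h4] at h2
    refine h1.trans_lt (lt_of_lt_of_eq ?_ h2.symm)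
    refine h3.trans_lt ?_
    nlinarith

end IsConeTriple

end Metric

section Metric

variable {E : Type*} [NormedAddCommGroup E] [NormedSpace ℝ E] [FiniteDimensional ℝ E]
  {M : Type*} [TopologicalSpace M] [ChartedSpace E M] [IsManifold 𝓘(ℝ, E) ∞ M]

omit [FiniteDimensional ℝ E] in
theorem IsConeStructure.notMem_zeroVectors {k : ℕ∞} {C : Set (TangentBundle 𝓘(ℝ, E) M)}
    (hC : IsConeStructure k C) {v : TangentBundle 𝓘(ℝ, E) M} (hv : v ∈ C) :
    v ∉ zeroVectors E M := by
  intro h0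
  obtain ⟨A, hA⟩ := hC.strongCone v.1
  have h1 : v.2 ∈ fiberAt C v.1 := hv
  have h2 : v.2 = (0 : E) := h0
  rw [h2] at h1
  exact hA.zero_notMem h1

namespace IsConeTriple

variable {k : ℕ∞} {Ω : (p : M) → TangentSpace 𝓘(ℝ, E) p →L[ℝ] ℝ}
  {T : (p : M) → TangentSpace 𝓘(ℝ, E) p} {F : TangentBundle 𝓘(ℝ, E) M → ℝ}
  (h : IsConeTriple k Ω T F)
include h

/-- Cone vectors are never modified: in the modified region `scaled_lt` gives `ε B + 2 ε t ^ 2 < t ^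
2`, and with `f = t` this is the condition for the metric to be unmodified. -/
theorem smoothedMetricOnBundle_eq_zero (hk : 2 ≤ k) {B : M → E →L[ℝ] E →L[ℝ] ℝ}
    (hB : ∀ p v, v ≠ 0 → 0 < B p v v) {U : Set (TangentBundle 𝓘(ℝ, E) M)} {ε : M → ℝ}
    (hε : ∀ p, IsSmoothingScale Ω T (coneFunction Ω T F) B U p (ε p))
    {v : TangentBundle 𝓘(ℝ, E) M} (hv : v ∉ zeroVectors E M)
    (hv' : coneFunction Ω T F v = Ω v.1 v.2) :
    smoothedMetricOnBundle Ω T (coneFunction Ω T F) B ε v = 0 := by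
  have hd := h.isSmoothingData hk hB (hε v.1)
  by_cases hx : 2 * (ε v.1 * Ω v.1 v.2 ^ 2) < coneFunction Ω T F v ^ 2 -
      ε v.1 * B v.1 (kerProj Ω T v).2 (kerProj Ω T v).2
  · refine (hd.smoothedMetric_eq_of_le (v := v.2) hx.le).trans ?_
    show Ω v.1 v.2 ^ 2 - coneFunction Ω T F v ^ 2 = 0
    rw [hv', sub_self]
  · have h1 : ε v.1 * B v.1 (kerProj Ω T v).2 (kerProj Ω T v).2 + 2 * (ε v.1 * Ω v.1 v.2 ^ 2) <
        Ω v.1 v.2 ^ 2 := hd.scaled_lt (v := v.2) hv hx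
    rw [hv'] at hx
    linarith

theorem smoothedMetricOnBundle_pos (hk : 2 ≤ k) {B : M → E →L[ℝ] E →L[ℝ] ℝ}
    (hB : ∀ p v, v ≠ 0 → 0 < B p v v) {U : Set (TangentBundle 𝓘(ℝ, E) M)} {ε : M → ℝ}
    (hε : ∀ p, IsSmoothingScale Ω T (coneFunction Ω T F) B U p (ε p))
    {v : TangentBundle 𝓘(ℝ, E) M} (hv : coneFunction Ω T F v < Ω v.1 v.2) :
    0 < smoothedMetricOnBundle Ω T (coneFunction Ω T F) B ε v := by
  have hd := h.isSmoothingData hk hB (hε v.1)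
  have h0 := h.coneFunction_nonneg v
  by_cases hx : 2 * (ε v.1 * Ω v.1 v.2 ^ 2) < coneFunction Ω T F v ^ 2 -
      ε v.1 * B v.1 (kerProj Ω T v).2 (kerProj Ω T v).2
  · refine lt_of_lt_of_eq ?_ (hd.smoothedMetric_eq_of_le (v := v.2) hx.le).symm
    show 0 < Ω v.1 v.2 ^ 2 - coneFunction Ω T F v ^ 2
    nlinarith
  · refine hd.smoothedMetric_pos (v := v.2) ?_ hx
    intro h1
    have h2 : Ω v.1 v.2 = 0 := (congrArg (fun x : E => Ω v.1 x) h1).trans (map_zero _)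
    rw [h2] at hv
    exact hv.not_ge h0

/-- If the metric is modified at `v = t T + w`, the rescaled vector `w / |t|` satisfies the premise
of `form_lt_one`, so `T + w / |t|` lies in `U`. -/
theorem smoothedMetricOnBundle_eq_continuousMetric (hk : 2 ≤ k) {B : M → E →L[ℝ] E →L[ℝ] ℝ}
    (hB : ∀ p v, v ≠ 0 → 0 < B p v v) {U : Set (TangentBundle 𝓘(ℝ, E) M)} {ε : M → ℝ}
    (hε : ∀ p, IsSmoothingScale Ω T (coneFunction Ω T F) B U p (ε p))
    {v : TangentBundle 𝓘(ℝ, E) M} (hv : v ∉ radialSaturation U)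
    (hv' : reflectVector Ω T v ∉ radialSaturation U) :
    smoothedMetricOnBundle Ω T (coneFunction Ω T F) B ε v = continuousMetric Ω T F v := by
  have hd := h.isSmoothingData hk hB (hε v.1)
  by_cases hx : 2 * (ε v.1 * Ω v.1 v.2 ^ 2) ≤ coneFunction Ω T F v ^ 2 -
      ε v.1 * B v.1 (kerProj Ω T v).2 (kerProj Ω T v).2
  · exact hd.smoothedMetric_eq_of_le (v := v.2) hx
  exfalso
  push Not at hx
  set w : TangentSpace 𝓘(ℝ, E) v.1 := (kerProj Ω T v).2 with hw
  have hvw : v.2 = w + Ω v.1 v.2 • T v.1 := (sub_add_cancel v.2 (Ω v.1 v.2 • T v.1)).symm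
  have hv0 : v.2 ≠ 0 := by
    intro h0
    have h1 : Ω v.1 v.2 = 0 := (congrArg (fun x => Ω v.1 x) h0).trans (map_zero _)
    have h2 : kerProj Ω T v = v := kerProj_of_form_eq_zero (T := T) (p := v.1) (v := v.2) h1
    have h3 : w = (0 : E) := by rw [hw, h2]; exact h0
    have h4 : coneFunction Ω T F v = 0 := h.coneFunction_of_mem h3
    have h5 : B v.1 w w = 0 := (congrArg (fun x : E => B v.1 x w) h3).trans
      (congrArg (fun A : E →L[ℝ] ℝ => A w) (map_zero (B v.1)))
    rw [h1, h4, h5] at hx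
    simp at hx
  have ht : Ω v.1 v.2 ≠ 0 := hd.coeff_ne_zero (v := v.2) hv0 hx.not_gt
  set t := Ω v.1 v.2 with htdef
  have ht' : 0 < |t|⁻¹ := inv_pos.2 (abs_pos.2 ht)
  have hfw : coneFunction Ω T F ⟨v.1, |t|⁻¹ • w⟩ = |t|⁻¹ * coneFunction Ω T F v := by
    refine (h.coneFunction_smul v.1 w ht').trans (congrArg _ ?_)
    have := h.coneFunction_add_smul v.1 w t
    exact this.symm.trans (congrArg (fun x => coneFunction Ω T F ⟨v.1, x⟩) hvw.symm)
  have hBw : B v.1 (|t|⁻¹ • w) (|t|⁻¹ • w) = |t|⁻¹ ^ 2 * B v.1 w w :=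
    IsSmoothingData.form_smul (B := B v.1) _ (w : E)
  have hΩw : Ω v.1 (|t|⁻¹ • w) = 0 := by
    rw [map_smul, show Ω v.1 w = 0 from h.form_kerProj v, smul_zero]
  have hsq : |t|⁻¹ ^ 2 * t ^ 2 = 1 := by
    rw [inv_pow, sq_abs]; field_simp
  have hU := ((hε v.1).form_lt_one (|t|⁻¹ • w) hΩw (by
    rw [hfw, hBw]
    have := mul_lt_mul_of_pos_left hx (pow_pos ht' 2)
    have e : ε v.1 * 2 = |t|⁻¹ ^ 2 * (2 * (ε v.1 * t ^ 2)) := by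
      linear_combination (-2 * ε v.1) * hsq
    refine le_of_lt ?_
    calc _ = |t|⁻¹ ^ 2 * (coneFunction Ω T F v ^ 2 - ε v.1 * B v.1 w w) +
          |t|⁻¹ ^ 2 * (ε v.1 * B v.1 w w) := by ring
      _ < |t|⁻¹ ^ 2 * (2 * (ε v.1 * t ^ 2)) + |t|⁻¹ ^ 2 * (ε v.1 * B v.1 w w) :=
        add_lt_add_left this _
      _ = _ := by rw [← e]; ring)).1
  -- The point `T + w / |t|` is a positive multiple of `v` for `t > 0`, and of the reflection of `v`
  -- for `t < 0`.
  rcases lt_or_gt_of_ne ht with h0 | h0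
  · refine hv' ⟨|t|⁻¹, ht', ?_⟩
    convert hU using 1
    refine congrArg (TotalSpace.mk v.1) ?_
    show |t|⁻¹ • (v.2 - (2 * t) • T v.1) = T v.1 + |t|⁻¹ • w
    have e : v.2 - (2 * t) • T v.1 = w + |t| • T v.1 := by
      rw [abs_of_neg h0]
      conv_lhs => rw [hvw]
      module
    rw [e, smul_add, smul_smul, inv_mul_cancel₀ (abs_pos.2 ht).ne', one_smul, add_comm]
  · refine hv ⟨|t|⁻¹, ht', ?_⟩
    convert hU using 1
    refine congrArg (TotalSpace.mk v.1) ?_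
    show |t|⁻¹ • v.2 = T v.1 + |t|⁻¹ • w
    have e : v.2 = w + |t| • T v.1 := by rw [abs_of_pos h0]; exact hvw
    rw [e, smul_add, smul_smul, inv_mul_cancel₀ (abs_pos.2 ht).ne', one_smul, add_comm]

theorem isGlobalLorentzFinslerMetricWithCone {C : Set (TangentBundle 𝓘(ℝ, E) M)} (hk : 2 ≤ k)
    (hC : IsConeStructure k C) (hTC : IsAssociatedTriple Ω T F C) {B : M → E →L[ℝ] E →L[ℝ] ℝ}
    (hB : ∀ p v, v ≠ 0 → 0 < B p v v)
    (hBs : ContMDiff 𝓘(ℝ, E).tangent 𝓘(ℝ, ℝ) k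
      (fun v : TangentBundle 𝓘(ℝ, E) M => B v.1 v.2 v.2))
    {U : Set (TangentBundle 𝓘(ℝ, E) M)} {ε : M → ℝ} (hεs : ContMDiff 𝓘(ℝ, E) 𝓘(ℝ, ℝ) k ε)
    (hε : ∀ p, IsSmoothingScale Ω T (coneFunction Ω T F) B U p (ε p)) :
    IsGlobalLorentzFinslerMetricWithCone k C
      (smoothedMetricOnBundle Ω T (coneFunction Ω T F) B ε) := by
  have hL := h.isLorentzianOnTangentBundle_smoothedMetric hk hB hBs hεs hε
  have hk1 : 1 ≤ k := le_trans (by norm_num) hk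
  have hfr := h.frontier_domain.2
  have hbd (v : TangentBundle 𝓘(ℝ, E) M)
      (hv : v ∈ frontier {v : TangentBundle 𝓘(ℝ, E) M | coneFunction Ω T F v < Ω v.1 v.2}) :
      coneFunction Ω T F v = Ω v.1 v.2 := (Set.ext_iff.1 hfr v).1 hv
  have hbd' (p : M) (w : E) (hw : w ∈ frontier {w : E | coneFunction Ω T F ⟨p, w⟩ < Ω p w}) :
      coneFunction Ω T F ⟨p, w⟩ = Ω p w := (Set.ext_iff.1 (h.frontier_fiber_domain p).2 w).1 hw
  have hc : Continuous (coneFunction Ω T F) := h.continuous_coneFunction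
  have ho : IsOpen {v : TangentBundle 𝓘(ℝ, E) M | coneFunction Ω T F v < Ω v.1 v.2} :=
    isOpen_lt hc h.smooth_form.continuous
  have h0A : ∀ p, (0 : E) ∉ {w : E | coneFunction Ω T F ⟨p, w⟩ < Ω p w} := by
    intro p h1
    have h2 : Ω p (0 : E) = 0 := (Ω p).map_zero
    have h3 : coneFunction Ω T F ⟨p, (0 : E)⟩ < Ω p (0 : E) := h1
    rw [h2] at h3
    exact h3.not_ge (h.coneFunction_nonneg _)
  refine ⟨hL, {v | coneFunction Ω T F v < Ω v.1 v.2}, ⟨ho, ?_, ?_, ?_, fun p => ?_⟩, ?_⟩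
  · rintro v ⟨hv, hv0⟩
    refine ⟨_, _, (h.isLocalDefiningFunction hk1 hv0 (hbd v hv)).1, ?_⟩
    ext w
    exact ⟨fun hw => ⟨hw.2, sub_pos.2 hw.1⟩, fun hw => ⟨sub_pos.1 hw.2, hw.1⟩⟩
  · rintro v ⟨hv, hv0⟩
    exact h.smoothedMetricOnBundle_eq_zero hk hB hε hv0 (hbd v hv)
  · exact ⟨_, _, isClosed_zeroVectors.isOpen_compl, fun v hv => hv.2, hL.smooth, fun _ _ => rfl⟩
  · refine ⟨ho.preimage (continuous_fiberInclusion p), h.isConnected_fiber_domain p, h0A p, ?_, ?_,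
      ?_, ?_, ?_, ?_⟩
    · intro w hw c hc
      have h1 : coneFunction Ω T F ⟨p, w⟩ < Ω p w := hw
      show coneFunction Ω T F ⟨p, c • w⟩ < Ω p (c • w)
      have h2 : Ω p (c • w) = c * Ω p w := (Ω p).map_smul _ _
      rw [h2]
      exact (h.coneFunction_smul p w hc).trans_lt (mul_lt_mul_of_pos_left h1 hc)
    · exact fun w hw => h.smoothedMetricOnBundle_pos hk hB hε hw
    · exact fun w _ c hc => hL.homogeneous ⟨p, w⟩ c hc
    · rintro w ⟨hw, hw0⟩
      refine ⟨_, _, (h.isLocalDefiningFunction hk1 (v := ⟨p, w⟩) hw0 (hbd' p w hw)).2, ?_⟩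
      ext u
      exact ⟨fun hw => ⟨hw.2, sub_pos.2 hw.1⟩, fun hw => ⟨sub_pos.1 hw.2, hw.1⟩⟩
    · rintro w ⟨hw, hw0⟩
      exact h.smoothedMetricOnBundle_eq_zero hk hB hε (v := ⟨p, w⟩) hw0 (hbd' p w hw)
    · refine ⟨{0}ᶜ, restrictAt _ p, isOpen_compl_singleton, fun w hw => hw.2, ?_, fun _ _ => rfl,
        fun w hw => hL.nondegenerate p w hw.2, fun w hw => hL.index p w ?_⟩
      · rw [← contMDiffOn_iff_contDiffOn]
        exact ContMDiffOn.comp (I' := 𝓘(ℝ, E).tangent)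
          (f := fun w : E => (⟨p, w⟩ : TangentBundle 𝓘(ℝ, E) M)) hL.smooth
          (contMDiff_fiberInclusion p).contMDiffOn fun w hw => hw
      · rintro rfl
        exact h0A p hw
  · ext v
    constructor
    · rintro ⟨hv, hv0⟩
      exact (h.mem_iff_of_isAssociatedTriple hTC hv0).2 (hbd v hv)
    · intro hv
      have hv0 := hC.notMem_zeroVectors hv
      exact ⟨(Set.ext_iff.1 hfr v).2 ((h.mem_iff_of_isAssociatedTriple hTC hv0).1 hv), hv0⟩

theorem exists_isGlobalLorentzFinslerMetricWithCone [T2Space M] [SigmaCompactSpace M]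
    {C : Set (TangentBundle 𝓘(ℝ, E) M)} (hk : 2 ≤ k)
    (hC : IsConeStructure k C) (hTC : IsAssociatedTriple Ω T F C)
    {U : Set (TangentBundle 𝓘(ℝ, E) M)} (hU : IsOpen U)
    (hTU : ∀ p, (⟨p, T p⟩ : TangentBundle 𝓘(ℝ, E) M) ∈ U) :
    ∃ L : TangentBundle 𝓘(ℝ, E) M → ℝ, IsGlobalLorentzFinslerMetricWithCone k C L ∧
      ∀ v, v ∉ radialSaturation U → reflectVector Ω T v ∉ radialSaturation U →
        L v = continuousMetric Ω T F v := by
  obtain ⟨B, hB, hBs⟩ := exists_pos_form (E := E) (M := M) k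
  obtain ⟨ε, hεs, hε⟩ := h.exists_smoothingScale hB hBs.continuous hU hTU k
  exact ⟨_, h.isGlobalLorentzFinslerMetricWithCone hk hC hTC hB hBs hεs hε, fun v hv hv' =>
    h.smoothedMetricOnBundle_eq_continuousMetric hk hB hε hv hv'⟩

end IsConeTriple

end Metric

/-! ### Convex geometry of a strong cone -/

theorem IsPreconnected.inter_frontier_nonempty {X : Type*} [TopologicalSpace X] {s A : Set X}
    (hs : IsPreconnected s) (hA : IsOpen A) {x y : X} (hx : x ∈ s) (hxA : x ∈ A) (hy : y ∈ s)
    (hyA : y ∉ A) : (s ∩ frontier A).Nonempty := by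
  by_contra h0
  have h1 : ∀ z ∈ s, z ∉ A → z ∉ closure A := fun z hz hzA hzc =>
    h0 ⟨z, hz, hA.frontier_eq ▸ ⟨hzc, hzA⟩⟩
  obtain ⟨z, -, hzA, hzc⟩ := hs A (closure A)ᶜ hA isClosed_closure.isOpen_compl
    (fun z hz => (em (z ∈ A)).imp id (h1 z hz)) ⟨x, hx, hxA⟩ ⟨y, hy, h1 y hy hyA⟩
  exact hzc (subset_closure hzA)

namespace IsStrongConeWithInterior

variable {E : Type*} [NormedAddCommGroup E] [NormedSpace ℝ E] {k : ℕ∞} {C A : Set E}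
  (h : IsStrongConeWithInterior k C A)
include h

theorem subset_frontier : C ⊆ frontier A := h.boundary ▸ sdiff_subset

theorem interior_nonempty : A.Nonempty := by
  obtain ⟨v, hv⟩ := h.nonempty
  exact closure_nonempty_iff.1 ⟨v, frontier_subset_closure (h.subset_frontier hv)⟩

theorem notMem_of_mem_interior {v : E} (hv : v ∈ A) : v ∉ C := fun hvC => by
  have h1 := h.subset_frontier hvC
  rw [h.isOpen_interior.frontier_eq] at h1
  exact h1.2 hv

theorem mem_of_mem_frontier {v : E} (hv : v ∈ frontier A) (hv0 : v ≠ 0) : v ∈ C :=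
  h.boundary ▸ ⟨hv, hv0⟩

theorem mem_or_mem_of_mem_closure {v : E} (hv : v ∈ closure A) (hv0 : v ≠ 0) : v ∈ A ∨ v ∈ C := by
  by_cases hA : v ∈ A
  · exact .inl hA
  · exact .inr (h.mem_of_mem_frontier (h.isOpen_interior.frontier_eq ▸ ⟨hv, hA⟩) hv0)

/-- Scale invariance is assumed only for the hypersurface. A ray that left `A` would cross the
frontier at a nonzero point, hence in `C`, and rescaling this point would put `v` in `C`. -/
theorem isConic_interior : IsConic A := by
  intro v hv c hc
  by_contra hcv
  have hv0 : v ≠ 0 := fun h0 => h.zero_notMem_interior (h0 ▸ hv)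
  have h1 : IsPreconnected ((fun r : ℝ => r • v) '' Ioi 0) :=
    isPreconnected_Ioi.image _ (by fun_prop)
  obtain ⟨_, ⟨r, hr, rfl⟩, hr'⟩ := h1.inter_frontier_nonempty h.isOpen_interior
    (x := v) (y := c • v) ⟨1, mem_Ioi.2 one_pos, one_smul ℝ v⟩ hv ⟨c, hc, rfl⟩ hcv
  have hr : 0 < r := hr
  have h2 := h.conic _ (h.mem_of_mem_frontier hr' (smul_ne_zero hr.ne' hv0)) r⁻¹ (inv_pos.2 hr)
  rw [smul_smul, inv_mul_cancel₀ hr.ne', one_smul] at h2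
  exact h.notMem_of_mem_interior hv h2

theorem smul_mem_closure {v : E} (hv : v ∈ closure A) {c : ℝ} (hc : 0 < c) : c • v ∈ closure A :=
  map_mem_closure (f := fun v : E => c • v) (by fun_prop) hv fun w hw => h.isConic_interior w hw c hc

theorem add_mem_interior {v w : E} (hv : v ∈ closure A) (hw : w ∈ A) : v + w ∈ A := by
  have h1 := h.convex_interior.combo_closure_interior_mem_interior hv
    (h.isOpen_interior.interior_eq.symm ▸ hw) (a := 1 / 2) (b := 1 / 2) (by norm_num) (by norm_num)
    (by norm_num)
  have h2 := h.isConic_interior _ (interior_subset h1) 2 two_pos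
  rw [← smul_add, smul_smul] at h2
  norm_num at h2
  exact h2

theorem add_smul_mem_interior {v w : E} (hv : v ∈ closure A) (hw : w ∈ A) {c : ℝ} (hc : 0 < c) :
    v + c • w ∈ A :=
  h.add_mem_interior hv (h.isConic_interior w hw c hc)

/-- Salience is assumed only on `C`. If `v` or `-v` were interior, the sum of the two would be
interior, yet it is `0`. -/
theorem neg_notMem_closure {v : E} (hv : v ∈ closure A) (hv0 : v ≠ 0) : -v ∉ closure A := by
  intro hn
  rcases h.mem_or_mem_of_mem_closure hv hv0 with hA | hC
  · exact h.zero_notMem_interior (by simpa using h.add_mem_interior hn hA)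
  · rcases h.mem_or_mem_of_mem_closure hn (neg_ne_zero.2 hv0) with hA' | hC'
    · exact h.zero_notMem_interior (by simpa using h.add_mem_interior hv hA')
    · exact h.salient v hC hC'

theorem mem_closure {v : E} (hv : v ∈ C) : v ∈ closure A :=
  frontier_subset_closure (h.subset_frontier hv)

/-- Each vector of the closure of the interior is positive for a form which is nonnegative there. -/
theorem exists_form_pos_at {u : E} (hu : u ∈ closure A) (hu0 : u ≠ 0) :
    ∃ f : E →L[ℝ] ℝ, (∀ v ∈ closure A, 0 ≤ f v) ∧ 0 < f u := by
  obtain ⟨f, c, hc, hf⟩ := geometric_hahn_banach_point_closed h.convex_interior.closure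
    isClosed_closure (h.neg_notMem_closure hu hu0)
  have hnonneg : ∀ v ∈ closure A, 0 ≤ f v := by
    intro v hv
    by_contra! hneg
    -- The multiple is chosen so that `f` takes the value `-(|c| + 1)`, below the separating
    -- constant `c`.
    have h1 := hf _ (h.smul_mem_closure hv (c := (|c| + 1) / -f v)
      (div_pos (by positivity) (neg_pos.2 hneg)))
    rw [map_smul, smul_eq_mul, div_mul_eq_mul_div, div_neg, mul_div_cancel_right₀ _ hneg.ne] at h1
    linarith [neg_abs_le c]
  refine ⟨f, hnonneg, ?_⟩
  by_contra! hle
  rw [map_neg] at hc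
  have hfu := hf u hu
  linarith

/-- A salient cone admits a linear form which is positive on its closure. -/
theorem exists_form_pos [FiniteDimensional ℝ E] :
    ∃ ℓ : E →L[ℝ] ℝ, ∀ v ∈ closure A, v ≠ 0 → 0 < ℓ v := by
  have hK : IsCompact (closure A ∩ Metric.sphere 0 1) :=
    IsCompact.inter_left (isCompact_sphere (0 : E) 1) isClosed_closure
  have h0 (u : E) (hu : u ∈ closure A ∩ Metric.sphere 0 1) : u ≠ 0 := fun h1 => by
    simp [h1] at hu
  choose! f hf hfu using fun u (hu : u ∈ closure A ∩ Metric.sphere 0 1) =>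
    h.exists_form_pos_at hu.1 (h0 u hu)
  -- Finitely many of these forms have a positive member at each unit vector of the closure; all are
  -- nonnegative, so their sum is positive.
  obtain ⟨s, hs, hsK⟩ := hK.elim_nhds_subcover (fun u => {v | 0 < f u v}) fun u hu =>
    (isOpen_lt continuous_const (f u).continuous).mem_nhds (hfu u hu)
  refine ⟨∑ u ∈ s, f u, fun v hv hv0 => ?_⟩
  have hn : 0 < ‖v‖⁻¹ := inv_pos.2 (norm_pos_iff.2 hv0)
  have h1 := hsK (a := ‖v‖⁻¹ • v) ⟨h.smul_mem_closure hv hn, by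
    rw [mem_sphere_zero_iff_norm, norm_smul, norm_inv, norm_norm,
      inv_mul_cancel₀ (norm_ne_zero_iff.2 hv0)]⟩
  obtain ⟨u, hu, hpos⟩ := mem_iUnion₂.1 h1
  have hpos : 0 < f u (‖v‖⁻¹ • v) := hpos
  rw [map_smul, smul_eq_mul] at hpos
  rw [sum_apply]
  exact Finset.sum_pos' (fun i hi => hf i (hs i hi) v hv) ⟨u, hu, pos_of_mul_pos_right hpos hn.le⟩

/-- From a point of the closure, moving in an interior direction enters `A` at once, and `A` is
disjoint from `C`; so a line with such a direction crosses at most once. -/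
theorem eq_of_add_smul_mem {u v : E} (hv : v ∈ A) {s t : ℝ} (hs : u + s • v ∈ C)
    (ht : u + t • v ∈ C) : s = t := by
  have key {s t : ℝ} (hs : u + s • v ∈ C) (ht : u + t • v ∈ C) : ¬ s < t := fun hst => by
    refine h.notMem_of_mem_interior ?_ ht
    have := h.add_smul_mem_interior (h.mem_closure hs) hv (sub_pos.2 hst)
    rwa [add_assoc, ← add_smul, add_sub_cancel] at this
  exact le_antisymm (not_lt.1 (key ht hs)) (not_lt.1 (key hs ht))

theorem smul_notMem {v : E} (hv : v ∈ A) (t : ℝ) : t • v ∉ C := by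
  intro ht
  rcases lt_trichotomy t 0 with h0 | h0 | h0
  · have hv0 : v ≠ 0 := fun h0 => h.zero_notMem_interior (h0 ▸ hv)
    refine h.neg_notMem_closure (h.mem_closure ht) (smul_ne_zero h0.ne hv0) ?_
    rw [← neg_smul]
    exact subset_closure (h.isConic_interior v hv (-t) (neg_pos.2 h0))
  · rw [h0, zero_smul] at ht
    exact h.zero_notMem ht
  · exact h.notMem_of_mem_interior (h.isConic_interior v hv t h0) ht

/-- A line through a vector of `ker ℓ` directed to the interior crosses the cone. -/
theorem exists_add_smul_mem {ℓ : E →L[ℝ] ℝ} (hℓ : ∀ v ∈ closure A, v ≠ 0 → 0 < ℓ v) {u v : E}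
    (hv : v ∈ A) (hu : ℓ u = 0) (hu0 : u ≠ 0) : ∃ t > (0 : ℝ), u + t • v ∈ C := by
  have huA : u ∉ closure A := fun h1 => (hℓ u h1 hu0).ne' hu
  -- Seen from far along the direction `v`, the point `u + t v` is close to the ray of `v`, hence
  -- interior for large `t`; `u` itself is outside the closure, so the half-line meets the frontier.
  have hlim : Tendsto (fun t : ℝ => t • u + v) (𝓝[>] 0) (𝓝 v) := by
    have : Continuous fun t : ℝ => t • u + v := by fun_prop
    have h1 : Tendsto (fun t : ℝ => t • u + v) (𝓝 0) (𝓝 v) := by simpa using this.tendsto 0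
    exact h1.mono_left nhdsWithin_le_nhds
  obtain ⟨t, htA, ht⟩ := ((hlim.eventually (h.isOpen_interior.mem_nhds hv)).and
    self_mem_nhdsWithin).exists
  have ht : 0 < t := ht
  have h1 : u + t⁻¹ • v ∈ A := by
    have := h.isConic_interior _ htA t⁻¹ (inv_pos.2 ht)
    rwa [smul_add, smul_smul, inv_mul_cancel₀ ht.ne', one_smul] at this
  have h2 : IsPreconnected ((fun r : ℝ => u + r • v) '' Ici 0) :=
    isPreconnected_Ici.image _ (by fun_prop)
  obtain ⟨_, ⟨r, hr, rfl⟩, hr'⟩ := h2.inter_frontier_nonempty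
    h.isOpen_interior ⟨t⁻¹, (inv_pos.2 ht).le, rfl⟩ h1
    (y := u) ⟨0, mem_Ici.2 le_rfl, by simp⟩ fun h3 => huA (subset_closure h3)
  have hr : 0 ≤ r := hr
  have hr0 : r ≠ 0 := by
    rintro rfl
    simp only [zero_smul, add_zero] at hr'
    exact huA (frontier_subset_closure hr')
  refine ⟨r, hr.lt_of_ne' hr0, h.mem_of_mem_frontier hr' fun h3 => ?_⟩
  have h4 := congrArg ℓ h3
  have hv0 : v ≠ 0 := fun h0 => h.zero_notMem_interior (h0 ▸ hv)
  rw [map_add, hu, map_smul, smul_eq_mul, zero_add, map_zero] at h4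
  exact (mul_pos (hr.lt_of_ne' hr0) (hℓ v (subset_closure hv) hv0)).ne' h4

/-- Conversely, if all lines through nonzero vectors of `ker ℓ` with direction `v` cross the cone,
then `v` is directed to the interior and `ℓ` is positive there. -/
theorem mem_interior_of_forall_exists [FiniteDimensional ℝ E] (hn : 2 ≤ Module.finrank ℝ E)
    {ℓ : E →L[ℝ] ℝ} {v : E} (hv : ℓ v = 1)
    (hC : ∀ u, ℓ u = 0 → u ≠ 0 → ∃ t > (0 : ℝ), u + t • v ∈ C) :
    v ∈ A ∧ ∀ w ∈ closure A, w ≠ 0 → 0 < ℓ w := by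
  have hv0 : v ≠ 0 := fun h0 => by simp [h0] at hv
  have hvA : v ∈ A := by
    -- Otherwise a form `f` separates `v` from `A`, and conicity gives `f ≤ 0` on the closure and `f
    -- v ≥ 0`. The crossings from `u` and from `-u` give `f v ≤ 0`, hence `f v = 0`, and then `f =
    -- 0` on `ker ℓ`. So `f = 0`, against strict separation. Dimension at least two supplies a
    -- nonzero `u`.
    by_contra hvA
    obtain ⟨f, hf⟩ := geometric_hahn_banach_open_point h.convex_interior h.isOpen_interior hvA
    have hneg : ∀ a ∈ A, f a ≤ 0 := by
      intro a ha
      by_contra! hpos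
      have h1 := hf _ (h.isConic_interior a ha ((|f v| + 1) / f a) (by positivity))
      rw [map_smul, smul_eq_mul, div_mul_cancel₀ _ hpos.ne'] at h1
      linarith [le_abs_self (f v)]
    have hneg' : ∀ a ∈ closure A, f a ≤ 0 := fun a ha =>
      closure_minimal (t := {a | f a ≤ 0}) hneg (isClosed_le f.continuous continuous_const) ha
    have hker : ∀ u, ℓ u = 0 → u ≠ 0 → f u + f (-u) = 0 ∧ 0 ≤ f v ∧ f v ≤ 0 ∧ f u ≤ 0 := by
      intro u hu hu0
      obtain ⟨s, hs, hsC⟩ := hC u hu hu0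
      obtain ⟨t, ht, htC⟩ := hC (-u) (by simp [hu]) (neg_ne_zero.2 hu0)
      have h1 := hneg' _ (h.mem_closure hsC)
      have h2 := hneg' _ (h.mem_closure htC)
      simp only [map_add, map_neg, map_smul, smul_eq_mul] at h1 h2 ⊢
      have h3 : 0 ≤ f v := by
        by_contra! h4
        obtain ⟨a, ha⟩ := h.interior_nonempty
        have h5 : 0 < f v / (2 * f a) := div_pos_of_neg_of_neg h4 (by linarith [hf a ha])
        have h6 := hf _ (h.isConic_interior a ha _ h5)
        have h7 : f a < 0 := (hf a ha).trans h4
        rw [map_smul, smul_eq_mul] at h6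
        have h8 : f v / (2 * f a) * f a = f v / 2 := by
          have := h7.ne
          field_simp
        linarith
      have h4 : f v ≤ 0 := by nlinarith
      have h5 : f v = 0 := le_antisymm h4 h3
      rw [h5] at h1
      exact ⟨by ring, h3, h4, by linarith⟩
    obtain ⟨u, hu0, hu⟩ : ∃ u, u ≠ 0 ∧ ℓ u = 0 := by
      have h1 : 0 < Module.finrank ℝ (LinearMap.ker ℓ.toLinearMap) := by
        have h2 := LinearMap.finrank_range_add_finrank_ker ℓ.toLinearMap
        have h3 := Submodule.finrank_le (LinearMap.range ℓ.toLinearMap)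
        rw [Module.finrank_self] at h3
        omega
      obtain ⟨⟨u, hu⟩, hu'⟩ := (Module.finrank_pos_iff_exists_ne_zero).1 h1
      exact ⟨u, fun h0 => hu' (Subtype.ext h0), hu⟩
    have hfv : f v = 0 := le_antisymm (hker u hu hu0).2.2.1 (hker u hu hu0).2.1
    have hf0 : ∀ w, f w = 0 := by
      intro w
      have h1 : ℓ (w - ℓ w • v) = 0 := by simp [hv]
      have h2 : f (w - ℓ w • v) = 0 := by
        by_cases h3 : w - ℓ w • v = 0
        · rw [h3, map_zero]
        · have h4 := hker _ h1 h3
          have h5 := hker (-(w - ℓ w • v)) (by rw [map_neg, h1, neg_zero]) (neg_ne_zero.2 h3)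
          linarith [h4.1, h4.2.2.2, h5.2.2.2]
      rwa [map_sub, map_smul, hfv, smul_zero, sub_zero] at h2
    obtain ⟨a, ha⟩ := h.interior_nonempty
    exact (hf a ha).ne (by rw [hf0, hf0])
  refine ⟨hvA, fun w hw hw0 => ?_⟩
  -- If `ℓ w ≤ 0`, the crossing point of the line through the projection of `w` to `ker ℓ` is `w`
  -- plus a positive multiple of `v`, hence interior, which is absurd.
  by_contra! hneg
  have hu : ℓ (w + (-ℓ w) • v) = 0 := by simp [hv]
  by_cases hu0 : w + (-ℓ w) • v = 0
  · have h1 : ℓ w ≠ 0 := fun h1 => hw0 (by simpa [h1] using hu0)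
    have h2 : (-ℓ w) • v = -w := (neg_eq_of_add_eq_zero_right hu0).symm
    refine h.neg_notMem_closure hw hw0 ?_
    rw [← h2]
    exact subset_closure (h.isConic_interior v hvA _ (neg_pos.2 (hneg.lt_of_ne h1)))
  · obtain ⟨t, ht, htC⟩ := hC _ hu hu0
    refine h.notMem_of_mem_interior ?_ htC
    rw [add_assoc, ← add_smul]
    exact h.add_smul_mem_interior hw hvA (by linarith)

/-- Interior directions are transverse to the cone, by convexity alone. If `v` were tangent at `c`,
perturbing it to `v ± δ N` with `N` transverse would give interior directions along which `f` takes
opposite signs near `c`. The segment between two such points lies in `A`, yet contains a zero of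
`f`, that is, a point of `C`. -/
theorem fderiv_ne_zero {c : E} {U : Set E} {f : E → ℝ}
    (hk : 1 ≤ k) (hf : IsLocalDefiningFunction 𝓘(ℝ, E) k C c U f) (hc : c ∈ C) {v : E}
    (hv : v ∈ A) : fderiv ℝ f c v ≠ 0 := by
  intro h0
  have hreg : fderiv ℝ f c ≠ 0 := fun h1 => hf.regular (mfderiv_eq_fderiv.trans h1)
  have hk0 : (k : WithTop ℕ∞) ≠ 0 := by
    have : k ≠ 0 := fun h0 => by simp [h0] at hk
    exact_mod_cast this
  have hdiff : DifferentiableAt ℝ f c :=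
    (hf.smooth.contMDiffAt (hf.isOpen.mem_nhds hf.mem)).contDiffAt.differentiableAt hk0
  obtain ⟨N, hN⟩ : ∃ N, 0 < fderiv ℝ f c N := by
    obtain ⟨N, hN⟩ := ContinuousLinearMap.exists_ne_zero hreg
    rcases lt_or_gt_of_ne hN with h1 | h1
    · exact ⟨-N, by rw [map_neg]; linarith⟩
    · exact ⟨N, h1⟩
  have hfc : f c = 0 := (hf.zero_set.subset ⟨hc, hf.mem⟩).2
  have hA (s : ℝ) : ∀ᶠ δ in 𝓝[>] (0 : ℝ), v + (δ * s) • N ∈ A := by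
    have h1 : Continuous fun δ : ℝ => v + (δ * s) • N := by fun_prop
    have h2 : Tendsto (fun δ : ℝ => v + (δ * s) • N) (𝓝 0) (𝓝 v) := by simpa using h1.tendsto 0
    exact (h2.mono_left nhdsWithin_le_nhds).eventually (h.isOpen_interior.mem_nhds hv)
  obtain ⟨δ, ⟨h1, h2⟩, hδ⟩ := (((hA 1).and (hA (-1))).and self_mem_nhdsWithin).exists
  have hδ : 0 < δ := hδ
  obtain ⟨ρ, hρ, hρU⟩ := Metric.isOpen_iff.1 hf.isOpen c hf.mem
  have hball (w : E) : ∀ᶠ r in 𝓝[>] (0 : ℝ), c + r • w ∈ Metric.ball c ρ := by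
    have h3 : Continuous fun r : ℝ => c + r • w := by fun_prop
    have h4 : Tendsto (fun r : ℝ => c + r • w) (𝓝 0) (𝓝 c) := by simpa using h3.tendsto 0
    exact (h4.mono_left nhdsWithin_le_nhds).eventually (Metric.ball_mem_nhds c hρ)
  have hderiv (w : E) : HasDerivAt (fun r : ℝ => f (c + r • w)) (fderiv ℝ f c w) 0 :=
    hdiff.hasFDerivAt.hasLineDerivAt w
  have hpos (w : E) (hw : 0 < fderiv ℝ f c w) : ∀ᶠ r in 𝓝[>] (0 : ℝ), 0 < f (c + r • w) := by
    have h3 := (hderiv w).tendsto_slope_zero_right.eventually (lt_mem_nhds hw)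
    filter_upwards [h3, self_mem_nhdsWithin] with r hr hr0
    have hr0 : 0 < r := hr0
    simp only [zero_add, zero_smul, add_zero, hfc, sub_zero, smul_eq_mul] at hr
    exact pos_of_mul_pos_right hr (inv_pos.2 hr0).le
  have hneg (w : E) (hw : fderiv ℝ f c w < 0) : ∀ᶠ r in 𝓝[>] (0 : ℝ), f (c + r • w) < 0 := by
    have h3 := (hderiv w).tendsto_slope_zero_right.eventually (gt_mem_nhds hw)
    filter_upwards [h3, self_mem_nhdsWithin] with r hr hr0
    have hr0 : 0 < r := hr0
    simp only [zero_add, zero_smul, add_zero, hfc, sub_zero, smul_eq_mul] at hr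
    by_contra! h4
    exact hr.not_ge (mul_nonneg (inv_pos.2 hr0).le h4)
  have e1 : fderiv ℝ f c (v + (δ * 1) • N) = δ * fderiv ℝ f c N := by
    rw [map_add, map_smul, h0]; simp
  have e2 : fderiv ℝ f c (v + (δ * -1) • N) = -(δ * fderiv ℝ f c N) := by
    rw [map_add, map_smul, h0]; simp
  obtain ⟨r, ⟨⟨⟨h3, h4⟩, h5⟩, h6⟩, hr⟩ := (((((hball (v + (δ * 1) • N)).and
    (hball (v + (δ * -1) • N))).and (hpos _ (by rw [e1]; positivity))).and
    (hneg _ (by rw [e2]; have := mul_pos hδ hN; linarith))).and self_mem_nhdsWithin).exists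
  have hr : 0 < r := hr
  have hseg : segment ℝ (c + r • (v + (δ * -1) • N)) (c + r • (v + (δ * 1) • N)) ⊆ A ∩ U :=
    subset_inter (h.convex_interior.segment_subset
      (h.add_smul_mem_interior (h.mem_closure hc) h2 hr)
      (h.add_smul_mem_interior (h.mem_closure hc) h1 hr))
      (((convex_ball c ρ).segment_subset h4 h3).trans hρU)
  have hcont : ContinuousOn f (segment ℝ (c + r • (v + (δ * -1) • N)) (c + r • (v + (δ * 1) • N))) :=
    hf.smooth.continuousOn.mono (hseg.trans inter_subset_right)
  obtain ⟨x, hx, hx0⟩ := (convex_segment _ _).isPreconnected.intermediate_value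
    (left_mem_segment ℝ _ _) (right_mem_segment ℝ _ _) hcont ⟨h6.le, h5.le⟩
  exact h.notMem_of_mem_interior (hseg hx).1 (hf.zero_set.superset ⟨(hseg hx).2, hx0⟩).1

end IsStrongConeWithInterior

/-! ### Implicit functions on manifolds -/

section Implicit

theorem hasDerivAt_comp_add_smul {E : Type*} [NormedAddCommGroup E] [NormedSpace ℝ E] {g : E → ℝ}
    {v u : E} {t : ℝ} (hg : DifferentiableAt ℝ g (v + t • u)) :
    HasDerivAt (fun s : ℝ => g (v + s • u)) (fderiv ℝ g (v + t • u) u) t :=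
  HasFDerivAt.comp_hasDerivAt (f := fun s : ℝ => v + s • u) t hg.hasFDerivAt
    (by simpa using ((hasDerivAt_id t).smul_const u).const_add v)

/-- The implicit function theorem read in a chart of `N`; the invertible partial derivative is
multiplication by `d`. -/
theorem exists_implicit_of_contMDiffAt {E' : Type*} [NormedAddCommGroup E'] [NormedSpace ℝ E']
    [CompleteSpace E'] {H' : Type*} [TopologicalSpace H'] {J : ModelWithCorners ℝ E' H'}
    [J.Boundaryless] {N : Type*} [TopologicalSpace N] [ChartedSpace H' N] {n : WithTop ℕ∞}
    [IsManifold J n N] (hn : n ≠ 0) {Ψ : N × ℝ → ℝ} {x₀ : N} {t₀ : ℝ}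
    (hΨ : ContMDiffAt (J.prod 𝓘(ℝ, ℝ)) 𝓘(ℝ, ℝ) n Ψ (x₀, t₀)) {d : ℝ} (hd : d ≠ 0)
    (hΨd : HasDerivAt (fun t => Ψ (x₀, t)) d t₀) :
    ∃ τ : N → ℝ, ContMDiffAt J 𝓘(ℝ, ℝ) n τ x₀ ∧ τ x₀ = t₀ ∧
      ∀ᶠ x in 𝓝 x₀, Ψ (x, τ x) = Ψ (x₀, t₀) := by
  set φ := extChartAt J x₀ with hφ
  have hφx : φ.symm (φ x₀) = x₀ := extChartAt_to_inv x₀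
  let g : E' × ℝ → ℝ := fun q => Ψ (φ.symm q.1, q.2)
  have hsymm : ContMDiffAt 𝓘(ℝ, E') J n φ.symm (φ x₀) :=
    (contMDiffOn_extChartAt_symm x₀).contMDiffAt (extChartAt_target_mem_nhds x₀)
  have hpair : ContMDiffAt 𝓘(ℝ, E' × ℝ) (J.prod 𝓘(ℝ, ℝ)) n
      (fun q : E' × ℝ => (φ.symm q.1, q.2)) (φ x₀, t₀) := by
    refine ContMDiffAt.prodMk ?_ contDiff_snd.contMDiff.contMDiffAt
    exact ContMDiffAt.comp (I' := 𝓘(ℝ, E')) (g := φ.symm) (f := fun q : E' × ℝ => q.1)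
      (φ x₀, t₀) hsymm contDiff_fst.contMDiff.contMDiffAt
  have hg : ContDiffAt ℝ n g (φ x₀, t₀) := by
    refine ContMDiffAt.contDiffAt ?_
    refine ContMDiffAt.comp (I' := J.prod 𝓘(ℝ, ℝ)) (g := Ψ)
      (f := fun q : E' × ℝ => (φ.symm q.1, q.2)) (φ x₀, t₀) ?_ hpair
    simpa only [hφx] using hΨ
  have hgd : fderiv ℝ g (φ x₀, t₀) (0, 1) = d := by
    have h1 : HasDerivAt (fun t : ℝ => (φ x₀, t)) ((0 : E'), (1 : ℝ)) t₀ :=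
      (hasDerivAt_const t₀ (φ x₀)).prodMk (hasDerivAt_id t₀)
    have h2 : HasDerivAt (fun t : ℝ => g (φ x₀, t)) (fderiv ℝ g (φ x₀, t₀) (0, 1)) t₀ :=
      HasFDerivAt.comp_hasDerivAt (f := fun t : ℝ => (φ x₀, t)) t₀
        (hg.differentiableAt hn).hasFDerivAt h1
    simp only [g, hφx] at h2
    exact h2.unique hΨd
  have hinv : (fderiv ℝ g (φ x₀, t₀) ∘L .inr ℝ E' ℝ).IsInvertible := by
    refine ⟨ContinuousLinearEquiv.unitsEquivAut ℝ (Units.mk0 d hd), ?_⟩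
    ext
    simp [hgd]
  refine ⟨fun x => hg.implicitFunction hn hinv (φ x), ?_, ?_, ?_⟩
  · exact ContMDiffAt.comp (I' := 𝓘(ℝ, E')) (f := φ) x₀
      (hg.contDiffAt_implicitFunction hn hinv).contMDiffAt contMDiffAt_extChartAt
  · exact hg.implicitFunction_apply_self hn hinv
  · have h1 := (continuousAt_extChartAt (I := J) x₀).eventually
      (hg.eventually_apply_implicitFunction hn hinv)
    filter_upwards [h1, extChartAt_source_mem_nhds (I := J) x₀] with x hx hxs
    have h2 : φ.symm (φ x) = x := φ.left_inv hxs
    have h3 : Ψ (φ.symm (φ x), hg.implicitFunction hn hinv (φ x)) = Ψ (φ.symm (φ x₀), t₀) := hx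
    rwa [h2, hφx] at h3

end Implicit

/-! ### Smooth dependence of crossings on the line -/

section Crossing

variable {E : Type*} [NormedAddCommGroup E] [NormedSpace ℝ E]
  {M : Type*} [TopologicalSpace M] [ChartedSpace E M] [IsManifold 𝓘(ℝ, E) ∞ M]
  {k : ℕ∞} {C : Set (TangentBundle 𝓘(ℝ, E) M)}

/-- A local defining function of a cone structure restricts to local defining functions of the
cones in the fibres. -/
theorem IsConeStructure.isLocalDefiningFunction_fiber (hC : IsConeStructure k C) (hk : 1 ≤ k)
    {p : M} {c : E} (hc : (⟨p, c⟩ : TangentBundle 𝓘(ℝ, E) M) ∈ C)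
    {U : Set (TangentBundle 𝓘(ℝ, E) M)} {Φ : TangentBundle 𝓘(ℝ, E) M → ℝ}
    (hΦ : IsLocalDefiningFunction 𝓘(ℝ, E).tangent k C ⟨p, c⟩ U Φ) :
    IsLocalDefiningFunction 𝓘(ℝ, E) k (fiberAt C p) c (fiberAt U p) (fun w => Φ ⟨p, w⟩) := by
  have hk0 : (k : WithTop ℕ∞) ≠ 0 := by
    have : k ≠ 0 := fun h0 => by simp [h0] at hk
    exact_mod_cast this
  refine ⟨hΦ.isOpen.preimage (continuous_fiberInclusion p), hΦ.mem, ?_, fun h0 => ?_, ?_⟩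
  · exact ContMDiffOn.comp (I' := 𝓘(ℝ, E).tangent)
      (f := fun w : E => (⟨p, w⟩ : TangentBundle 𝓘(ℝ, E) M)) hΦ.smooth
      (contMDiff_fiberInclusion p).contMDiffOn fun w hw => hw
  · refine hΦ.regular ?_
    have h1 : MDifferentiableAt 𝓘(ℝ, E).tangent 𝓘(ℝ, ℝ) Φ ⟨p, c⟩ :=
      (hΦ.smooth.contMDiffAt (hΦ.isOpen.mem_nhds hΦ.mem)).mdifferentiableAt hk0
    have h2 := (fderiv_comp_fiberInclusion h1).symm.trans (mfderiv_eq_fderiv.symm.trans h0)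
    -- If the fibre differential vanished, the vertical space would lie in the kernel of the
    -- differential of `Φ`; transversality would then make that kernel everything, against
    -- regularity.
    have h3 : tangentOfFiber p c ≤
        LinearMap.ker (mfderiv 𝓘(ℝ, E).tangent 𝓘(ℝ, ℝ) Φ ⟨p, c⟩).toLinearMap := by
      rintro _ ⟨w, rfl⟩
      exact congrArg (fun A : E →L[ℝ] ℝ => A w) h2
    have h4 := hC.transverse p c hc U Φ hΦ
    rw [sup_eq_right.2 h3] at h4
    exact ContinuousLinearMap.ext fun w => (h4.symm ▸ Submodule.mem_top :
      w ∈ LinearMap.ker (mfderiv 𝓘(ℝ, E).tangent 𝓘(ℝ, ℝ) Φ ⟨p, c⟩).toLinearMap)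
  · ext w
    exact Set.ext_iff.1 hΦ.zero_set (⟨p, w⟩ : TangentBundle 𝓘(ℝ, E) M)

/-- The lines in the fibres with a given direction field, transverse to the cones, cross the cone
structure at parameters that depend smoothly on the line. -/
theorem IsConeStructure.exists_crossing [FiniteDimensional ℝ E] (hC : IsConeStructure k C)
    (hk : 1 ≤ k) {T : (p : M) → TangentSpace 𝓘(ℝ, E) p} {v : TangentBundle 𝓘(ℝ, E) M}
    (hT : ContMDiffAt 𝓘(ℝ, E) 𝓘(ℝ, E).tangent k
      (fun p => (⟨p, T p⟩ : TangentBundle 𝓘(ℝ, E) M)) v.1)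
    {A : Set E} (hA : IsStrongConeWithInterior k (fiberAt C v.1) A) (hTA : T v.1 ∈ A) {t₀ : ℝ}
    (ht : (⟨v.1, v.2 + t₀ • T v.1⟩ : TangentBundle 𝓘(ℝ, E) M) ∈ C) :
    ∃ τ : TangentBundle 𝓘(ℝ, E) M → ℝ, ContMDiffAt 𝓘(ℝ, E).tangent 𝓘(ℝ, ℝ) k τ v ∧ τ v = t₀ ∧
      ∀ᶠ w in 𝓝 v, (⟨w.1, w.2 + τ w • T w.1⟩ : TangentBundle 𝓘(ℝ, E) M) ∈ C := by
  have hk0 : (k : WithTop ℕ∞) ≠ 0 := by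
    have : k ≠ 0 := fun h0 => by simp [h0] at hk
    exact_mod_cast this
  have hM : IsManifold 𝓘(ℝ, E) k M := .of_le (n := ∞) (by exact_mod_cast le_top)
  obtain ⟨U, Φ, hΦ⟩ := hC.hypersurface _ ht
  let S : TangentBundle 𝓘(ℝ, E) M × ℝ → TangentBundle 𝓘(ℝ, E) M :=
    fun q => ⟨q.1.1, q.1.2 + q.2 • T q.1.1⟩
  have hS : ContMDiffAt (𝓘(ℝ, E).tangent.prod 𝓘(ℝ, ℝ)) 𝓘(ℝ, E).tangent k S (v, t₀) := by
    have h1 : ContMDiffAt (𝓘(ℝ, E).tangent.prod 𝓘(ℝ, ℝ)) 𝓘(ℝ, E) k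
        (fun q : TangentBundle 𝓘(ℝ, E) M × ℝ => q.1.1) (v, t₀) :=
      ContMDiffAt.comp (I' := 𝓘(ℝ, E).tangent) (g := fun v : TangentBundle 𝓘(ℝ, E) M => v.1)
        (f := fun q : TangentBundle 𝓘(ℝ, E) M × ℝ => q.1) (v, t₀)
        (contMDiff_proj (TangentSpace 𝓘(ℝ, E) (M := M))).contMDiffAt contMDiffAt_fst
    have h2 : ContMDiffAt (𝓘(ℝ, E).tangent.prod 𝓘(ℝ, ℝ)) 𝓘(ℝ, E).tangent k
        (fun q : TangentBundle 𝓘(ℝ, E) M × ℝ => (⟨q.1.1, T q.1.1⟩ : TangentBundle 𝓘(ℝ, E) M))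
        (v, t₀) :=
      ContMDiffAt.comp (I' := 𝓘(ℝ, E)) (g := fun p => (⟨p, T p⟩ : TangentBundle 𝓘(ℝ, E) M))
        (f := fun q : TangentBundle 𝓘(ℝ, E) M × ℝ => q.1.1) (v, t₀) hT h1
    have h3 : ContMDiffAt (𝓘(ℝ, E).tangent.prod 𝓘(ℝ, ℝ)) 𝓘(ℝ, E).tangent k
        (fun q : TangentBundle 𝓘(ℝ, E) M × ℝ => (⟨q.1.1, q.1.2⟩ : TangentBundle 𝓘(ℝ, E) M))
        (v, t₀) := contMDiffAt_fst
    have h4 : ContMDiffAt (𝓘(ℝ, E).tangent.prod 𝓘(ℝ, ℝ)) 𝓘(ℝ, ℝ) k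
        (fun q : TangentBundle 𝓘(ℝ, E) M × ℝ => q.2) (v, t₀) := contMDiffAt_snd
    exact contMDiffWithinAt_add_smul (E := E) (n := k) (S := univ) (x₀ := (v, t₀))
      (b := fun q : TangentBundle 𝓘(ℝ, E) M × ℝ => q.1.1) (s := fun q => q.1.2)
      (t := fun q => T q.1.1) (c := fun q => q.2) h3 h2 h4
  have hΨ : ContMDiffAt (𝓘(ℝ, E).tangent.prod 𝓘(ℝ, ℝ)) 𝓘(ℝ, ℝ) k (fun q => Φ (S q)) (v, t₀) :=
    ContMDiffAt.comp (I' := 𝓘(ℝ, E).tangent) (g := Φ) (f := S) (v, t₀)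
      (hΦ.smooth.contMDiffAt (hΦ.isOpen.mem_nhds hΦ.mem)) hS
  have hfib := hC.isLocalDefiningFunction_fiber hk ht hΦ
  -- This is the derivative of `Φ` along the line, which the implicit function theorem requires to
  -- be nonzero.
  have hd := hA.fderiv_ne_zero hk hfib ht hTA
  have hdiff : DifferentiableAt ℝ (fun w : E => Φ ⟨v.1, w⟩) (v.2 + t₀ • T v.1) :=
    (hfib.smooth.contMDiffAt (hfib.isOpen.mem_nhds hfib.mem)).contDiffAt.differentiableAt hk0
  have hΨd : HasDerivAt (fun t => Φ (S (v, t)))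
      (fderiv ℝ (fun w : E => Φ ⟨v.1, w⟩) (v.2 + t₀ • T v.1) (T v.1)) t₀ :=
    hasDerivAt_comp_add_smul (E := E) (v := v.2) (u := T v.1) hdiff
  obtain ⟨τ, hτ, hτv, hτΦ⟩ := exists_implicit_of_contMDiffAt hk0 hΨ hd hΨd
  refine ⟨τ, hτ, hτv, ?_⟩
  have h0 : Φ (S (v, t₀)) = 0 := (hΦ.zero_set.subset ⟨ht, hΦ.mem⟩).2
  have hcont : ContinuousAt (fun w => S (w, τ w)) v := by
    refine ContinuousAt.comp (g := S) (f := fun w => (w, τ w)) ?_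
      (continuousAt_id.prodMk hτ.continuousAt)
    rw [hτv]
    exact hS.continuousAt
  have hU : ∀ᶠ w in 𝓝 v, S (w, τ w) ∈ U :=
    hcont.eventually (hΦ.isOpen.mem_nhds (by show S (v, τ v) ∈ U; rw [hτv]; exact hΦ.mem))
  filter_upwards [hτΦ, hU] with w hw hwU
  exact (hΦ.zero_set.superset ⟨hwU, hw.trans h0⟩).1

end Crossing

/-! ### Construction of the field and the one-form -/

section Gluing

variable {E : Type*} [NormedAddCommGroup E] [NormedSpace ℝ E] [FiniteDimensional ℝ E]
  {M : Type*} [TopologicalSpace M] [ChartedSpace E M] [IsManifold 𝓘(ℝ, E) ∞ M]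
  {k : ℕ∞} {C : Set (TangentBundle 𝓘(ℝ, E) M)}

/-- Near each point there are a vector field with values in the interior of the cones and a one-form
which is positive on their closures. -/
theorem IsConeStructure.exists_local_field_form (hC : IsConeStructure k C) (hk : 1 ≤ k)
    (hn : 2 ≤ Module.finrank ℝ E) {A : M → Set E}
    (hA : ∀ p, IsStrongConeWithInterior k (fiberAt C p) (A p)) (p₀ : M) :
    ∃ U ∈ 𝓝 p₀, ∃ (T : (p : M) → TangentSpace 𝓘(ℝ, E) p) (ℓ : E →L[ℝ] ℝ),
      ContMDiffOn 𝓘(ℝ, E) 𝓘(ℝ, E).tangent k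
        (fun p => (⟨p, T p⟩ : TangentBundle 𝓘(ℝ, E) M)) U ∧
      ∀ p ∈ U, p ∈ (trivializationAt E (TangentSpace 𝓘(ℝ, E) (M := M)) p₀).baseSet ∧
        T p ∈ A p ∧ ∀ w ∈ closure (A p), w ≠ 0 → 0 < ℓ (fiberCoord p₀ ⟨p, w⟩) := by
  have hp₀ := mem_baseSet_trivializationAt E (TangentSpace 𝓘(ℝ, E) (M := M)) p₀
  obtain ⟨ℓ₀, hℓ₀⟩ := (hA p₀).exists_form_pos
  obtain ⟨v₀, hv₀A, hv₀⟩ : ∃ v₀ ∈ A p₀, ℓ₀ v₀ = 1 := by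
    obtain ⟨a, ha⟩ := (hA p₀).interior_nonempty
    have ha0 : a ≠ 0 := fun h0 => (hA p₀).zero_notMem_interior (h0 ▸ ha)
    have hpos := hℓ₀ a (subset_closure ha) ha0
    refine ⟨(ℓ₀ a)⁻¹ • a, (hA p₀).isConic_interior a ha _ (inv_pos.2 hpos), ?_⟩
    rw [map_smul, smul_eq_mul, inv_mul_cancel₀ hpos.ne']
  let e := (trivializationAt E (TangentSpace 𝓘(ℝ, E) (M := M)) p₀).continuousLinearEquivAt ℝ p₀ hp₀
  let ℓ : E →L[ℝ] ℝ := ContinuousLinearMap.comp (M₂ := E) ℓ₀ (e.symm : E →L[ℝ] TangentSpace 𝓘(ℝ, E) p₀)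
  have hℓ (w : E) : ℓ (fiberCoord p₀ ⟨p₀, w⟩) = ℓ₀ w := congrArg ℓ₀ (e.symm_apply_apply w)
  set y₀ : E := fiberCoord p₀ ⟨p₀, v₀⟩ with hy₀
  -- The vector and the form chosen at `p₀` are extended with constant coordinates in the
  -- trivialization.
  let T : (p : M) → TangentSpace 𝓘(ℝ, E) p := fun p => (tangentOfCoord p₀ p y₀).2
  have hTp₀ : T p₀ = v₀ := e.symm_apply_apply v₀
  have hTs : ContMDiffOn 𝓘(ℝ, E) 𝓘(ℝ, E).tangent k
      (fun p => (⟨p, T p⟩ : TangentBundle 𝓘(ℝ, E) M))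
      (trivializationAt E (TangentSpace 𝓘(ℝ, E) (M := M)) p₀).baseSet :=
    ContMDiffOn.comp (I' := 𝓘(ℝ, E).prod 𝓘(ℝ, E)) (f := fun p : M => (p, y₀))
      ((contMDiffOn_tangentOfCoord (E := E) p₀).of_le (by exact_mod_cast le_top))
      (contMDiff_id.prodMk contMDiff_const).contMDiffOn fun p hp => ⟨hp, mem_univ _⟩
  have hTA : ∀ p ∈ (trivializationAt E (TangentSpace 𝓘(ℝ, E) (M := M)) p₀).baseSet,
      fiberCoord p₀ ⟨p, T p⟩ = y₀ := fun p hp => fiberCoord_tangentOfCoord hp y₀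
  -- `T p ∈ A p` is not visibly an open condition, as `A p` is chosen separately at each point. The
  -- crossing condition is: crossings persist by the implicit function theorem, and it is vacuous
  -- where the form is nonzero.
  have key := eventually_forall_unit (E := E) () p₀
    (P := fun _ v => ℓ (fiberCoord p₀ v) = 0 → ∃ t > (0 : ℝ),
      (⟨v.1, v.2 + t • T v.1⟩ : TangentBundle 𝓘(ℝ, E) M) ∈ C) fun v hvp hv0 => by
    have hsnd : Tendsto (fun q : Unit × TangentBundle 𝓘(ℝ, E) M => q.2) (𝓝 ((), v)) (𝓝 v) :=
      continuous_snd.continuousAt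
    refine hsnd.eventually (p := fun v => ℓ (fiberCoord p₀ v) = 0 → ∃ t > (0 : ℝ),
      (⟨v.1, v.2 + t • T v.1⟩ : TangentBundle 𝓘(ℝ, E) M) ∈ C) ?_
    obtain ⟨p, v⟩ := v
    obtain rfl : p = p₀ := hvp
    by_cases hv : ℓ₀ v = 0
    · obtain ⟨t, ht, htC⟩ := (hA p).exists_add_smul_mem hℓ₀ hv₀A hv hv0
      have htC' : (⟨p, v + t • T p⟩ : TangentBundle 𝓘(ℝ, E) M) ∈ C := by
        rw [hTp₀]
        exact htC
      have hTA' : T p ∈ A p := by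
        rw [hTp₀]
        exact hv₀A
      obtain ⟨τ, hτ, hτv, hτC⟩ := hC.exists_crossing hk (v := ⟨p, v⟩)
        (hTs.contMDiffAt (baseSet_mem_nhds p)) (hA p) hTA' htC'
      have h1 : ∀ᶠ w in 𝓝 (⟨p, v⟩ : TangentBundle 𝓘(ℝ, E) M), 0 < τ w :=
        hτ.continuousAt.eventually (lt_mem_nhds (by rw [hτv]; exact ht))
      filter_upwards [h1, hτC] with w hw hwC _
      exact ⟨τ w, hw, hwC⟩
    · have h1 : ContinuousAt (fun v => ℓ (fiberCoord p v)) (⟨p, v⟩ : TangentBundle 𝓘(ℝ, E) M) :=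
        ℓ.continuous.continuousAt.comp (continuousAt_fiberCoord hp₀)
      have h2 : ∀ᶠ w in 𝓝 (⟨p, v⟩ : TangentBundle 𝓘(ℝ, E) M), ℓ (fiberCoord p w) ≠ 0 :=
        h1.eventually (isOpen_ne.mem_nhds fun h0 => hv ((hℓ v).symm.trans h0))
      filter_upwards [h2] with w hw hw'
      exact absurd hw' hw
  have key' : ∀ᶠ p in 𝓝 p₀, ∀ v : TangentSpace 𝓘(ℝ, E) p,
      ‖fiberCoord p₀ ⟨p, v⟩‖ = 1 → ℓ (fiberCoord p₀ ⟨p, v⟩) = 0 →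
      ∃ t > (0 : ℝ), (⟨p, v + t • T p⟩ : TangentBundle 𝓘(ℝ, E) M) ∈ C :=
    key.curry_nhds.self_of_nhds
  refine ⟨_, inter_mem key' (baseSet_mem_nhds p₀), T, ℓ, hTs.mono inter_subset_right, ?_⟩
  rintro p ⟨hp, hpb⟩
  refine ⟨hpb, (hA p).mem_interior_of_forall_exists hn (v := T p)
    (ℓ := ContinuousLinearMap.comp (M₂ := E) ℓ
      ((trivializationAt E (TangentSpace 𝓘(ℝ, E) (M := M)) p₀).continuousLinearEquivAt ℝ p hpb :
        TangentSpace 𝓘(ℝ, E) p →L[ℝ] E)) ?_ ?_⟩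
  · show ℓ (fiberCoord p₀ ⟨p, T p⟩) = 1
    rw [hTA p hpb, hy₀, hℓ, hv₀]
  · intro u hu hu0
    have hu : ℓ (fiberCoord p₀ ⟨p, u⟩) = 0 := hu
    obtain ⟨u', hu', hru, -, hr⟩ := exists_unit_scale (E := E) hpb hu0
    set r := ‖fiberCoord p₀ (⟨p, u⟩ : TangentBundle 𝓘(ℝ, E) M)‖
    have h1 : ℓ (fiberCoord p₀ ⟨p, u'⟩) = 0 := by
      have h2 : fiberCoord p₀ ⟨p, u⟩ = r • fiberCoord p₀ ⟨p, u'⟩ :=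
        (congrArg (fun x : E => fiberCoord p₀ ⟨p, x⟩) hru).trans (fiberCoord_smul hpb r u')
      rw [h2, map_smul, smul_eq_mul] at hu
      exact (mul_eq_zero.1 hu).resolve_left hr.ne'
    obtain ⟨t, ht, htC⟩ := hp u' hu' h1
    refine ⟨r * t, mul_pos hr ht, ?_⟩
    have h3 := (hA p).conic _ htC r hr
    have h4 (a b c : E) (hc : c = r • a) (hm : r • (a + t • b) ∈ fiberAt C p) :
        c + (r * t) • b ∈ fiberAt C p := by
      rwa [hc, ← smul_smul, ← smul_add]
    exact h4 u' (T p) u hru h3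

/-- Lying in a convex interior and being positive on its closure are convex conditions on the vector
and on the form, so partitions of unity preserve them. -/
theorem IsConeStructure.exists_field_form [T2Space M] [SigmaCompactSpace M]
    (hC : IsConeStructure k C) (hk : 1 ≤ k) (hn : 2 ≤ Module.finrank ℝ E) {A : M → Set E}
    (hA : ∀ p, IsStrongConeWithInterior k (fiberAt C p) (A p)) :
    ∃ (Ω : (p : M) → TangentSpace 𝓘(ℝ, E) p →L[ℝ] ℝ) (T : (p : M) → TangentSpace 𝓘(ℝ, E) p),
      ContMDiff 𝓘(ℝ, E).tangent 𝓘(ℝ, ℝ) k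
        (fun v : TangentBundle 𝓘(ℝ, E) M => Ω v.1 v.2) ∧
      ContMDiff 𝓘(ℝ, E) 𝓘(ℝ, E).tangent k (fun p => (⟨p, T p⟩ : TangentBundle 𝓘(ℝ, E) M)) ∧
      (∀ p, Ω p (T p) = 1) ∧ (∀ p, T p ∈ A p) ∧ ∀ p, ∀ w ∈ closure (A p), w ≠ 0 → 0 < Ω p w := by
  choose W hW T₀ ℓ hT₀ hWp using hC.exists_local_field_form hk hn hA
  obtain ⟨T, hT⟩ := exists_contMDiffSection_forall_mem_convex_of_local 𝓘(ℝ, E) (n := k)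
    (TangentSpace 𝓘(ℝ, E) (M := M)) (F_fiber := E) (fun p => A p)
    (fun p => (hA p).convex_interior)
    fun p => ⟨W p, hW p, T₀ p, hT₀ p, fun q hq => (hWp p q hq).2.1⟩
  obtain ⟨ρ, hρ⟩ := SmoothPartitionOfUnity.exists_isSubordinate 𝓘(ℝ, E) isClosed_univ
    (fun p => interior (W p)) (fun _ => isOpen_interior)
    fun p _ => mem_iUnion.2 ⟨p, mem_interior_iff_mem_nhds.2 (hW p)⟩
  let L : M → (p : M) → E →L[ℝ] ℝ := fun i p => (ℓ i) ∘L
    ((trivializationAt E (TangentSpace 𝓘(ℝ, E) (M := M)) i).continuousLinearMapAt ℝ p)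
  have hL (i p : M) (hp : p ∈ W i) (v : E) : L i p v = ℓ i (fiberCoord i ⟨p, v⟩) :=
    congrArg (ℓ i) ((trivializationAt E (TangentSpace 𝓘(ℝ, E) (M := M))
      i).continuousLinearMapAt_apply_of_mem (R := ℝ) (hWp i p hp).1 v)
  have hsum (p : M) (v : E) : (∑ i ∈ ρ.finsupport p, ρ i p • L i p) v =
      ∑ i ∈ ρ.finsupport p, ρ i p * L i p v := by
    simp only [sum_apply, smul_apply, smul_eq_mul]
  let Λ : M → E →L[ℝ] ℝ := fun p => ∑ i ∈ ρ.finsupport p, ρ i p • L i p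
  have hΛpos : ∀ p, ∀ w ∈ closure (A p), w ≠ 0 → 0 < Λ p w := by
    intro p w hw hw0
    rw [hsum]
    refine Finset.sum_pos (fun i hi => ?_) ?_
    · have h0 : ρ i p ≠ 0 := by simpa using hi
      have hp : p ∈ W i := interior_subset (hρ i (subset_tsupport _ h0))
      refine mul_pos ((ρ.nonneg i p).lt_of_ne' h0) ?_
      rw [hL i p hp]
      exact (hWp i p hp).2.2 w hw hw0
    · obtain ⟨i, hi⟩ := ρ.exists_pos_of_mem (mem_univ p)
      exact ⟨i, by simpa using hi.ne'⟩
  have hΛs : ContMDiff 𝓘(ℝ, E).tangent 𝓘(ℝ, ℝ) k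
      (fun v : TangentBundle 𝓘(ℝ, E) M => Λ v.1 v.2) := by
    have := ρ.contMDiff_sum_tangentBundle (fun _ => isOpen_interior) hρ (n := k)
      (g := fun i v => L i v.1 v.2) fun i => by
        refine (((ℓ i).contDiff.contMDiff (n := k)).comp_contMDiffOn
          (((contMDiffOn_fiberCoord i).of_le (by exact_mod_cast le_top)).mono
            fun v hv => (hWp i v.1 (interior_subset hv)).1)).congr fun v hv => ?_
        exact hL i v.1 (interior_subset hv) v.2
    exact this.congr fun v => hsum v.1 v.2
  have hTs : ContMDiff 𝓘(ℝ, E) 𝓘(ℝ, E).tangent k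
      (fun p => (⟨p, T p⟩ : TangentBundle 𝓘(ℝ, E) M)) := T.contMDiff
  have hT0 : ∀ p, 0 < Λ p (T p) := fun p =>
    hΛpos p (T p) (subset_closure (hT p)) fun h0 => (hA p).zero_notMem_interior (h0 ▸ hT p)
  -- Normalization to `Ω T = 1`, harmless for positivity because `T` is interior and so `Λ T > 0`.
  refine ⟨fun p => (Λ p (T p))⁻¹ • Λ p, T, ?_, hTs, fun p => ?_, hT, fun p w hw hw0 => ?_⟩
  · have h1 : ContMDiff 𝓘(ℝ, E).tangent 𝓘(ℝ, ℝ) k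
        (fun v : TangentBundle 𝓘(ℝ, E) M => Λ v.1 (T v.1)) :=
      hΛs.comp (hTs.comp (contMDiff_proj (TangentSpace 𝓘(ℝ, E) (M := M))))
    exact (h1.inv₀ fun v => (hT0 v.1).ne').mul hΛs
  · exact inv_mul_cancel₀ (hT0 p).ne'
  · exact mul_pos (inv_pos.2 (hT0 p)) (hΛpos p w hw hw0)

end Gluing

/-! ### The crossing parameter and its convexity -/

section Crossing

variable {E : Type*} [NormedAddCommGroup E] [NormedSpace ℝ E]

/-- The parameter at which the line through `w` with direction `T` crosses `C`, or `0` if it does not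
cross `C`. -/
noncomputable def crossingParameter (C : Set E) (T w : E) : ℝ :=
  sInf {t : ℝ | w + t • T ∈ C}

theorem deriv_deriv_sq {γ : ℝ → ℝ} (hγ : ContDiffAt ℝ 2 γ 0) :
    deriv (deriv fun r => γ r ^ 2) 0 = 2 * deriv γ 0 ^ 2 + 2 * γ 0 * deriv (deriv γ) 0 := by
  have h1 : ∀ᶠ r in 𝓝 (0 : ℝ), DifferentiableAt ℝ γ r :=
    (hγ.eventually (by simp)).mono fun y hy => hy.differentiableAt (by simp)
  have h2 : deriv (fun r => γ r ^ 2) =ᶠ[𝓝 0] fun r => 2 * (γ r * deriv γ r) := by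
    filter_upwards [h1] with r hr
    have := (hr.hasDerivAt.pow 2).deriv
    simp only [Nat.cast_ofNat, Nat.add_one_sub_one, pow_one] at this
    rw [← mul_assoc]
    exact this
  have h3 : HasDerivAt (fun r => 2 * (γ r * deriv γ r)) _ 0 :=
    (h1.self_of_nhds.hasDerivAt.mul (hasDerivAt_deriv_of_contDiffAt hγ)).const_mul 2
  rw [h2.deriv_eq, h3.deriv]
  ring

namespace IsStrongConeWithInterior

variable {k : ℕ∞} {C A : Set E} (h : IsStrongConeWithInterior k C A)
include h

theorem crossingParameter_eq {T w : E} (hT : T ∈ A) {t : ℝ} (ht : w + t • T ∈ C) :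
    crossingParameter C T w = t := by
  have : {t : ℝ | w + t • T ∈ C} = {t} :=
    subset_antisymm (fun s hs => h.eq_of_add_smul_mem hT hs ht) (singleton_subset_iff.2 ht)
  rw [crossingParameter, this, csInf_singleton]

theorem crossingParameter_add_smul {T w : E} (hT : T ∈ A) {t : ℝ} (ht : w + t • T ∈ C) (s : ℝ) :
    crossingParameter C T (w + s • T) = t - s :=
  h.crossingParameter_eq hT (by rwa [add_assoc, ← add_smul, add_sub_cancel])

/-- The line `ℝ T` misses the cone, so the value is the default infimum of the empty set, which is
the one a Finsler metric needs at `0`. -/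
theorem crossingParameter_zero {T : E} (hT : T ∈ A) : crossingParameter C T 0 = 0 := by
  have : {t : ℝ | (0 : E) + t • T ∈ C} = ∅ :=
    eq_empty_of_forall_notMem fun t ht => h.smul_notMem hT t (by simpa using ht)
  rw [crossingParameter, this, Real.sInf_empty]

theorem crossingParameter_smul {T w : E} (hT : T ∈ A) {t : ℝ} (ht : w + t • T ∈ C) {c : ℝ}
    (hc : 0 < c) : crossingParameter C T (c • w) = c * t :=
  h.crossingParameter_eq hT (by rw [← smul_smul, ← smul_add]; exact h.conic _ ht c hc)

/-- Shifting the point by `s T` lowers the parameter by `s`, so its negative has derivative `1`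
along `T`; off `ℝ T` it vanishes exactly on the cone. -/
theorem isLocalDefiningFunction_crossingParameter (hk : 1 ≤ k) {ℓ : E →L[ℝ] ℝ} {T : E}
    (hT : T ∈ A) (hcr : ∀ w, w - ℓ w • T ≠ 0 → ∃ t : ℝ, w + t • T ∈ C)
    (hsm : ∀ w (t : ℝ), w + t • T ∈ C → ContDiffAt ℝ k (crossingParameter C T) w) {c : E} (hc : c ∈ C)
    (hc0 : c - ℓ c • T ≠ 0) :
    fderiv ℝ (fun w => -crossingParameter C T w) c T = 1 ∧
    IsLocalDefiningFunction 𝓘(ℝ, E) k C c {w | w - ℓ w • T ≠ 0}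
      (fun w => -crossingParameter C T w) := by
  have hk0 : (k : WithTop ℕ∞) ≠ 0 := by
    have : k ≠ 0 := fun h0 => by simp [h0] at hk
    exact_mod_cast this
  have hc' : c + (0 : ℝ) • T ∈ C := by rwa [zero_smul, add_zero]
  have h1 : fderiv ℝ (fun w => -crossingParameter C T w) c T = 1 := by
    refine fderiv_apply_of_map_add_smul ((hsm c 0 hc').neg.differentiableAt hk0) fun s => ?_
    rw [h.crossingParameter_add_smul hT hc', h.crossingParameter_eq hT hc']
    ring
  refine ⟨h1, isOpen_ne_fun (by fun_prop) continuous_const, hc0, fun w hw => ?_, fun h0 => ?_, ?_⟩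
  · obtain ⟨t, ht⟩ := hcr w hw
    exact (hsm w t ht).neg.contMDiffAt.contMDiffWithinAt
  · have h2 : fderiv ℝ (fun w => -crossingParameter C T w) c = 0 := mfderiv_eq_fderiv.symm.trans h0
    rw [h2] at h1
    exact zero_ne_one h1
  · ext w
    refine ⟨fun hw => ⟨hw.2, ?_⟩, fun hw => ⟨?_, hw.1⟩⟩
    · rw [h.crossingParameter_eq hT (t := 0) (by rw [zero_smul, add_zero]; exact hw.1), neg_zero]
    · obtain ⟨t, ht⟩ := hcr w hw.1
      have h2 := hw.2
      rw [h.crossingParameter_eq hT ht, neg_eq_zero] at h2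
      rwa [h2, zero_smul, add_zero] at ht

/-- Non-radial strong convexity of the cone gives strong convexity of the squared crossing
parameter. -/
theorem deriv_deriv_sq_crossingParameter_pos (hk : 2 ≤ k) {ℓ : E →L[ℝ] ℝ} {T : E} (hT : T ∈ A)
    (hℓT : ℓ T = 1) (hcr : ∀ w, w - ℓ w • T ≠ 0 → ∃ t : ℝ, w + t • T ∈ C)
    (hsm : ∀ w (t : ℝ), w + t • T ∈ C → ContDiffAt ℝ k (crossingParameter C T) w) {v u : E}
    (hv : ℓ v = 0) (hu : ℓ u = 0) (hv0 : v ≠ 0) (hu0 : u ≠ 0) {t₀ : ℝ} (ht₀ : 0 < t₀)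
    (hc : v + t₀ • T ∈ C) :
    0 < deriv (deriv fun r : ℝ => crossingParameter C T (v + r • u) ^ 2) 0 := by
  have hk2 : (2 : WithTop ℕ∞) ≤ k := WithTop.coe_le_coe.2 hk
  set g := crossingParameter C T with hg
  set c := v + t₀ • T with hcdef
  have hc' : c + (0 : ℝ) • T ∈ C := by rwa [zero_smul, add_zero]
  have hπc : c - ℓ c • T = v := by simp [hcdef, hv, hℓT]
  obtain ⟨hfT, hf⟩ := h.isLocalDefiningFunction_crossingParameter (le_trans (by norm_num) hk) hT hcr
    hsm hc (by rwa [hπc])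
  rw [← hg] at hfT hf
  have hgv : ContDiffAt ℝ 2 g v := (hsm v t₀ hc).of_le hk2
  have hfc : ContDiffAt ℝ 2 (fun w => -g w) c := ((hsm c 0 hc').of_le hk2).neg
  -- With the defining function `-g` and transverse direction `T`, the denominator of the second
  -- fundamental form is `1`, so the form is minus the Hessian of `-g`.
  obtain ⟨hpsd, hrad⟩ := h.stronglyConvex c hc _ _ hf T (by rw [hfT]; exact one_ne_zero) (by
    filter_upwards [self_mem_nhdsWithin] with t ht
    exact h.add_smul_mem_interior (h.mem_closure hc) hT ht)
  set D := fderiv ℝ (fderiv ℝ fun w => -g w) c with hD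
  have hσ (X Y : E) : affineSecondFundamentalForm (fun w => -g w) c T X Y = -D X Y := by
    rw [affineSecondFundamentalForm, hfT, div_one]
  simp only [hσ] at hpsd hrad
  set γ : ℝ → ℝ := fun r => g (v + r • u) with hγdef
  have hγ : ContDiffAt ℝ 2 γ 0 := by
    have h1 : ContDiff ℝ 2 fun r : ℝ => v + r • u := by fun_prop
    refine ContDiffAt.comp (g := g) (f := fun r : ℝ => v + r • u) 0 ?_ h1.contDiffAt
    simpa using hgv
  have hγ0 : γ 0 = t₀ := by
    simp only [hγdef, zero_smul, add_zero]
    exact h.crossingParameter_eq hT hc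
  set a := deriv γ 0 with ha
  -- The tangent lift of `u` to the cone. Since `-g` is affine along `T`, its second derivative
  -- along `X` is that of `-γ`.
  set X := u + a • T with hX
  have hline : (fun r : ℝ => -g (c + r • X)) =ᶠ[𝓝 0] fun r => -γ r + (t₀ + r * a) := by
    have h1 : Continuous fun r : ℝ => v + r • u := by fun_prop
    have h2 : ∀ᶠ r in 𝓝 (0 : ℝ), v + r • u ≠ 0 :=
      h1.continuousAt.eventually (isOpen_ne.mem_nhds (by simpa using hv0))
    filter_upwards [h2] with r hr
    obtain ⟨t, ht⟩ := hcr (v + r • u) (by simpa [hv, hu] using hr)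
    have h3 : c + r • X = v + r • u + (t₀ + r * a) • T := by
      rw [hcdef, hX]; module
    rw [h3, hg, h.crossingParameter_add_smul hT ht, hγdef]
    simp only [hg]
    rw [h.crossingParameter_eq hT ht]
    ring
  have hfX : fderiv ℝ (fun w => -g w) c X = 0 := by
    have h1 := (hfc.differentiableAt two_ne_zero).hasFDerivAt.hasLineDerivAt X
    have h2 : HasDerivAt (fun r : ℝ => -g (c + r • X)) (-a + a) 0 := by
      refine HasDerivAt.congr_of_eventuallyEq ?_ hline
      refine ((hγ.differentiableAt two_ne_zero).hasDerivAt.neg).add ?_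
      simpa using ((hasDerivAt_id (0 : ℝ)).mul_const a).const_add t₀
    exact (HasDerivAt.unique h1 h2).trans (neg_add_cancel a)
  have hDX : D X X = -deriv (deriv γ) 0 := by
    have h1 := fundamentalTensor_eq_fderiv hfc X X
    rw [fundamentalTensor_self] at h1
    have h2 : deriv (deriv fun r : ℝ => -g (c + r • X)) 0 = D X X :=
      mul_left_cancel₀ (by norm_num) h1
    have h3 : deriv (fun r => -γ r + (t₀ + r * a)) =ᶠ[𝓝 0] fun r => -deriv γ r + a := by
      filter_upwards [hγ.eventually (by simp)] with r hr
      refine HasDerivAt.deriv (((hr.differentiableAt two_ne_zero).hasDerivAt.neg).add ?_)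
      simpa using ((hasDerivAt_id r).mul_const a).const_add t₀
    rw [← h2, (hline.deriv.trans h3).deriv_eq, deriv_add_const, deriv.fun_neg]
  have hnonneg := hpsd X hfX
  rw [hDX, neg_neg] at hnonneg
  rw [deriv_deriv_sq hγ, hγ0]
  rcases hnonneg.eq_or_lt with h0 | hpos
  · have hsymm : ∀ Y Z, D Y Z = D Z Y := hfc.isSymmSndFDerivAt (by simp)
    have hXrad : X ∈ Submodule.span ℝ {c} := by
      refine (hrad X hfX).1 fun Y hY => ?_
      rw [neg_eq_zero]
      -- Degenerate Cauchy-Schwarz: when the form vanishes at `X`, its value at `Y + s X` is affine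
      -- in `s` and nonnegative, so the mixed term is zero and `X` is in the radical.
      have hquad (s : ℝ) : 0 ≤ -D Y Y - 2 * s * D X Y := by
        have := hpsd (Y + s • X) (by rw [map_add, map_smul, hY, hfX, smul_zero, add_zero])
        simp only [map_add, map_smul, add_apply, smul_apply, smul_eq_mul, hsymm Y X, hDX,
          ← h0] at this
        linarith
      by_contra hne
      have := hquad ((-D Y Y + 1) / (2 * D X Y))
      have e : 2 * ((-D Y Y + 1) / (2 * D X Y)) * D X Y = -D Y Y + 1 := by field_simp
      linarith
    -- With `X = m c`, applying `ℓ` gives `a = m t₀`. If `a` were zero, so would be `m`, and hence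
    -- `u`. Thus `γ' ≠ 0`, and the square of the first derivative provides strict positivity.
    obtain ⟨m, hm⟩ := Submodule.mem_span_singleton.1 hXrad
    have h1 := congrArg ℓ hm
    simp only [hcdef, hX, map_add, map_smul, hv, hu, hℓT, smul_eq_mul, mul_one, zero_add] at h1
    have h2 : a ≠ 0 := by
      intro ha0
      rw [ha0] at h1
      have hm0 := (mul_eq_zero.1 h1).resolve_right ht₀.ne'
      rw [hm0, hX, ha0, zero_smul, zero_smul, add_zero] at hm
      exact hu0 hm.symm
    rw [← h0]
    positivity
  · positivity

end IsStrongConeWithInterior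

end Crossing

/-! ### Existence of a cone triple and the main theorem -/

section ConeTriple

variable {E : Type*} [NormedAddCommGroup E] [NormedSpace ℝ E] [FiniteDimensional ℝ E]
  {M : Type*} [TopologicalSpace M] [ChartedSpace E M] [IsManifold 𝓘(ℝ, E) ∞ M]
  {k : ℕ∞} {C : Set (TangentBundle 𝓘(ℝ, E) M)}

/-- The Finsler metric determined by a cone structure and a field of directions. -/
noncomputable def coneFinsler (C : Set (TangentBundle 𝓘(ℝ, E) M))
    (T : (p : M) → TangentSpace 𝓘(ℝ, E) p) (v : TangentBundle 𝓘(ℝ, E) M) : ℝ :=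
  crossingParameter (E := E) (fiberAt C v.1) (T v.1) v.2

/-- The implicit function gives some crossing parameter near `v`; crossings are unique, so it agrees
with the globally defined one. -/
theorem IsConeStructure.contMDiffAt_coneFinsler (hC : IsConeStructure k C) (hk : 1 ≤ k)
    {A : M → Set E} (hA : ∀ p, IsStrongConeWithInterior k (fiberAt C p) (A p))
    {T : (p : M) → TangentSpace 𝓘(ℝ, E) p} (hT : ContMDiff 𝓘(ℝ, E) 𝓘(ℝ, E).tangent k
      (fun p => (⟨p, T p⟩ : TangentBundle 𝓘(ℝ, E) M))) (hTA : ∀ p, T p ∈ A p)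
    {v : TangentBundle 𝓘(ℝ, E) M} {t : ℝ}
    (ht : (⟨v.1, v.2 + t • T v.1⟩ : TangentBundle 𝓘(ℝ, E) M) ∈ C) :
    ContMDiffAt 𝓘(ℝ, E).tangent 𝓘(ℝ, ℝ) k (coneFinsler C T) v := by
  obtain ⟨τ, hτ, -, hτC⟩ := hC.exists_crossing hk hT.contMDiffAt (hA v.1) (hTA v.1) ht
  refine hτ.congr_of_eventuallyEq ?_
  filter_upwards [hτC] with w hw
  exact (hA w.1).crossingParameter_eq (hTA w.1) hw

theorem IsConeStructure.exists_coneTriple [T2Space M] [SigmaCompactSpace M]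
    (hC : IsConeStructure k C) (hk : 2 ≤ k) (hn : 2 ≤ Module.finrank ℝ E) :
    ∃ Ω T F, IsConeTriple k Ω T F ∧ IsAssociatedTriple Ω T F C := by
  have hk1 : 1 ≤ k := le_trans (by norm_num) hk
  choose A hA using hC.strongCone
  obtain ⟨Ω, T, hΩ, hT, hΩT, hTA, hpos⟩ := hC.exists_field_form hk1 hn hA
  have hcross (p : M) (w : TangentSpace 𝓘(ℝ, E) p) (hw : Ω p w = 0) (hw0 : w ≠ 0) :
      ∃ t > (0 : ℝ), (⟨p, w + t • T p⟩ : TangentBundle 𝓘(ℝ, E) M) ∈ C :=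
    (hA p).exists_add_smul_mem (hpos p) (hTA p) hw hw0
  have hF (p : M) (w : TangentSpace 𝓘(ℝ, E) p) (t : ℝ)
      (ht : (⟨p, w + t • T p⟩ : TangentBundle 𝓘(ℝ, E) M) ∈ C) : coneFinsler C T ⟨p, w⟩ = t :=
    (hA p).crossingParameter_eq (hTA p) ht
  have hF0 (v : TangentBundle 𝓘(ℝ, E) M) (hv : v ∈ zeroVectors E M) : coneFinsler C T v = 0 := by
    obtain ⟨p, v⟩ := v
    obtain rfl : v = (0 : E) := hv
    exact (hA p).crossingParameter_zero (hTA p)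
  have hker (v : TangentBundle 𝓘(ℝ, E) M) : Ω v.1 (v.2 - Ω v.1 v.2 • T v.1) = 0 := by
    rw [map_sub, map_smul, hΩT]
    simp
  refine ⟨Ω, T, coneFinsler C T, ⟨hΩ, hT, hΩT, ?_, hF0, ?_, ?_, ?_⟩, ?_⟩
  · rintro v ⟨hv, hv0⟩
    obtain ⟨t, -, ht⟩ := hcross v.1 v.2 hv hv0
    exact (hC.contMDiffAt_coneFinsler hk1 hA hT hTA ht).contMDiffWithinAt
  · intro v hv hv0
    obtain ⟨t, ht, htC⟩ := hcross v.1 v.2 hv hv0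
    exact ht.trans_eq (hF v.1 v.2 t htC).symm
  · intro v hv c hc
    by_cases hv0 : v ∈ zeroVectors E M
    · have h1 : scaleVector c v ∈ zeroVectors E M := by
        have h2 : v.2 = 0 := hv0
        show c • v.2 = 0
        rw [h2, smul_zero]
      rw [hF0 _ hv0, hF0 _ h1, mul_zero]
    · obtain ⟨t, -, ht⟩ := hcross v.1 v.2 hv hv0
      rw [show coneFinsler C T v = t from hF v.1 v.2 t ht]
      exact (hA v.1).crossingParameter_smul (hTA v.1) ht hc
  · intro p v u hv hu hv0 hu0
    obtain ⟨t, ht, htC⟩ := hcross p v hv hv0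
    rw [fundamentalTensor_self]
    refine mul_pos (by norm_num) ((hA p).deriv_deriv_sq_crossingParameter_pos hk (ℓ := Ω p)
      (hTA p) (hΩT p) (fun w hw => ?_) (fun w s hs => ?_) hv hu hv0 hu0 ht htC)
    · obtain ⟨s, -, hs⟩ := hcross p _ (hker ⟨p, w⟩) hw
      refine ⟨s - Ω p w, ?_⟩
      have e (x y : E) (r : ℝ) (hm : x - r • y + s • y ∈ fiberAt C p) :
          x + (s - r) • y ∈ fiberAt C p := by
        convert hm using 1
        module
      exact e w (T p) (Ω p w) hs
    · have h1 := hC.contMDiffAt_coneFinsler hk1 hA hT hTA (v := ⟨p, w⟩) hs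
      exact (ContMDiffAt.comp (I' := 𝓘(ℝ, E).tangent) (g := coneFinsler C T)
        (f := fun w : E => (⟨p, w⟩ : TangentBundle 𝓘(ℝ, E) M)) w h1
        (contMDiff_fiberInclusion p).contMDiffAt).contDiffAt
  · intro v hv0
    have hsub : v.2 = Ω v.1 v.2 • T v.1 + (v.2 - Ω v.1 v.2 • T v.1) := (add_sub_cancel _ _).symm
    -- On `ℝ T` both sides fail: interior lines miss the cone, and the equation would force `v = 0`.
    by_cases hπ : v.2 - Ω v.1 v.2 • T v.1 = 0
    · have h1 : coneFinsler C T (kerProj Ω T v) = 0 := hF0 _ hπ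
      refine iff_of_false (fun hv => ?_) fun hv => hv0 ?_
      · refine (hA v.1).smul_notMem (hTA v.1) (Ω v.1 v.2) ?_
        have h2 : v.2 = Ω v.1 v.2 • T v.1 := sub_eq_zero.1 hπ
        have h3 : v.2 ∈ fiberAt C v.1 := hv
        exact (congrArg (· ∈ fiberAt C v.1) h2).mp h3
      · rw [h1, zero_smul, hπ, add_zero] at hv
        exact hv
    · obtain ⟨t, ht, htC⟩ := hcross v.1 _ (hker v) hπ
      have h1 : coneFinsler C T (kerProj Ω T v) = t := hF v.1 _ t htC
      rw [h1]
      constructor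
      · intro hv
        have h2 := hF v.1 (v.2 - Ω v.1 v.2 • T v.1) (Ω v.1 v.2) (by
          rw [sub_add_cancel]
          exact hv)
        rw [← h2.symm.trans h1]
        exact hsub
      · intro hv
        rw [add_comm, ← hv] at htC
        exact htC

end ConeTriple

theorem mainTheorem2 {E : Type*} [NormedAddCommGroup E] [NormedSpace ℝ E] [FiniteDimensional ℝ E]
    (hn : 2 ≤ Module.finrank ℝ E)
    {M : Type*} [TopologicalSpace M] [T2Space M] [SecondCountableTopology M]
    [ChartedSpace E M] [IsManifold 𝓘(ℝ, E) ∞ M]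
    (k : ℕ∞) (hk : 2 ≤ k)
    (C : Set (TangentBundle 𝓘(ℝ, E) M)) (hC : IsConeStructure k C) :
    (∃ L : TangentBundle 𝓘(ℝ, E) M → ℝ, IsGlobalLorentzFinslerMetricWithCone k C L) ∧
    (∃ Ω T F, IsConeTriple k Ω T F ∧ IsAssociatedTriple Ω T F C) ∧
    ∀ Ω T F, IsConeTriple k Ω T F → IsAssociatedTriple Ω T F C →
      ∀ U : Set (TangentBundle 𝓘(ℝ, E) M), IsOpen U →
        (∀ p, (⟨p, T p⟩ : TangentBundle 𝓘(ℝ, E) M) ∈ U) →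
        ∃ L : TangentBundle 𝓘(ℝ, E) M → ℝ, IsGlobalLorentzFinslerMetricWithCone k C L ∧
          ∀ v, v ∉ radialSaturation U → reflectVector Ω T v ∉ radialSaturation U →
            L v = continuousMetric Ω T F v := by
  -- Local compactness and second countability give σ-compactness, hence partitions of unity.
  have : LocallyCompactSpace M := Manifold.locallyCompact_of_finiteDimensional 𝓘(ℝ, E)
  have : SigmaCompactSpace M := inferInstance
  have h2 := hC.exists_coneTriple hk hn
  refine ⟨?_, h2, fun Ω T F h hTC U hU hTU =>
    h.exists_isGlobalLorentzFinslerMetricWithCone hk hC hTC hU hTU⟩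
  obtain ⟨Ω, T, F, h, hTC⟩ := h2
  -- With the whole bundle as neighbourhood the agreement clause carries no information, and
  -- existence of the metric remains.
  obtain ⟨L, hL, -⟩ := h.exists_isGlobalLorentzFinslerMetricWithCone hk hC hTC isOpen_univ
    fun _ => mem_univ _
  exact ⟨L, hL⟩
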